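/- Let $U\subseteq\mathbb R^n$ be open, with coordinates $u^1,\dots,u^n$, and let $$P_1^{ij}=g^{ij}\frac{d}{dx}+\Gamma^{ij}_k u^k_x$$ be a Hamiltonian operator of hydrodynamic type written in flat coordinates: $g^{ij}$ is a symmetric non-degenerate matrix, constant on $U$, and $\Gamma^{ij}_k=-g^{ir}\Gamma^j_{rk}$ with $\Gamma^j_{rk}$ the Christoffel symbols of the Levi-Civita connection of $g_{ij}$ (so $\Gamma^{ij}_k=0$). Let $$P_2^{ij}=a^{ij}\Big(\frac{d}{dx}\Big)^2+b^{ij}_k u^k_x\frac{d}{dx}+c^{ij}_{kl}u^k_xu^l_x+c^{ij}_k u^k_{xx}$$ with coefficients smooth functions of $u\in U$ and $c^{ij}_{kl}=c^{ij}_{lk}$. An operator $P$ defines the bracket $\{F,G\}_P=\int_{S^1}\frac{\delta F}{\delta u^i}P^{ij}\big(\frac{\delta G}{\delta u^j}\big)dx$ of local functionals $F=\int_{S^1} f(x,u,u_x,\dots,u^{(m)})\,dx$ ($f$ smooth, $m$ arbitrary) on the space of smooth loops $u:S^1\to U$. Call $P_2$ an infinitesimal deformation of $P_1$ on $U$ if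 $\{\cdot,\cdot\}_{P_2}$ is skew-symmetric and $P_1+\varepsilon P_2$ satisfies the Jacobi identity to order $\varepsilon$, i.e. for all local functionals $F,G,H$ and all loops $u$ in $U$ the cyclic sum of $\{\{F,G\},H\}$ for $P_1+\varepsilon P_2$, evaluated at $u$, is $O(\varepsilon^2)$ as $\varepsilon\to0$. For a smooth $(1,1)$-tensor field $A^i_j$ consider the formulas $$\begin{aligned} a^{ij}&=g^{ir}A^j_r-g^{jr}A^i_r,\\ b^{ij}_k&=2g^{is}A^j_{s,k}-g^{jr}A^i_{k,r}-g^{is}A^j_{k,s},\\ c^{ij}_{kl}&=g^{is}A^j_{s,kl}-g^{is}A^j_{(k,l)s},\\ c^{ij}_k&=g^{is}A^j_{s,k}-g^{is}A^j_{k,s}, \end{aligned}\qquad(*)$$ where commas denote partial derivatives and $A^j_{(k,l)s}=\tfrac12(A^j_{k,ls}+A^j_{l,ks})$. 1. If $P_2$ is an infinitesimal deformation of $P_1$ on $U$, then on every star-shaped non-empty open set $V\subseteq U$ (in particular near every point) there is a smooth $(1,1)$-tensor field $A^i_j$ such that $(*)$ holds on $V$. 2. Conversely, for every smooth $(1,1)$-tensor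 field $A^i_j$ on $U$, the operator $P_2$ with the coefficients $(*)$ (which are smooth, with $c^{ij}_{kl}=c^{ij}_{lk}$) is an infinitesimal deformation of $P_1$ on $U$. In both cases the deformation is trivial: on $V$, respectively $U$, one has $P_2=-\mathcal L_eP_1$ for the evolutionary vector field $e=-A^i_j(u)\,u^j_x\,\partial/\partial u^i+\dots$, i.e. $\{F,G\}_{P_2}=-\big(e\{F,G\}_{P_1}-\{eF,G\}_{P_1}-\{F,eG\}_{P_1}\big)$ for all local functionals $F,G$, where $eF$ denotes the derivative of $F$ along $e$. -/

import Mathlib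

open scoped ContDiff Topology
open Asymptotics

noncomputable section

/-! ### The loop space of an open set of `ℝⁿ` and local functionals -/

/-- Smooth loops `u : S¹ = ℝ/ℤ → U`, as smooth `1`-periodic curves with values in `U`. -/
def IsLoop {n : ℕ} (U : Set (Fin n → ℝ)) (u : ℝ → Fin n → ℝ) : Prop :=
  ContDiff ℝ ∞ u ∧ Function.Periodic u 1 ∧ ∀ x, u x ∈ U

/-- Functionals on the loop space; only the values on loops matter. -/
abbrev LoopFunctional (n : ℕ) : Type := (ℝ → Fin n → ℝ) → ℝ

/-- Local functionals `F[u] = ∫ f(x, u, u_x, …, u^{(m)}) dx` on the loop space of `U`, with a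
smooth density `f` on the jet space over `S¹ × U`, of arbitrary finite order `m`. -/
def IsLocalFunctional {n : ℕ} (U : Set (Fin n → ℝ)) (F : LoopFunctional n) : Prop :=
  ∃ (m : ℕ) (f : ℝ × (Fin (m + 1) → Fin n → ℝ) → ℝ),
    ContDiffOn ℝ ∞ f {p | p.2 0 ∈ U} ∧
    (∀ x z, z 0 ∈ U → f (x + 1, z) = f (x, z)) ∧
    ∀ u, IsLoop U u → F u = ∫ x in (0 : ℝ)..1, f (x, fun k => iteratedDeriv (k : ℕ) u x)

/-- `ξ = δF/δu` at the loop `u`: the smooth covector field along `u` with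
`d/dt F[u + t v] = ∫ ξ_i v^i dx` at `t = 0` for all smooth periodic `v`. -/
def IsVariationalDerivative {n : ℕ} (F : LoopFunctional n) (u ξ : ℝ → Fin n → ℝ) : Prop :=
  IsLoop Set.univ ξ ∧ ∀ v, IsLoop Set.univ v →
    HasDerivAt (fun t : ℝ => F (u + t • v)) (∫ x in (0 : ℝ)..1, ∑ i, ξ x i * v x i) 0

/-- The variational derivative is unique. -/
theorem IsVariationalDerivative.unique {n : ℕ} {F : LoopFunctional n} {u ξ η : ℝ → Fin n → ℝ}
    (hξ : IsVariationalDerivative F u ξ) (hη : IsVariationalDerivative F u η) : ξ = η := by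
  obtain ⟨⟨sξ, pξ, -⟩, dξ⟩ := hξ
  obtain ⟨⟨sη, pη, -⟩, dη⟩ := hη
  have hv : IsLoop Set.univ (ξ - η) :=
    ⟨sξ.sub sη, fun x => by simp [pξ x, pη x], fun _ => Set.mem_univ _⟩
  have cξ := sξ.continuous
  have cη := sη.continuous
  have h0 := (dξ _ hv).unique (dη _ hv)
  have h1 : ∫ x in (0 : ℝ)..1, ∑ i, (ξ x i - η x i) ^ 2 = 0 := by
    rw [← sub_eq_zero, ← intervalIntegral.integral_sub] at h0
    · rw [← h0]
      congr 1
      ext x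
      rw [← Finset.sum_sub_distrib]
      refine Finset.sum_congr rfl fun i _ => ?_
      simp only [Pi.sub_apply]
      ring
    · exact Continuous.intervalIntegrable (by fun_prop) _ _
    · exact Continuous.intervalIntegrable (by fun_prop) _ _
  have hc : Continuous fun x => ∑ i, (ξ x i - η x i) ^ 2 := by fun_prop
  have hnn : ∀ x, 0 ≤ ∑ i, (ξ x i - η x i) ^ 2 := fun x =>
    Finset.sum_nonneg fun i _ => sq_nonneg _
  have key : ∀ x ∈ Set.Icc (0 : ℝ) 1, ∑ i, (ξ x i - η x i) ^ 2 = 0 := by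
    intro x hx
    by_contra hne
    have := intervalIntegral.integral_pos (a := 0) (b := 1) one_pos hc.continuousOn
      (fun y _ => hnn y) ⟨x, hx, lt_of_le_of_ne (hnn x) (Ne.symm hne)⟩
    linarith
  funext x
  have hper : ∀ y, ξ y - η y = ξ (Int.fract y) - η (Int.fract y) := by
    intro y
    have a1 := pξ.sub_int_mul_eq (x := y) ⌊y⌋
    have a2 := pη.sub_int_mul_eq (x := y) ⌊y⌋
    rw [mul_one] at a1 a2
    rw [Int.fract, a1, a2]
  have hk := key (Int.fract x) ⟨Int.fract_nonneg x, (Int.fract_lt_one x).le⟩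
  rw [Finset.sum_eq_zero_iff_of_nonneg fun i _ => sq_nonneg _] at hk
  rw [← sub_eq_zero, hper x]
  funext i
  exact pow_eq_zero_iff (two_ne_zero) |>.1 (hk i (Finset.mem_univ i))

open Classical in
/-- The variational derivative `δF/δu` (and `0` where there is none). -/
def variationalDerivative {n : ℕ} (F : LoopFunctional n) (u : ℝ → Fin n → ℝ) :
    ℝ → Fin n → ℝ :=
  if h : ∃ ξ, IsVariationalDerivative F u ξ then h.choose else 0

/-! ### Operators and their brackets -/

/-- An operator `P`: at each loop `u` it sends a covector field along `u`
to a vector field along `u`. -/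
abbrev LoopOperator (n : ℕ) : Type :=
  (ℝ → Fin n → ℝ) → (ℝ → Fin n → ℝ) → ℝ → Fin n → ℝ

/-- `{F, G} = ∫ δF/δu^i P^{ij}(δG/δu^j) dx`. -/
def loopBracket {n : ℕ} (P : LoopOperator n) (F G : LoopFunctional n) : LoopFunctional n :=
  fun u => ∫ x in (0 : ℝ)..1,
    ∑ i, variationalDerivative F u x i * P u (variationalDerivative G u) x i

/-- The left hand side of the Jacobi identity. -/
def jacobiator {n : ℕ} (P : LoopOperator n) (F G H : LoopFunctional n) : LoopFunctional n :=
  fun u => loopBracket P (loopBracket P F G) H u + loopBracket P (loopBracket P G H) F u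
    + loopBracket P (loopBracket P H F) G u

/-- `P₂` is skew-symmetric, and `P₁ + ε P₂` satisfies the Jacobi identity to order `ε`, i.e. up
to `O(ε²)`, on all local functionals on the loop space of `U`. -/
def IsInfinitesimalDeformation {n : ℕ} (U : Set (Fin n → ℝ)) (P₁ P₂ : LoopOperator n) : Prop :=
  (∀ F G, IsLocalFunctional U F → IsLocalFunctional U G →
    ∀ u, IsLoop U u → loopBracket P₂ F G u = -loopBracket P₂ G F u) ∧
  ∀ F G H, IsLocalFunctional U F → IsLocalFunctional U G → IsLocalFunctional U H →
    ∀ u, IsLoop U u →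
      (fun ε : ℝ => jacobiator (P₁ + ε • P₂) F G H u) =O[𝓝 0] fun ε : ℝ => ε ^ 2

/-- The derivative of a functional along a vector field `e` on the loop space. -/
def evolutionaryDerivative {n : ℕ} (e : (ℝ → Fin n → ℝ) → ℝ → Fin n → ℝ)
    (F : LoopFunctional n) : LoopFunctional n :=
  fun u => deriv (fun t : ℝ => F (u + t • e u)) 0

/-- The Lie derivative along `e` of the bivector (bracket) with operator `P`:
`(𝓛_e P)(F, G) = e{F, G} - {eF, G} - {F, eG}`. -/
def lieDerivativeBracket {n : ℕ} (e : (ℝ → Fin n → ℝ) → ℝ → Fin n → ℝ) (P : LoopOperator n)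
    (F G : LoopFunctional n) : LoopFunctional n :=
  fun u => evolutionaryDerivative e (loopBracket P F G) u
    - loopBracket P (evolutionaryDerivative e F) G u
    - loopBracket P F (evolutionaryDerivative e G) u

/-! ### Operators of degree 1 and 2 -/

/-- `∂f/∂u^k`. -/
def partialDeriv {n : ℕ} (k : Fin n) (f : (Fin n → ℝ) → ℝ) (u : Fin n → ℝ) : ℝ :=
  fderiv ℝ f u (Pi.single k 1)

/-- The coefficients of `g^{ij}(u) d/dx + Γ^{ij}_k(u) u^k_x`;
here `g u i j = g^{ij}(u)` and `Γ i j k u = Γ^{ij}_k(u)`. -/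
structure HydrodynamicOperator (n : ℕ) where
  g : (Fin n → ℝ) → Matrix (Fin n) (Fin n) ℝ
  Γ : Fin n → Fin n → Fin n → (Fin n → ℝ) → ℝ

/-- The differential operator `g^{ij}(u) d/dx + Γ^{ij}_k(u) u^k_x`. -/
def HydrodynamicOperator.toOperator {n : ℕ} (P : HydrodynamicOperator n) : LoopOperator n :=
  fun u ξ x i => ∑ j,
    (P.g (u x) i j * deriv ξ x j + (∑ k, P.Γ i j k (u x) * deriv u x k) * ξ x j)

/-- The Christoffel symbols
`Γ^j_{rk} = ½ g^{js} (∂_r g_{sk} + ∂_k g_{sr} - ∂_s g_{rk})` of the Levi-Civita connection of the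
metric `g_{ij}` inverse to `g^{ij}`. -/
def christoffel {n : ℕ} (g : (Fin n → ℝ) → Matrix (Fin n) (Fin n) ℝ) (j r k : Fin n)
    (u : Fin n → ℝ) : ℝ :=
  (1 / 2) * ∑ s, g u j s * (partialDeriv r (fun v => (g v)⁻¹ s k) u
    + partialDeriv k (fun v => (g v)⁻¹ s r) u - partialDeriv s (fun v => (g v)⁻¹ r k) u)

/-- `g^{ij}` is symmetric and non-degenerate, `Γ^{ij}_k = -g^{ir} Γ^j_{rk}` with the Levi-Civita
Christoffel symbols of its inverse, and the coordinates on `U` are flat coordinates for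
the metric: its components are constant. -/
def HydrodynamicOperator.IsHamiltonianInFlatCoordinates {n : ℕ} (P : HydrodynamicOperator n)
    (U : Set (Fin n → ℝ)) : Prop :=
  (∀ u ∈ U, (P.g u).IsSymm ∧ IsUnit (P.g u).det) ∧
  (∀ u ∈ U, ∀ i j k, P.Γ i j k u = -∑ r, P.g u i r * christoffel P.g j r k u) ∧
  ∀ u ∈ U, ∀ v ∈ U, P.g u = P.g v

/-- The coefficients of `a^{ij} (d/dx)² + b^{ij}_k u^k_x d/dx + c^{ij}_{kl} u^k_x u^l_x
+ c^{ij}_k u^k_{xx}`; here `cc i j k l = c^{ij}_{kl}` and `c i j k = c^{ij}_k`. -/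
structure SecondOrderOperator (n : ℕ) where
  a : Fin n → Fin n → (Fin n → ℝ) → ℝ
  b : Fin n → Fin n → Fin n → (Fin n → ℝ) → ℝ
  cc : Fin n → Fin n → Fin n → Fin n → (Fin n → ℝ) → ℝ
  c : Fin n → Fin n → Fin n → (Fin n → ℝ) → ℝ

/-- The differential operator with the given coefficients. -/
def SecondOrderOperator.toOperator {n : ℕ} (P : SecondOrderOperator n) : LoopOperator n :=
  fun u ξ x i => ∑ j,
    (P.a i j (u x) * iteratedDeriv 2 ξ x j
      + (∑ k, P.b i j k (u x) * deriv u x k) * deriv ξ x j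
      + ((∑ k, ∑ l, P.cc i j k l (u x) * deriv u x k * deriv u x l)
        + ∑ k, P.c i j k (u x) * iteratedDeriv 2 u x k) * ξ x j)

/-- The coefficients are smooth on `U`, and `c^{ij}_{kl} = c^{ij}_{lk}` (only the symmetric part
enters the operator). -/
def SecondOrderOperator.IsAdmissible {n : ℕ} (P : SecondOrderOperator n)
    (U : Set (Fin n → ℝ)) : Prop :=
  (∀ i j, ContDiffOn ℝ ∞ (P.a i j) U) ∧
  (∀ i j k, ContDiffOn ℝ ∞ (P.b i j k) U) ∧
  (∀ i j k l, ContDiffOn ℝ ∞ (P.cc i j k l) U) ∧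
  (∀ i j k, ContDiffOn ℝ ∞ (P.c i j k) U) ∧
  ∀ u ∈ U, ∀ i j k l, P.cc i j k l u = P.cc i j l k u

/-- A smooth (1,1)-tensor field on `U`, by its components `A i j = A^i_j`. -/
def IsSmoothTensorField {n : ℕ} (A : Fin n → Fin n → (Fin n → ℝ) → ℝ)
    (U : Set (Fin n → ℝ)) : Prop :=
  ∀ i j, ContDiffOn ℝ ∞ (A i j) U

/-- On `U`, the coefficients of `P₂` are
`a^{ij} = g^{ir} A^j_r - g^{jr} A^i_r`,
`b^{ij}_k = 2 g^{is} A^j_{s,k} - g^{jr} A^i_{k,r} - g^{is} A^j_{k,s}`,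
`c^{ij}_{kl} = g^{is} A^j_{s,kl} - g^{is} A^j_{(k,l)s}`,
`c^{ij}_k = g^{is} A^j_{s,k} - g^{is} A^j_{k,s}`. -/
def IsGivenByTensor {n : ℕ} (U : Set (Fin n → ℝ))
    (g : (Fin n → ℝ) → Matrix (Fin n) (Fin n) ℝ)
    (A : Fin n → Fin n → (Fin n → ℝ) → ℝ) (P₂ : SecondOrderOperator n) : Prop :=
  ∀ u ∈ U,
    (∀ i j, P₂.a i j u = ∑ r, g u i r * A j r u - ∑ r, g u j r * A i r u) ∧
    (∀ i j k, P₂.b i j k u = 2 * ∑ s, g u i s * partialDeriv k (A j s) u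
      - ∑ r, g u j r * partialDeriv r (A i k) u - ∑ s, g u i s * partialDeriv s (A j k) u) ∧
    (∀ i j k l, P₂.cc i j k l u =
      ∑ s, g u i s * partialDeriv l (partialDeriv k (A j s)) u
      - ∑ s, g u i s * ((1 / 2) * (partialDeriv s (partialDeriv l (A j k)) u
          + partialDeriv s (partialDeriv k (A j l)) u))) ∧
    (∀ i j k, P₂.c i j k u = ∑ s, g u i s * partialDeriv k (A j s) u
      - ∑ s, g u i s * partialDeriv s (A j k) u)

/-- The evolutionary vector field with components `-A^i_j(u) u^j_x`. -/
def tensorEvolutionaryField {n : ℕ} (A : Fin n → Fin n → (Fin n → ℝ) → ℝ) :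
    (ℝ → Fin n → ℝ) → ℝ → Fin n → ℝ :=
  fun u x i => -∑ j, A i j (u x) * deriv u x j

/-- `P₂ = -𝓛_e P₁` as brackets on the local functionals on the loop space of `U`. -/
def IsMinusLieDerivative {n : ℕ} (U : Set (Fin n → ℝ))
    (e : (ℝ → Fin n → ℝ) → ℝ → Fin n → ℝ) (P₁ P₂ : LoopOperator n) : Prop :=
  ∀ F G, IsLocalFunctional U F → IsLocalFunctional U G →
    ∀ u, IsLoop U u → loopBracket P₂ F G u = -lieDerivativeBracket e P₁ F G u

end

/-! ### Integrals depending on a parameter -/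

/-! In flat coordinates `P₁` acts on loops in `U` as `L = G d/dx` with `G` a constant symmetric
invertible matrix. Everything rests on comparing `P₂` with the linearization `e_*` of the field `e =
-A u_x`.

From tensors to deformations. Because `L` does not depend on `u`, differentiating an `L`-bracket
produces only second variations, and these are symmetric (`hessian_comm`). This gives the Jacobi
identity for `L`, and in `𝓛_e L` all second variations cancel, leaving `-𝓛_e L = e_* L + L e_*†`
(`lieDerivativeBracket_eq`). Here `e_* v = -(A v_x + D v)` with `D^j_s = A^j_{k,s} u^k_x`, and
integration by parts gives `(e_*† η)_s = A^j_s η_{j,x} + C^j_s η_j` with `C^j_s = (A^j_{s,k} -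
A^j_{k,s}) u^k_x`. Expanding `e_* L + L e_*†` yields exactly the coefficients `(*)`
(`IsGivenByTensor.loopPairing_toOperator`). A Lie derivative of `L` satisfies the order `ε` Jacobi
identity because that identity is the derivative along `e` of the Jacobi identity of `L`.

From deformations to tensors. Skewness and the order `ε` Jacobi identity are tested on linear
functionals `∫ ξ_i u^i dx`. Their variational derivatives do not depend on `u` and their
`L`-brackets are constant, so only three derivatives of pairings with `P₂` remain
(`IsInfinitesimalDeformation.jacobi`). Covectors with trigonometric or constant entries, at constant
loops and small perturbations of them, isolate the coefficient relations: `a` is skew (`a_skew`);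
`c^{ij}_{kl}` is the symmetrized derivative of `c^{ij}_k` (`sum_cc_eq`, `cc_eq`); `b` is determined
by `a` and `c` (`b_eq`); for each fixed `j`, lowering `i` in `c^{ij}_k` gives a closed 2-form
(`c_skew`, `c_closed`); and the cyclic derivative of `a` is a cyclic sum of `c` (`a_cyclic`).

Thus only `a` and `c` have to be matched. The Poincaré lemma, applied for each `j`, produces a
tensor `B` with the right `c`. Such a `B` may be changed by gradients `∂_s f^j` without affecting
`c`. By `a_cyclic` the error of `B` in `a` is, with indices lowered, a closed 2-form, so a second
use of the Poincaré lemma finds the `f^j` that correct it (`exists_isGivenByTensor`). -/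

/-- The integrand is smooth only on an open set `O`, since densities live on jets over `U`. The tube
lemma around `{p} × [0,1]` supplies a neighbourhood of `p` on which the integrand is defined and its
derivative is uniformly bounded, as dominated convergence requires. -/
theorem hasFDerivAt_intervalIntegral_of_contDiffOn {H E : Type*} [NormedAddCommGroup H]
    [NormedSpace ℝ H] [NormedAddCommGroup E] [NormedSpace ℝ E] {O : Set (H × ℝ)} (hO : IsOpen O)
    {φ : H × ℝ → E} (hφ : ContDiffOn ℝ 1 φ O) {p : H} (hp : ∀ x ∈ Set.Icc (0 : ℝ) 1, (p, x) ∈ O) :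
    HasFDerivAt (fun q => ∫ x in (0 : ℝ)..1, φ (q, x))
      (∫ x in (0 : ℝ)..1, (fderiv ℝ φ (p, x)).comp (ContinuousLinearMap.inl ℝ H ℝ)) p := by
  have hd : ContinuousOn (fderiv ℝ φ) O := hφ.continuousOn_fderiv_of_isOpen hO le_rfl
  have hK : IsCompact (({p} : Set H) ×ˢ Set.Icc (0 : ℝ) 1) := isCompact_singleton.prod isCompact_Icc
  have hKO : ({p} : Set H) ×ˢ Set.Icc (0 : ℝ) 1 ⊆ O := by
    rintro ⟨q, x⟩ ⟨rfl, hx⟩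
    exact hp x hx
  obtain ⟨C, hC⟩ := hK.exists_bound_of_continuousOn (hd.mono hKO)
  have hW : IsOpen (O ∩ (fun q => ‖fderiv ℝ φ q‖) ⁻¹' Set.Iio (C + 1)) :=
    hd.norm.isOpen_inter_preimage hO isOpen_Iio
  obtain ⟨s, t, hs, ht, hps, hts, hst⟩ := generalized_tube_lemma isCompact_singleton
    isCompact_Icc hW fun q hq => ⟨hKO hq, (hC q hq).trans_lt (lt_add_one C)⟩
  have hsO : ∀ q ∈ s, ∀ x ∈ Set.Icc (0 : ℝ) 1, (q, x) ∈ O := fun q hq x hx =>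
    (hst ⟨hq, hts hx⟩ : _ ∈ _ ∩ _).1
  have hsn : s ∈ 𝓝 p := hs.mem_nhds (hps rfl)
  have hsub : Set.uIoc (0 : ℝ) 1 ⊆ Set.Icc 0 1 := by
    rw [Set.uIoc_of_le zero_le_one]
    exact Set.Ioc_subset_Icc_self
  have hcont : ∀ q ∈ s, ContinuousOn (fun x => φ (q, x)) (Set.Icc 0 1) := fun q hq =>
    hφ.continuousOn.comp (by fun_prop) fun x hx => hsO q hq x hx
  have hcont' : ContinuousOn (fun x => (fderiv ℝ φ (p, x)).comp (ContinuousLinearMap.inl ℝ H ℝ))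
      (Set.Icc 0 1) :=
    (hd.comp (by fun_prop) fun x hx => hp x hx).clm_comp continuousOn_const
  refine intervalIntegral.hasFDerivAt_integral_of_dominated_of_fderiv_le
    (F := fun q x => φ (q, x))
    (F' := fun q x => (fderiv ℝ φ (q, x)).comp (ContinuousLinearMap.inl ℝ H ℝ))
    (bound := fun _ => (C + 1) * ‖ContinuousLinearMap.inl ℝ H ℝ‖) hsn ?_ ?_ ?_ ?_ ?_ ?_
  · filter_upwards [hsn] with q hq
    exact ((hcont q hq).mono hsub).aestronglyMeasurable measurableSet_uIoc
  · exact ((hcont p (hps rfl)).mono (by simp)).intervalIntegrable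
  · exact (hcont'.mono hsub).aestronglyMeasurable measurableSet_uIoc
  · refine .of_forall fun x hx q hq => (ContinuousLinearMap.opNorm_comp_le _ _).trans ?_
    gcongr
    exact (le_of_lt (hst (⟨hq, hts (hsub hx)⟩ : (q, x) ∈ s ×ˢ t) : _ ∈ _ ∩ _).2)
  · exact intervalIntegrable_const
  · refine .of_forall fun x hx q hq => ?_
    have h1 : HasFDerivAt φ (fderiv ℝ φ (q, x)) (q, x) :=
      ((hφ.contDiffAt (hO.mem_nhds (hsO q hq x (hsub hx)))).differentiableAt one_ne_zero).hasFDerivAt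
    exact h1.comp q (hasFDerivAt_prodMk_left q x)

/-- Induction on the order of differentiability. The target `E` is quantified inside the induction
because the derivative of the integral is again such an integral, with values in `H →L[ℝ] E`. -/
theorem contDiffOn_intervalIntegral_nat {H : Type} [NormedAddCommGroup H] [NormedSpace ℝ H]
    {O : Set (H × ℝ)} (hO : IsOpen O) {V : Set H} (hV : IsOpen V)
    (hVO : ∀ q ∈ V, ∀ x ∈ Set.Icc (0 : ℝ) 1, (q, x) ∈ O) (m : ℕ) :
    ∀ {E : Type} [NormedAddCommGroup E] [NormedSpace ℝ E] {φ : H × ℝ → E}, ContDiffOn ℝ ∞ φ O →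
      ContDiffOn ℝ m (fun q => ∫ x in (0 : ℝ)..1, φ (q, x)) V := by
  induction m with
  | zero =>
    intro E _ _ φ hφ
    refine contDiffOn_zero.2 fun q hq => ?_
    exact (hasFDerivAt_intervalIntegral_of_contDiffOn hO (hφ.of_le (by simp))
      (hVO q hq)).continuousAt.continuousWithinAt
  | succ m ih =>
    intro E _ _ φ hφ
    have hder : ∀ q ∈ V, HasFDerivAt (fun q => ∫ x in (0 : ℝ)..1, φ (q, x)) _ q := fun q hq =>
      hasFDerivAt_intervalIntegral_of_contDiffOn hO (hφ.of_le (by simp)) (hVO q hq)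
    push_cast
    rw [contDiffOn_succ_iff_fderiv_of_isOpen hV]
    refine ⟨fun q hq => (hder q hq).differentiableAt.differentiableWithinAt, by simp, ?_⟩
    refine (ih (φ := fun z => (fderiv ℝ φ z).comp (ContinuousLinearMap.inl ℝ H ℝ)) ?_).congr
      fun q hq => (hder q hq).fderiv
    exact (hφ.fderiv_of_isOpen hO (by simp)).clm_comp contDiffOn_const

theorem contDiffOn_intervalIntegral {H E : Type} [NormedAddCommGroup H] [NormedSpace ℝ H]
    [NormedAddCommGroup E] [NormedSpace ℝ E]
    {O : Set (H × ℝ)} (hO : IsOpen O) {V : Set H} (hV : IsOpen V)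
    (hVO : ∀ q ∈ V, ∀ x ∈ Set.Icc (0 : ℝ) 1, (q, x) ∈ O) {φ : H × ℝ → E}
    (hφ : ContDiffOn ℝ ∞ φ O) :
    ContDiffOn ℝ ∞ (fun q => ∫ x in (0 : ℝ)..1, φ (q, x)) V :=
  contDiffOn_infty.2 fun m => contDiffOn_intervalIntegral_nat hO hV hVO m hφ

/-- Differentiation under the integral sign, for a real parameter near `0`. -/
theorem hasDerivAt_intervalIntegral_of_contDiffOn {O : Set (ℝ × ℝ)} (hO : IsOpen O)
    {φ : ℝ × ℝ → ℝ} (hφ : ContDiffOn ℝ ∞ φ O) (hp : ∀ x, (0, x) ∈ O) {φ' : ℝ → ℝ}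
    (hφ' : ∀ x, HasDerivAt (fun t => φ (t, x)) (φ' x) 0) :
    HasDerivAt (fun t => ∫ x in (0 : ℝ)..1, φ (t, x)) (∫ x in (0 : ℝ)..1, φ' x) 0 := by
  have h := (hasFDerivAt_intervalIntegral_of_contDiffOn hO (hφ.of_le (by simp)) (p := 0)
    fun x _ => hp x).hasDerivAt
  have hc : Continuous fun x => (fderiv ℝ φ (0, x)).comp (ContinuousLinearMap.inl ℝ ℝ ℝ) := by
    have h1 : ContinuousOn (fderiv ℝ φ) O := hφ.continuousOn_fderiv_of_isOpen hO (by simp)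
    exact (h1.comp_continuous (by fun_prop) hp).clm_comp continuous_const
  rw [ContinuousLinearMap.intervalIntegral_apply (hc.intervalIntegrable _ _)] at h
  refine h.congr_deriv (intervalIntegral.integral_congr fun x _ => ?_)
  have h1 : HasFDerivAt φ (fderiv ℝ φ (0, x)) (0, x) :=
    ((hφ.contDiffAt (hO.mem_nhds (hp x))).differentiableAt (by simp)).hasFDerivAt
  exact (h1.comp 0 (hasFDerivAt_prodMk_left 0 x)).hasDerivAt.unique (hφ' x)

/-! ### Partial derivatives and the Poincaré lemma for 2-forms -/

theorem fderiv_apply_eq_sum_partialDeriv {n : ℕ} (f : (Fin n → ℝ) → ℝ) (u w : Fin n → ℝ) :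
    fderiv ℝ f u w = ∑ k, partialDeriv k f u * w k := by
  conv_lhs => rw [← Finset.univ_sum_single w]
  rw [map_sum]
  refine Finset.sum_congr rfl fun k _ => ?_
  rw [partialDeriv, mul_comm, ← smul_eq_mul, ← map_smul, ← Pi.single_smul]
  simp

theorem ContDiffOn.partialDeriv {n : ℕ} {V : Set (Fin n → ℝ)} (hV : IsOpen V)
    {f : (Fin n → ℝ) → ℝ} (hf : ContDiffOn ℝ ∞ f V) (k : Fin n) :
    ContDiffOn ℝ ∞ (partialDeriv k f) V :=
  (hf.fderiv_of_isOpen hV (by simp)).clm_apply contDiffOn_const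

theorem ContDiffOn.hasFDerivAt_of_mem {E F : Type*} [NormedAddCommGroup E] [NormedSpace ℝ E]
    [NormedAddCommGroup F] [NormedSpace ℝ F] {V : Set E} (hV : IsOpen V) {f : E → F}
    (hf : ContDiffOn ℝ ∞ f V) {u : E} (hu : u ∈ V) :
    HasFDerivAt f (fderiv ℝ f u) u :=
  ((hf.contDiffAt (hV.mem_nhds hu)).differentiableAt (by simp)).hasFDerivAt

/-- The chain rule in terms of partial derivatives. -/
theorem ContDiffOn.hasDerivAt_comp_curve {n : ℕ} {V : Set (Fin n → ℝ)} (hV : IsOpen V)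
    {f : (Fin n → ℝ) → ℝ} (hf : ContDiffOn ℝ ∞ f V) {γ : ℝ → Fin n → ℝ} {w : Fin n → ℝ} {t : ℝ}
    (hγ : HasDerivAt γ w t) (ht : γ t ∈ V) :
    HasDerivAt (fun s => f (γ s)) (∑ k, _root_.partialDeriv k f (γ t) * w k) t := by
  rw [← fderiv_apply_eq_sum_partialDeriv]
  exact (hf.hasFDerivAt_of_mem hV ht).comp_hasDerivAt t hγ

theorem two_le_infty : (2 : WithTop ℕ∞) ≤ ∞ :=
  WithTop.coe_le_coe.2 (le_top : (2 : ℕ∞) ≤ ⊤)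

theorem partialDeriv_partialDeriv_comm {n : ℕ} {V : Set (Fin n → ℝ)} (hV : IsOpen V)
    {f : (Fin n → ℝ) → ℝ} (hf : ContDiffOn ℝ ∞ f V) {u : Fin n → ℝ} (hu : u ∈ V) (k l : Fin n) :
    partialDeriv k (partialDeriv l f) u = partialDeriv l (partialDeriv k f) u := by
  have hs : IsSymmSndFDerivAt ℝ f u :=
    (hf.contDiffAt (hV.mem_nhds hu)).isSymmSndFDerivAt (by simpa using two_le_infty)
  have hd : DifferentiableAt ℝ (fderiv ℝ f) u :=
    ((hf.fderiv_of_isOpen hV (m := ∞) (by simp)).contDiffAt (hV.mem_nhds hu)).differentiableAt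
      (by simp)
  have key : ∀ a b : Fin n, partialDeriv a (partialDeriv b f) u
      = fderiv ℝ (fderiv ℝ f) u (Pi.single a 1) (Pi.single b 1) := fun a b => by
    have : partialDeriv b f = fun v => fderiv ℝ f v (Pi.single b 1) := rfl
    rw [this, partialDeriv, fderiv_clm_apply hd (differentiableAt_const _)]
    simp
  rw [key, key, hs.eq]

/-- The Poincaré lemma for 2-forms on a star-shaped open set. -/
theorem exists_potential_of_closed {n : ℕ} {V : Set (Fin n → ℝ)} (hV : IsOpen V) {p : Fin n → ℝ}
    (hstar : StarConvex ℝ p V) {β : Fin n → Fin n → (Fin n → ℝ) → ℝ}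
    (hβ : ∀ i j, ContDiffOn ℝ ∞ (β i j) V) (hanti : ∀ u ∈ V, ∀ i j, β i j u = -β j i u)
    (hclosed : ∀ u ∈ V, ∀ i j k, partialDeriv k (β i j) u + partialDeriv i (β j k) u
      + partialDeriv j (β k i) u = 0) :
    ∃ θ : Fin n → (Fin n → ℝ) → ℝ, (∀ i, ContDiffOn ℝ ∞ (θ i) V) ∧
      ∀ u ∈ V, ∀ i j, β i j u = partialDeriv i (θ j) u - partialDeriv j (θ i) u := by
  set γ : (Fin n → ℝ) × ℝ → Fin n → ℝ := fun z => p + z.2 • (z.1 - p) with hγ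
  have hγs : ContDiff ℝ ∞ γ := by fun_prop
  set O : Set ((Fin n → ℝ) × ℝ) := γ ⁻¹' V
  have hO : IsOpen O := hV.preimage hγs.continuous
  have hVO : ∀ q ∈ V, ∀ x ∈ Set.Icc (0 : ℝ) 1, (q, x) ∈ O := fun q hq x hx =>
    hstar.add_smul_sub_mem hq hx.1 hx.2
  -- The homotopy formula: `θ_j(u) = ∫₀¹ x β_ij(p + x (u - p)) (u - p)^i dx`, the integral of `β`
  -- contracted with the radial field.
  set φ : Fin n → (Fin n → ℝ) × ℝ → ℝ := fun j z => z.2 * ∑ i, β i j (γ z) * (z.1 i - p i)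
  have hφ : ∀ j, ContDiffOn ℝ ∞ (φ j) O := fun j => by
    refine contDiff_snd.contDiffOn.mul (ContDiffOn.sum fun i _ => ContDiffOn.mul ?_ ?_)
    · exact (hβ i j).comp hγs.contDiffOn fun z hz => hz
    · exact ContDiff.contDiffOn (by fun_prop)
  have hθ : ∀ j, ContDiffOn ℝ ∞ (fun q => ∫ x in (0 : ℝ)..1, φ j (q, x)) V := fun j =>
    contDiffOn_intervalIntegral hO hV hVO (hφ j)
  refine ⟨fun j q => ∫ x in (0 : ℝ)..1, φ j (q, x), hθ, fun u hu k j => ?_⟩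
  have hφd : ∀ j k x, x ∈ Set.Icc (0 : ℝ) 1 → fderiv ℝ (φ j) (u, x) (Pi.single k 1, 0)
      = x ^ 2 * ∑ i, partialDeriv k (β i j) (γ (u, x)) * (u i - p i) + x * β k j (γ (u, x)) := by
    intro j k x hx
    have h1 : HasDerivAt (fun t : ℝ => ((u + t • Pi.single k 1, x) : (Fin n → ℝ) × ℝ))
        (Pi.single k 1, 0) 0 := by
      refine HasDerivAt.prodMk ?_ (hasDerivAt_const _ _)
      simpa using ((hasDerivAt_id (0 : ℝ)).smul_const (Pi.single k 1 : Fin n → ℝ)).const_add u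
    have h2 : HasFDerivAt (φ j) (fderiv ℝ (φ j) (u, x))
        ((u + (0 : ℝ) • (Pi.single k 1 : Fin n → ℝ), x)) := by
      simpa using (hφ j).hasFDerivAt_of_mem hO (hVO u hu x hx)
    refine (h2.comp_hasDerivAt (0 : ℝ) h1).unique ?_
    have h3 : HasDerivAt (fun t : ℝ => γ (u + t • Pi.single k 1, x)) (x • Pi.single k 1) 0 := by
      have : (fun t : ℝ => γ (u + t • Pi.single k 1, x))
          = fun t : ℝ => γ (u, x) + t • x • (Pi.single k 1 : Fin n → ℝ) := by
        funext t i
        simp only [hγ, Pi.add_apply, Pi.smul_apply, Pi.sub_apply, smul_eq_mul]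
        ring
      rw [this]
      simpa using ((hasDerivAt_id (0 : ℝ)).smul_const
        (x • Pi.single k 1 : Fin n → ℝ)).const_add (γ (u, x))
    have h4 : ∀ i, HasDerivAt (fun t : ℝ => β i j (γ (u + t • Pi.single k 1, x))
        * ((u + t • (Pi.single k 1 : Fin n → ℝ)) i - p i))
        (x * partialDeriv k (β i j) (γ (u, x)) * (u i - p i)
          + β i j (γ (u, x)) * (Pi.single k 1 : Fin n → ℝ) i) 0 := by
      intro i
      have e1 := (hβ i j).hasDerivAt_comp_curve hV h3
        (by simpa using hstar.add_smul_sub_mem hu hx.1 hx.2)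
      have e2 : HasDerivAt (fun t : ℝ => (u + t • (Pi.single k 1 : Fin n → ℝ)) i - p i)
          ((Pi.single k 1 : Fin n → ℝ) i) 0 := by
        simpa using (((hasDerivAt_id (0 : ℝ)).mul_const
          ((Pi.single k 1 : Fin n → ℝ) i)).const_add (u i)).sub_const (p i)
      have e3 := e1.mul e2
      simp only [zero_smul, add_zero, Pi.smul_apply, smul_eq_mul] at e3
      refine e3.congr_deriv ?_
      simp only [Pi.single_apply, mul_ite, mul_one, mul_zero, Finset.sum_ite_eq',
        Finset.mem_univ, if_true]
      ring
    have h5 := (HasDerivAt.fun_sum fun i (_ : i ∈ Finset.univ) => h4 i).const_mul x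
    refine h5.congr_deriv ?_
    rw [Finset.sum_add_distrib, mul_add]
    congr 1
    · rw [Finset.mul_sum, Finset.mul_sum]
      exact Finset.sum_congr rfl fun i _ => by ring
    · simp [Pi.single_apply]
  have hcγ : ContinuousOn (fun x => γ (u, x)) (Set.Icc 0 1) := by fun_prop
  have hmem : Set.MapsTo (fun x => γ (u, x)) (Set.Icc 0 1) V := fun x hx => hVO u hu x hx
  have hpd : ∀ j k, partialDeriv k (fun q => ∫ x in (0 : ℝ)..1, φ j (q, x)) u
      = ∫ x in (0 : ℝ)..1, (x ^ 2 * ∑ i, partialDeriv k (β i j) (γ (u, x)) * (u i - p i)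
        + x * β k j (γ (u, x))) := by
    intro j k
    have hc : ContinuousOn (fun x => (fderiv ℝ (φ j) (u, x)).comp
        (ContinuousLinearMap.inl ℝ (Fin n → ℝ) ℝ)) (Set.Icc 0 1) := by
      have h1 : ContinuousOn (fderiv ℝ (φ j)) O := (hφ j).continuousOn_fderiv_of_isOpen hO (by simp)
      exact (h1.comp (by fun_prop) fun x hx => hVO u hu x hx).clm_comp continuousOn_const
    rw [partialDeriv, (hasFDerivAt_intervalIntegral_of_contDiffOn hO ((hφ j).of_le (by simp))
      (hVO u hu)).fderiv, ContinuousLinearMap.intervalIntegral_apply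
        (hc.mono (by simp)).intervalIntegrable]
    refine intervalIntegral.integral_congr fun x hx => ?_
    rw [Set.uIcc_of_le zero_le_one] at hx
    exact hφd j k x hx
  have hint : ∀ j k, IntervalIntegrable (fun x => x ^ 2 * ∑ i, partialDeriv k (β i j) (γ (u, x))
      * (u i - p i) + x * β k j (γ (u, x))) MeasureTheory.volume 0 1 := by
    intro j k
    refine ContinuousOn.intervalIntegrable ?_
    rw [Set.uIcc_of_le zero_le_one]
    refine ((continuousOn_id.pow 2).mul (continuousOn_finsetSum _ fun i _ => ?_)).add
      (continuousOn_id.mul ?_)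
    · exact (((hβ i j).partialDeriv hV k).continuousOn.comp hcγ hmem).mul continuousOn_const
    · exact (hβ k j).continuousOn.comp hcγ hmem
  -- Closedness turns the difference of the integrands of `∂_k θ_j` and `∂_j θ_k` into the
  -- `x`-derivative of `x² β_kj`. Its boundary values are `0` and `β_kj(u)`.
  have hderiv : ∀ x ∈ Set.uIcc (0 : ℝ) 1, HasDerivAt (fun x => x ^ 2 * β k j (γ (u, x)))
      (x ^ 2 * ∑ i, partialDeriv k (β i j) (γ (u, x)) * (u i - p i) + x * β k j (γ (u, x))
      - (x ^ 2 * ∑ i, partialDeriv j (β i k) (γ (u, x)) * (u i - p i)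
        + x * β j k (γ (u, x)))) x := by
    intro x hx
    rw [Set.uIcc_of_le zero_le_one] at hx
    have hm : γ (u, x) ∈ V := hVO u hu x hx
    have h3 : HasDerivAt (fun x : ℝ => γ (u, x)) (u - p) x := by
      simpa [hγ] using ((hasDerivAt_id x).smul_const (u - p)).const_add p
    refine ((hasDerivAt_pow 2 x).mul
      ((hβ k j).hasDerivAt_comp_curve hV h3 hm)).congr_deriv ?_
    have hk : ∀ i, partialDeriv i (β k j) (γ (u, x))
        = partialDeriv k (β i j) (γ (u, x)) - partialDeriv j (β i k) (γ (u, x)) := by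
      intro i
      have e1 := hclosed _ hm i j k
      have neg : ∀ a b c, partialDeriv c (β a b) (γ (u, x)) = -partialDeriv c (β b a) (γ (u, x)) :=
        fun a b c => by
          have : β a b =ᶠ[𝓝 (γ (u, x))] fun v => -β b a v := by
            filter_upwards [hV.mem_nhds hm] with v hv using hanti v hv a b
          rw [partialDeriv, this.fderiv_eq, partialDeriv, fderiv_fun_neg]
          rfl
      rw [neg j k i, neg k i j] at e1
      linarith
    simp only [hk, Pi.sub_apply, sub_mul, Finset.sum_sub_distrib, hanti _ hm j k]
    push_cast
    ring
  rw [hpd, hpd, ← intervalIntegral.integral_sub (hint j k) (hint k j),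
    intervalIntegral.integral_eq_sub_of_hasDerivAt hderiv ((hint j k).sub (hint k j))]
  simp [hγ]

/-! ### Smooth periodic functions and loops -/

/-- Smooth functions on the circle `ℝ/ℤ`. -/
def SmoothPeriodic (f : ℝ → ℝ) : Prop := ContDiff ℝ ∞ f ∧ Function.Periodic f 1

namespace SmoothPeriodic

variable {f g : ℝ → ℝ}

theorem const (c : ℝ) : SmoothPeriodic fun _ => c := ⟨contDiff_const, fun _ => rfl⟩

theorem add (hf : SmoothPeriodic f) (hg : SmoothPeriodic g) : SmoothPeriodic fun x => f x + g x :=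
  ⟨hf.1.add hg.1, fun x => by simp only [hf.2 x, hg.2 x]⟩

theorem sub (hf : SmoothPeriodic f) (hg : SmoothPeriodic g) : SmoothPeriodic fun x => f x - g x :=
  ⟨hf.1.sub hg.1, fun x => by simp only [hf.2 x, hg.2 x]⟩

theorem neg (hf : SmoothPeriodic f) : SmoothPeriodic fun x => -f x :=
  ⟨hf.1.neg, fun x => by simp only [hf.2 x]⟩

theorem mul (hf : SmoothPeriodic f) (hg : SmoothPeriodic g) : SmoothPeriodic fun x => f x * g x :=
  ⟨hf.1.mul hg.1, fun x => by simp only [hf.2 x, hg.2 x]⟩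

theorem sum {ι : Type*} {s : Finset ι} {f : ι → ℝ → ℝ} (hf : ∀ i ∈ s, SmoothPeriodic (f i)) :
    SmoothPeriodic fun x => ∑ i ∈ s, f i x :=
  ⟨ContDiff.sum fun i hi => (hf i hi).1, fun x =>
    Finset.sum_congr rfl fun i hi => (hf i hi).2 x⟩

theorem deriv (hf : SmoothPeriodic f) : SmoothPeriodic (deriv f) := by
  refine ⟨(contDiff_infty_iff_deriv.1 hf.1).2, fun x => ?_⟩
  rw [← deriv_comp_add_const, funext hf.2]

theorem iteratedDeriv (hf : SmoothPeriodic f) (k : ℕ) : SmoothPeriodic (iteratedDeriv k f) := by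
  induction k with
  | zero => simpa using hf
  | succ k ih =>
    rw [iteratedDeriv_succ]
    exact ih.deriv

theorem hasDerivAt (hf : SmoothPeriodic f) (x : ℝ) : HasDerivAt f (_root_.deriv f x) x :=
  (hf.1.differentiable (by simp) x).hasDerivAt

theorem intervalIntegrable (hf : SmoothPeriodic f) (a b : ℝ) :
    IntervalIntegrable f MeasureTheory.volume a b :=
  hf.1.continuous.intervalIntegrable a b

theorem integral_deriv (hf : SmoothPeriodic f) : ∫ x in (0 : ℝ)..1, _root_.deriv f x = 0 := by
  rw [intervalIntegral.integral_deriv_eq_sub (fun x _ => hf.1.differentiable (by simp) x)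
    (hf.deriv.intervalIntegrable _ _)]
  have := hf.2 0
  rw [zero_add] at this
  rw [this, sub_self]

/-- The form in which integration by parts is mostly used below: an identity between integrals is
proved by exhibiting a periodic primitive of the difference of the integrands. -/
theorem integral_eq_zero_of_hasDerivAt (hf : SmoothPeriodic f) {f' : ℝ → ℝ}
    (h : ∀ x, HasDerivAt f (f' x) x) : ∫ x in (0 : ℝ)..1, f' x = 0 := by
  rw [← funext fun x => (h x).deriv]
  exact hf.integral_deriv

theorem integral_mul_deriv (hf : SmoothPeriodic f) (hg : SmoothPeriodic g) :
    ∫ x in (0 : ℝ)..1, f x * _root_.deriv g x = ∫ x in (0 : ℝ)..1, -_root_.deriv f x * g x := by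
  rw [← sub_eq_zero, ← intervalIntegral.integral_sub ((hf.mul hg.deriv).intervalIntegrable _ _)
    ((hf.deriv.neg.mul hg).intervalIntegrable _ _)]
  refine (hf.mul hg).integral_eq_zero_of_hasDerivAt fun x => ?_
  exact ((hf.hasDerivAt x).mul (hg.hasDerivAt x)).congr_deriv (by ring)

theorem integral_mul_iteratedDeriv (hf : SmoothPeriodic f) (hg : SmoothPeriodic g) (k : ℕ) :
    ∫ x in (0 : ℝ)..1, f x * _root_.iteratedDeriv k g x
      = ∫ x in (0 : ℝ)..1, (-1) ^ k * _root_.iteratedDeriv k f x * g x := by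
  induction k generalizing g with
  | zero => simp
  | succ k ih =>
    rw [iteratedDeriv_succ', ih hg.deriv, iteratedDeriv_succ]
    rw [((const ((-1) ^ k)).mul (hf.iteratedDeriv k)).integral_mul_deriv hg]
    refine intervalIntegral.integral_congr fun x _ => ?_
    have : HasDerivAt (fun x => (-1) ^ k * _root_.iteratedDeriv k f x)
        ((-1) ^ k * _root_.deriv (_root_.iteratedDeriv k f) x) x :=
      ((hf.iteratedDeriv k).hasDerivAt x).const_mul _
    simp only [this.deriv]
    ring

end SmoothPeriodic

section Loops

variable {n : ℕ} {U : Set (Fin n → ℝ)} {u v w : ℝ → Fin n → ℝ}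

theorem isLoop_univ_iff : IsLoop Set.univ u ↔ ∀ i, SmoothPeriodic fun x => u x i := by
  constructor
  · intro h i
    exact ⟨contDiff_pi.1 h.1 i, fun x => congrFun (h.2.1 x) i⟩
  · intro h
    exact ⟨contDiff_pi.2 fun i => (h i).1, fun x => funext fun i => (h i).2 x,
      fun _ => Set.mem_univ _⟩

theorem IsLoop.mono {V : Set (Fin n → ℝ)} (hu : IsLoop U u) (h : U ⊆ V) : IsLoop V u :=
  ⟨hu.1, hu.2.1, fun x => h (hu.2.2 x)⟩

theorem IsLoop.univ (hu : IsLoop U u) : IsLoop Set.univ u := hu.mono (Set.subset_univ U)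

theorem IsLoop.apply (hu : IsLoop U u) (i : Fin n) : SmoothPeriodic fun x => u x i :=
  isLoop_univ_iff.1 hu.univ i

theorem IsLoop.hasDerivAt (hu : IsLoop U u) (x : ℝ) : HasDerivAt u (deriv u x) x :=
  (hu.1.differentiable (by simp) x).hasDerivAt

theorem IsLoop.deriv_apply (hu : IsLoop U u) (x : ℝ) (i : Fin n) :
    deriv u x i = deriv (fun y => u y i) x :=
  ((hasDerivAt_pi.1 (hu.hasDerivAt x)) i).deriv.symm

theorem IsLoop.deriv (hu : IsLoop U u) : IsLoop Set.univ (deriv u) := by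
  rw [isLoop_univ_iff]
  intro i
  simp only [hu.deriv_apply]
  exact (hu.apply i).deriv

theorem IsLoop.iteratedDeriv (hu : IsLoop U u) (k : ℕ) : IsLoop Set.univ (iteratedDeriv k u) := by
  induction k with
  | zero => simpa using hu.univ
  | succ k ih =>
    rw [iteratedDeriv_succ]
    exact ih.deriv

theorem IsLoop.iteratedDeriv_apply (hu : IsLoop U u) (k : ℕ) (x : ℝ) (i : Fin n) :
    _root_.iteratedDeriv k u x i = _root_.iteratedDeriv k (fun y => u y i) x := by
  induction k generalizing x with
  | zero => simp
  | succ k ih =>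
    rw [iteratedDeriv_succ, (hu.iteratedDeriv k).deriv_apply, iteratedDeriv_succ]
    simp only [ih]

theorem IsLoop.const {p : Fin n → ℝ} (hp : p ∈ U) : IsLoop U fun _ => p :=
  ⟨contDiff_const, fun _ => rfl, fun _ => hp⟩

theorem IsLoop.add (hu : IsLoop Set.univ u) (hv : IsLoop Set.univ v) : IsLoop Set.univ (u + v) :=
  isLoop_univ_iff.2 fun i => (hu.apply i).add (hv.apply i)

theorem IsLoop.smul (hu : IsLoop Set.univ u) (c : ℝ) : IsLoop Set.univ (c • u) :=
  isLoop_univ_iff.2 fun i => (SmoothPeriodic.const c).mul (hu.apply i)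

theorem IsLoop.isLoop_add_smul (hu : IsLoop U u) (hv : IsLoop Set.univ v) {t : ℝ}
    (h : ∀ x, u x + t • v x ∈ U) : IsLoop U (u + t • v) :=
  ⟨(hu.univ.add (hv.smul t)).1, (hu.univ.add (hv.smul t)).2.1, h⟩

theorem Function.Periodic.exists_mem_Icc {α : Type*} {f : ℝ → α} (hf : Function.Periodic f 1)
    (x : ℝ) : ∃ y ∈ Set.Icc (0 : ℝ) 1, f x = f y :=
  let ⟨y, hy, h⟩ := hf.exists_mem_Ico₀ one_pos x
  ⟨y, ⟨hy.1, hy.2.le⟩, h⟩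

/-- Compactness of one period makes the bound on `t` uniform in `x`. Functionals are controlled only
on loops in `U`, so every derivative in `t` below first passes to these small `t`. -/
theorem IsLoop.eventually_add_smul (hU : IsOpen U) (hu : IsLoop U u) (hv : IsLoop Set.univ v) :
    ∀ᶠ t in 𝓝 (0 : ℝ), IsLoop U (u + t • v) := by
  have hcu := hu.1.continuous
  have hcv := hv.1.continuous
  have hW : IsOpen {z : ℝ × ℝ | u z.2 + z.1 • v z.2 ∈ U} := hU.preimage (by fun_prop)
  obtain ⟨s, t, hs, -, h0s, hts, hst⟩ := generalized_tube_lemma isCompact_singleton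
    (isCompact_Icc (a := (0 : ℝ)) (b := 1)) hW (s := {(0 : ℝ)})
    (by
      rintro ⟨a, x⟩ ⟨rfl, -⟩
      simpa using hu.2.2 x)
  filter_upwards [hs.mem_nhds (h0s rfl)] with a ha
  refine hu.isLoop_add_smul hv fun x => ?_
  have hper : Function.Periodic (fun x => u x + a • v x) 1 := fun x => by
    simp only [hu.2.1 x, hv.2.1 x]
  obtain ⟨y, hy, h⟩ := hper.exists_mem_Icc x
  change u x + a • v x ∈ U
  rw [show u x + a • v x = u y + a • v y from h]
  exact hst (⟨ha, hts hy⟩ : (a, y) ∈ s ×ˢ t)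

/-! ### Jets and local densities -/

/-- The `m`-jet of a curve. -/
noncomputable def jet (m : ℕ) (u : ℝ → Fin n → ℝ) (x : ℝ) : Fin (m + 1) → Fin n → ℝ :=
  fun k => iteratedDeriv (k : ℕ) u x

/-- The jets based at points of `U`. -/
def jetDomain (U : Set (Fin n → ℝ)) (m : ℕ) : Set (ℝ × (Fin (m + 1) → Fin n → ℝ)) :=
  {p | p.2 0 ∈ U}

theorem isOpen_jetDomain (hU : IsOpen U) (m : ℕ) : IsOpen (jetDomain U m) :=
  hU.preimage (by fun_prop)

theorem jet_zero (m : ℕ) (u : ℝ → Fin n → ℝ) (x : ℝ) : jet m u x 0 = u x := by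
  simp [jet]

theorem IsLoop.jet_mem (hu : IsLoop U u) (m : ℕ) (x : ℝ) : (x, jet m u x) ∈ jetDomain U m := by
  change jet m u x 0 ∈ U
  rw [jet_zero]
  exact hu.2.2 x

theorem IsLoop.contDiff_jet (hu : IsLoop U u) (m : ℕ) : ContDiff ℝ ∞ (jet m u) :=
  contDiff_pi.2 fun k => (hu.iteratedDeriv k).1

theorem IsLoop.jet_periodic (hu : IsLoop U u) (m : ℕ) : Function.Periodic (jet m u) 1 :=
  fun x => funext fun k => (hu.iteratedDeriv k).2.1 x

theorem IsLoop.hasDerivAt_jet (hu : IsLoop U u) (m : ℕ) (x : ℝ) :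
    HasDerivAt (jet m u) (fun k => jet (m + 1) u x k.succ) x := by
  refine hasDerivAt_pi.2 fun k => ?_
  have h := (hu.iteratedDeriv k).hasDerivAt x
  rw [← iteratedDeriv_succ] at h
  simpa [jet] using h

theorem IsLoop.jet_add_smul (hu : IsLoop Set.univ u) (hv : IsLoop Set.univ v) (m : ℕ) (t x : ℝ) :
    jet m (u + t • v) x = jet m u x + t • jet m v x := by
  funext k
  have h1 : ContDiffAt ℝ (k : ℕ) u x := (hu.1.of_le (by exact_mod_cast le_top)).contDiffAt
  have h2 : ContDiffAt ℝ (k : ℕ) v x := (hv.1.of_le (by exact_mod_cast le_top)).contDiffAt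
  simp only [jet, Pi.add_apply, Pi.smul_apply]
  rw [iteratedDeriv_add h1 (show ContDiffAt ℝ (k : ℕ) (t • v) x from h2.const_smul t),
    iteratedDeriv_const_smul h2]

/-- `h[u](x) = f(x, u, u_x, …, u^{(m)})` on the loops in `U`. -/
def IsLocalDensityOfOrder (U : Set (Fin n → ℝ)) (m : ℕ) (h : (ℝ → Fin n → ℝ) → ℝ → ℝ) : Prop :=
  ∃ f : ℝ × (Fin (m + 1) → Fin n → ℝ) → ℝ, ContDiffOn ℝ ∞ f (jetDomain U m) ∧
    (∀ x z, z 0 ∈ U → f (x + 1, z) = f (x, z)) ∧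
    ∀ u, IsLoop U u → ∀ x, h u x = f (x, jet m u x)

/-- Densities of local functionals. -/
def IsLocalDensity (U : Set (Fin n → ℝ)) (h : (ℝ → Fin n → ℝ) → ℝ → ℝ) : Prop :=
  ∃ m, IsLocalDensityOfOrder U m h

theorem IsLocalDensityOfOrder.mono {m m' : ℕ} {h : (ℝ → Fin n → ℝ) → ℝ → ℝ}
    (hh : IsLocalDensityOfOrder U m h) (hm : m ≤ m') : IsLocalDensityOfOrder U m' h := by
  obtain ⟨f, hf, hp, hu⟩ := hh
  have hm' : m + 1 ≤ m' + 1 := by lia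
  refine ⟨fun z => f (z.1, fun k => z.2 (Fin.castLE hm' k)), ?_, ?_, ?_⟩
  · refine hf.comp (ContDiff.contDiffOn (by fun_prop)) fun z hz => ?_
    simpa [jetDomain] using hz
  · intro x z hz
    exact hp x _ (by simpa using hz)
  · intro u hu' x
    rw [hu u hu']
    rfl

theorem IsLocalDensity.congr {h h' : (ℝ → Fin n → ℝ) → ℝ → ℝ} (hh : IsLocalDensity U h)
    (e : ∀ u, IsLoop U u → ∀ x, h' u x = h u x) : IsLocalDensity U h' := by
  obtain ⟨m, f, hf, hp, hu⟩ := hh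
  exact ⟨m, f, hf, hp, fun u hu' x => (e u hu' x).trans (hu u hu' x)⟩

theorem IsLocalDensity.comp₂ {h h' : (ℝ → Fin n → ℝ) → ℝ → ℝ} (hh : IsLocalDensity U h)
    (hh' : IsLocalDensity U h') {Φ : ℝ × ℝ → ℝ} (hΦ : ContDiff ℝ ∞ Φ) :
    IsLocalDensity U fun u x => Φ (h u x, h' u x) := by
  obtain ⟨m, hm⟩ := hh
  obtain ⟨m', hm'⟩ := hh'
  obtain ⟨f, hf, hp, hu⟩ := hm.mono (le_max_left m m')
  obtain ⟨f', hf', hp', hu'⟩ := hm'.mono (le_max_right m m')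
  refine ⟨max m m', fun z => Φ (f z, f' z), hΦ.comp_contDiffOn (hf.prodMk hf'), ?_, ?_⟩
  · intro x z hz
    simp only [hp x z hz, hp' x z hz]
  · intro u h x
    simp only [hu u h, hu' u h]

theorem IsLocalDensity.add {h h' : (ℝ → Fin n → ℝ) → ℝ → ℝ} (hh : IsLocalDensity U h)
    (hh' : IsLocalDensity U h') : IsLocalDensity U fun u x => h u x + h' u x :=
  hh.comp₂ hh' (Φ := fun z => z.1 + z.2) (by fun_prop)

theorem IsLocalDensity.mul {h h' : (ℝ → Fin n → ℝ) → ℝ → ℝ} (hh : IsLocalDensity U h)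
    (hh' : IsLocalDensity U h') : IsLocalDensity U fun u x => h u x * h' u x :=
  hh.comp₂ hh' (Φ := fun z => z.1 * z.2) (by fun_prop)

theorem IsLocalDensity.of_smoothPeriodic {φ : ℝ → ℝ} (hφ : SmoothPeriodic φ) :
    IsLocalDensity U fun _ x => φ x :=
  ⟨0, fun z => φ z.1, (hφ.1.comp contDiff_fst).contDiffOn, fun x _ _ => hφ.2 x, fun _ _ _ => rfl⟩

theorem IsLocalDensity.const (c : ℝ) : IsLocalDensity U fun _ _ => c :=
  .of_smoothPeriodic (.const c)

theorem IsLocalDensity.neg {h : (ℝ → Fin n → ℝ) → ℝ → ℝ} (hh : IsLocalDensity U h) :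
    IsLocalDensity U fun u x => -h u x :=
  hh.comp₂ hh (Φ := fun z => -z.1) (by fun_prop)

theorem IsLocalDensity.sum {ι : Type*} (s : Finset ι) {h : ι → (ℝ → Fin n → ℝ) → ℝ → ℝ}
    (hh : ∀ i ∈ s, IsLocalDensity U (h i)) : IsLocalDensity U fun u x => ∑ i ∈ s, h i u x := by
  classical
  induction s using Finset.induction_on with
  | empty => simpa using IsLocalDensity.const 0
  | insert a s ha ih =>
    simp only [Finset.sum_insert ha]
    exact (hh a (by simp)).add (ih fun i hi => hh i (by simp [hi]))

theorem IsLocalDensity.comp_contDiffOn {A : (Fin n → ℝ) → ℝ} (hA : ContDiffOn ℝ ∞ A U) :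
    IsLocalDensity U fun u x => A (u x) := by
  refine ⟨0, fun z => A (z.2 0), hA.comp (ContDiff.contDiffOn (by fun_prop)) fun z hz => hz, ?_, ?_⟩
  · intro x z _
    rfl
  · intro u _ x
    simp only [jet_zero]

/-- Periodicity holds only over `U`, but jets over `U` form an open set, so it passes to
derivatives. -/
theorem fderiv_jetDomain_periodic (hU : IsOpen U) {m : ℕ}
    {f : ℝ × (Fin (m + 1) → Fin n → ℝ) → ℝ} (hp : ∀ x z, z 0 ∈ U → f (x + 1, z) = f (x, z))
    (x : ℝ) {z : Fin (m + 1) → Fin n → ℝ} (hz : z 0 ∈ U) :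
    fderiv ℝ f (x + 1, z) = fderiv ℝ f (x, z) := by
  have h1 : f =ᶠ[𝓝 (x, z)] fun q => f (q + (1, 0)) := by
    filter_upwards [(isOpen_jetDomain hU m).mem_nhds (x := (x, z)) hz] with q hq
    have := (hp q.1 q.2 hq).symm
    rwa [show (q.1 + 1, q.2) = q + (1, 0) by ext <;> simp] at this
  rw [h1.fderiv_eq, fderiv_comp_add_right]
  simp

/-- The total derivative is `∂f/∂x + ∑ u^{(k+1)} ∂f/∂u^{(k)}`. It raises the order of the density by
one, hence the shifts `castSucc` and `succ`. -/
theorem IsLocalDensity.deriv (hU : IsOpen U) {h : (ℝ → Fin n → ℝ) → ℝ → ℝ}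
    (hh : IsLocalDensity U h) : IsLocalDensity U fun u x => deriv (h u) x := by
  obtain ⟨m, f, hf, hp, hu⟩ := hh
  have hO := isOpen_jetDomain hU m
  refine ⟨m + 1, fun z => fderiv ℝ f (z.1, fun k => z.2 k.castSucc) (1, fun k => z.2 k.succ),
    ?_, ?_, ?_⟩
  · refine ContDiffOn.clm_apply ?_ (ContDiff.contDiffOn (by fun_prop))
    exact (hf.fderiv_of_isOpen hO (m := ∞) (by simp)).comp (ContDiff.contDiffOn (by fun_prop))
      fun z hz => hz
  · intro x z hz
    simp only
    rw [fderiv_jetDomain_periodic hU hp x (z := fun k => z k.castSucc) hz]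
  · intro u hu' x
    have e : h u = fun x => f (x, jet m u x) := funext fun x => hu u hu' x
    simp only [e]
    have h1 := ((hf.hasFDerivAt_of_mem hO (hu'.jet_mem m x)).comp_hasDerivAt x
      ((hasDerivAt_id x).prodMk (hu'.hasDerivAt_jet m x)))
    exact h1.deriv

theorem IsLocalDensity.iteratedDeriv (hU : IsOpen U) {h : (ℝ → Fin n → ℝ) → ℝ → ℝ}
    (hh : IsLocalDensity U h) (k : ℕ) : IsLocalDensity U fun u x => iteratedDeriv k (h u) x := by
  induction k with
  | zero => simpa using hh
  | succ k ih =>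
    simp only [iteratedDeriv_succ]
    exact ih.deriv hU

theorem IsLocalDensity.coord (i : Fin n) : IsLocalDensity U fun u x => u x i :=
  .comp_contDiffOn (A := fun z => z i) (by fun_prop)

theorem IsLocalDensity.coord_deriv (hU : IsOpen U) (i : Fin n) :
    IsLocalDensity U fun u x => _root_.deriv u x i :=
  ((IsLocalDensity.coord i).deriv hU).congr fun _ hu x => hu.deriv_apply x i

theorem IsLocalDensity.coord_iteratedDeriv (hU : IsOpen U) (k : ℕ) (i : Fin n) :
    IsLocalDensity U fun u x => _root_.iteratedDeriv k u x i :=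
  ((IsLocalDensity.coord i).iteratedDeriv hU k).congr fun _ hu x => hu.iteratedDeriv_apply k x i

theorem IsLocalDensity.smoothPeriodic {h : (ℝ → Fin n → ℝ) → ℝ → ℝ}
    (hh : IsLocalDensity U h) (hu : IsLoop U u) : SmoothPeriodic (h u) := by
  obtain ⟨m, f, hf, hp, hu'⟩ := hh
  have e : h u = fun x => f (x, jet m u x) := funext fun x => hu' u hu x
  rw [e]
  refine ⟨hf.comp_contDiff (contDiff_id.prodMk (hu.contDiff_jet m)) fun x => hu.jet_mem m x, ?_⟩
  intro x
  simp only [hu.jet_periodic m x]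
  exact hp x _ (hu.jet_mem m x)

/-! ### Directional derivatives on the loop space -/

/-- The derivative of a density along `v` at the loop `u`. -/
noncomputable def dirDeriv (h : (ℝ → Fin n → ℝ) → ℝ → ℝ) (u v : ℝ → Fin n → ℝ) (x : ℝ) : ℝ :=
  deriv (fun t : ℝ => h (u + t • v) x) 0

theorem hasDerivAt_comp_jet {E : Type*} [NormedAddCommGroup E] [NormedSpace ℝ E]
    (hU : IsOpen U) {m : ℕ} {f : ℝ × (Fin (m + 1) → Fin n → ℝ) → E}
    (hf : ContDiffOn ℝ ∞ f (jetDomain U m)) (hu : IsLoop U u) (x : ℝ)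
    (z : Fin (m + 1) → Fin n → ℝ) :
    HasDerivAt (fun t : ℝ => f (x, jet m u x + t • z)) (fderiv ℝ f (x, jet m u x) (0, z)) 0 := by
  have h1 : HasDerivAt (fun t : ℝ => ((x, jet m u x + t • z) : ℝ × (Fin (m + 1) → Fin n → ℝ)))
      (0, z) 0 := by
    refine (hasDerivAt_const _ _).prodMk ?_
    simpa using ((hasDerivAt_id (0 : ℝ)).smul_const z).const_add (jet m u x)
  have h2 : HasFDerivAt f (fderiv ℝ f (x, jet m u x)) (x, jet m u x + (0 : ℝ) • z) := by
    simpa using hf.hasFDerivAt_of_mem (isOpen_jetDomain hU m) (hu.jet_mem m x)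
  exact h2.comp_hasDerivAt (0 : ℝ) h1

/-- The jet of `u + t • v` is affine in `t`. The values lie in a general space `E` so that the
statement also applies to `fderiv ℝ f`, as the second variation needs. -/
theorem hasDerivAt_density {E : Type*} [NormedAddCommGroup E] [NormedSpace ℝ E]
    (hU : IsOpen U) {m : ℕ} {h : (ℝ → Fin n → ℝ) → ℝ → E}
    {f : ℝ × (Fin (m + 1) → Fin n → ℝ) → E}
    (hf : ContDiffOn ℝ ∞ f (jetDomain U m)) (hh : ∀ u, IsLoop U u → ∀ x, h u x = f (x, jet m u x))
    (hu : IsLoop U u) (hv : IsLoop Set.univ v) (x : ℝ) :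
    HasDerivAt (fun t : ℝ => h (u + t • v) x) (fderiv ℝ f (x, jet m u x) (0, jet m v x)) 0 := by
  refine (hasDerivAt_comp_jet hU hf hu x (jet m v x)).congr_of_eventuallyEq ?_
  filter_upwards [hu.eventually_add_smul hU hv] with t ht
  rw [hh _ ht, hu.univ.jet_add_smul hv]

theorem IsLocalDensity.hasDerivAt (hU : IsOpen U) {h : (ℝ → Fin n → ℝ) → ℝ → ℝ}
    (hh : IsLocalDensity U h) (hu : IsLoop U u) (hv : IsLoop Set.univ v) (x : ℝ) :
    HasDerivAt (fun t : ℝ => h (u + t • v) x) (dirDeriv h u v x) 0 := by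
  obtain ⟨m, f, hf, -, hh⟩ := hh
  exact (hasDerivAt_density hU hf hh hu hv x).differentiableAt.hasDerivAt

theorem IsLocalDensity.hasDerivAt_integral (hU : IsOpen U) {h : (ℝ → Fin n → ℝ) → ℝ → ℝ}
    (hh : IsLocalDensity U h) (hu : IsLoop U u) (hv : IsLoop Set.univ v) :
    HasDerivAt (fun t : ℝ => ∫ x in (0 : ℝ)..1, h (u + t • v) x)
      (∫ x in (0 : ℝ)..1, dirDeriv h u v x) 0 := by
  obtain ⟨m, f, hf, hp, hh⟩ := hh
  have hcu := hu.contDiff_jet m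
  have hcv := hv.contDiff_jet m
  set ψ : ℝ × ℝ → ℝ × (Fin (m + 1) → Fin n → ℝ) :=
    fun z => (z.2, jet m u z.2 + z.1 • jet m v z.2)
  have hψ : ContDiff ℝ ∞ ψ :=
    contDiff_snd.prodMk ((hcu.comp contDiff_snd).add (contDiff_fst.smul (hcv.comp contDiff_snd)))
  have key := hasDerivAt_intervalIntegral_of_contDiffOn (φ := fun z => f (ψ z))
    (φ' := fun x => dirDeriv h u v x)
    ((isOpen_jetDomain hU m).preimage hψ.continuous) (hf.comp hψ.contDiffOn fun z hz => hz)
    (fun x => by simpa [ψ] using hu.jet_mem m x) fun x => by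
      have h1 := hasDerivAt_density hU hf hh hu hv x
      rw [← h1.deriv] at h1
      have h2 := hasDerivAt_comp_jet hU hf hu x (jet m v x)
      rwa [← (hasDerivAt_density hU hf hh hu hv x).deriv] at h2
  refine key.congr_of_eventuallyEq ?_
  filter_upwards [hu.eventually_add_smul hU hv] with t ht
  refine intervalIntegral.integral_congr fun x _ => ?_
  simp only [hh _ ht, hu.univ.jet_add_smul hv, ψ]

theorem IsLocalDensity.smoothPeriodic_dirDeriv (hU : IsOpen U) {h : (ℝ → Fin n → ℝ) → ℝ → ℝ}
    (hh : IsLocalDensity U h) (hu : IsLoop U u) (hv : IsLoop Set.univ v) :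
    SmoothPeriodic (dirDeriv h u v) := by
  refine ⟨?_, fun x => ?_⟩
  · obtain ⟨m, f, hf, hp, hh⟩ := hh
    have e : dirDeriv h u v = fun x => fderiv ℝ f (x, jet m u x) (0, jet m v x) :=
      funext fun x => (hasDerivAt_density hU hf hh hu hv x).deriv
    rw [e]
    refine ContDiff.clm_apply ?_ (contDiff_const.prodMk (hv.contDiff_jet m))
    exact (hf.fderiv_of_isOpen (isOpen_jetDomain hU m) (m := ∞) (by simp)).comp_contDiff
      (contDiff_id.prodMk (hu.contDiff_jet m)) fun x => hu.jet_mem m x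
  · refine Filter.EventuallyEq.deriv_eq ?_
    filter_upwards [hu.eventually_add_smul hU hv] with t ht
    exact (hh.smoothPeriodic ht).2 x

/-- The first variation in Euler–Lagrange form. -/
theorem IsLocalDensity.exists_eulerLagrange (hU : IsOpen U) {h : (ℝ → Fin n → ℝ) → ℝ → ℝ}
    (hh : IsLocalDensity U h) : ∃ ξ : Fin n → (ℝ → Fin n → ℝ) → ℝ → ℝ,
      (∀ i, IsLocalDensity U (ξ i)) ∧ ∀ u v, IsLoop U u → IsLoop Set.univ v →
        ∫ x in (0 : ℝ)..1, dirDeriv h u v x = ∫ x in (0 : ℝ)..1, ∑ i, ξ i u x * v x i := by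
  obtain ⟨m, f, hf, hp, hh⟩ := hh
  have hO := isOpen_jetDomain hU m
  set q : Fin (m + 1) → Fin n → (ℝ → Fin n → ℝ) → ℝ → ℝ := fun k i u x =>
    fderiv ℝ f (x, jet m u x) (0, Pi.single k (Pi.single i 1))
  have hq : ∀ k i, IsLocalDensity U (q k i) := fun k i => by
    refine ⟨m, fun z => fderiv ℝ f z (0, Pi.single k (Pi.single i 1)), ?_, ?_, fun _ _ _ => rfl⟩
    · exact (hf.fderiv_of_isOpen hO (m := ∞) (by simp)).clm_apply contDiffOn_const
    · intro x z hz
      simp only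
      rw [fderiv_jetDomain_periodic hU hp x hz]
  -- The Euler operator `∑ (-d/dx)^k ∂f/∂u^{i,(k)}`, produced by integrating each `v^{(k)}` by parts
  -- `k` times.
  refine ⟨fun i u x => ∑ k : Fin (m + 1), (-1) ^ (k : ℕ) * _root_.iteratedDeriv k (q k i u) x,
    fun i => .sum _ fun k _ => (IsLocalDensity.const _).mul ((hq k i).iteratedDeriv hU k), ?_⟩
  intro u v hu hv
  have e1 : ∀ x, dirDeriv h u v x
      = ∑ k : Fin (m + 1), ∑ i, q k i u x * _root_.iteratedDeriv k (fun y => v y i) x := by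
    intro x
    rw [dirDeriv, (hasDerivAt_density hU hf hh hu hv x).deriv]
    have e2 : ((0, jet m v x) : ℝ × (Fin (m + 1) → Fin n → ℝ)) = ∑ k : Fin (m + 1), ∑ i,
        _root_.iteratedDeriv k (fun y => v y i) x •
          ((0, Pi.single k (Pi.single i 1)) : ℝ × (Fin (m + 1) → Fin n → ℝ)) := by
      refine Prod.ext (by simp [Prod.fst_sum]) ?_
      rw [Prod.snd_sum]
      funext k i
      simp [Prod.snd_sum, Finset.sum_apply, Pi.single_apply, jet, hv.iteratedDeriv_apply,
        ite_apply, Finset.sum_ite_eq]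
    rw [e2, map_sum]
    refine Finset.sum_congr rfl fun k _ => ?_
    rw [map_sum]
    exact Finset.sum_congr rfl fun i _ => by rw [map_smul, smul_eq_mul, mul_comm]
  have hqs : ∀ k i, SmoothPeriodic (q k i u) := fun k i => (hq k i).smoothPeriodic hu
  simp only [e1]
  simp only [Finset.sum_mul]
  rw [intervalIntegral.integral_finsetSum fun k _ => (SmoothPeriodic.sum fun i _ =>
      (hqs k i).mul ((hv.apply i).iteratedDeriv k)).intervalIntegrable _ _,
    intervalIntegral.integral_finsetSum fun i _ => (SmoothPeriodic.sum fun k _ =>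
      ((SmoothPeriodic.const _).mul ((hqs k i).iteratedDeriv k)).mul
        (hv.apply i)).intervalIntegrable _ _]
  simp_rw [intervalIntegral.integral_finsetSum fun i _ =>
      ((hqs _ i).mul ((hv.apply i).iteratedDeriv _)).intervalIntegrable _ _]
  rw [Finset.sum_comm]
  refine Finset.sum_congr rfl fun i _ => ?_
  rw [intervalIntegral.integral_finsetSum fun k _ =>
      (((SmoothPeriodic.const _).mul ((hqs k i).iteratedDeriv k)).mul
        (hv.apply i)).intervalIntegrable _ _]
  exact Finset.sum_congr rfl fun k _ => (hqs k i).integral_mul_iteratedDeriv (hv.apply i) k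

end Loops

/-! ### Local functionals and their variational derivatives -/

section Functionals

variable {n : ℕ} {U : Set (Fin n → ℝ)} {F F' G H K : LoopFunctional n} {u v w : ℝ → Fin n → ℝ}

theorem isLocalFunctional_iff : IsLocalFunctional U F ↔
    ∃ h, IsLocalDensity U h ∧ ∀ u, IsLoop U u → F u = ∫ x in (0 : ℝ)..1, h u x := by
  constructor
  · rintro ⟨m, f, hf, hp, h⟩
    exact ⟨fun u x => f (x, jet m u x), ⟨m, f, hf, hp, fun _ _ _ => rfl⟩, h⟩
  · rintro ⟨h, ⟨m, f, hf, hp, hh⟩, hF⟩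
    refine ⟨m, f, hf, hp, fun u hu => ?_⟩
    rw [hF u hu]
    exact intervalIntegral.integral_congr fun x _ => hh u hu x

theorem IsLocalDensity.isLocalFunctional {h : (ℝ → Fin n → ℝ) → ℝ → ℝ} (hh : IsLocalDensity U h) :
    IsLocalFunctional U fun u => ∫ x in (0 : ℝ)..1, h u x :=
  isLocalFunctional_iff.2 ⟨h, hh, fun _ _ => rfl⟩

theorem IsLocalFunctional.congr (hF : IsLocalFunctional U F)
    (e : ∀ u, IsLoop U u → F' u = F u) : IsLocalFunctional U F' := by
  obtain ⟨h, hh, hF⟩ := isLocalFunctional_iff.1 hF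
  exact isLocalFunctional_iff.2 ⟨h, hh, fun u hu => (e u hu).trans (hF u hu)⟩

/-- The pairing of covector fields and vector fields along a loop. -/
noncomputable def loopPairing (ξ v : ℝ → Fin n → ℝ) : ℝ :=
  ∫ x in (0 : ℝ)..1, ∑ i, ξ x i * v x i

/-- Fields on the loop space whose components are local densities. -/
def IsLocalField (U : Set (Fin n → ℝ)) (ξ : (ℝ → Fin n → ℝ) → ℝ → Fin n → ℝ) : Prop :=
  ∀ i, IsLocalDensity U fun u x => ξ u x i

theorem IsLocalField.isLoop {ξ : (ℝ → Fin n → ℝ) → ℝ → Fin n → ℝ} (hξ : IsLocalField U ξ)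
    (hu : IsLoop U u) : IsLoop Set.univ (ξ u) :=
  isLoop_univ_iff.2 fun i => (hξ i).smoothPeriodic hu

/-- The derivative of a field on the loop space along `v`. -/
noncomputable def fieldDeriv (ξ : (ℝ → Fin n → ℝ) → ℝ → Fin n → ℝ) (u v : ℝ → Fin n → ℝ) :
    ℝ → Fin n → ℝ :=
  fun x i => dirDeriv (fun u x => ξ u x i) u v x

theorem IsLocalField.isLoop_fieldDeriv (hU : IsOpen U) {ξ : (ℝ → Fin n → ℝ) → ℝ → Fin n → ℝ}
    (hξ : IsLocalField U ξ) (hu : IsLoop U u) (hv : IsLoop Set.univ v) :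
    IsLoop Set.univ (fieldDeriv ξ u v) :=
  isLoop_univ_iff.2 fun i => (hξ i).smoothPeriodic_dirDeriv hU hu hv

theorem IsLoop.intervalIntegrable_sum_mul {ξ : ℝ → Fin n → ℝ} (hξ : IsLoop Set.univ ξ)
    (hv : IsLoop Set.univ v) (a b : ℝ) :
    IntervalIntegrable (fun x => ∑ i, ξ x i * v x i) MeasureTheory.volume a b :=
  (SmoothPeriodic.sum fun i _ => (hξ.apply i).mul (hv.apply i)).intervalIntegrable a b

/-- The Euler–Lagrange expression is a variational derivative at every loop in `U`, so the default
value `0` of `variationalDerivative` plays no role for local functionals. -/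
theorem IsLocalFunctional.exists_gradient (hU : IsOpen U) (hF : IsLocalFunctional U F) :
    ∃ ξ : (ℝ → Fin n → ℝ) → ℝ → Fin n → ℝ, IsLocalField U ξ ∧
      ∀ u, IsLoop U u → IsVariationalDerivative F u (ξ u) := by
  obtain ⟨h, hh, hF⟩ := isLocalFunctional_iff.1 hF
  obtain ⟨ξ, hξ, hel⟩ := hh.exists_eulerLagrange hU
  have hl : IsLocalField U fun u x i => ξ i u x := hξ
  refine ⟨fun u x i => ξ i u x, hl, fun u hu => ⟨hl.isLoop hu, fun v hv => ?_⟩⟩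
  refine ((hh.hasDerivAt_integral hU hu hv).congr_deriv (hel u v hu hv)).congr_of_eventuallyEq ?_
  filter_upwards [hu.eventually_add_smul hU hv] with t ht using hF _ ht

theorem IsVariationalDerivative.variationalDerivative_eq {ξ : ℝ → Fin n → ℝ}
    (hξ : IsVariationalDerivative F u ξ) : variationalDerivative F u = ξ := by
  have h : ∃ ξ, IsVariationalDerivative F u ξ := ⟨ξ, hξ⟩
  rw [variationalDerivative, dif_pos h]
  exact h.choose_spec.unique hξ

theorem IsLocalFunctional.isVariationalDerivative (hU : IsOpen U) (hF : IsLocalFunctional U F)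
    (hu : IsLoop U u) : IsVariationalDerivative F u (variationalDerivative F u) := by
  obtain ⟨ξ, -, hξ⟩ := hF.exists_gradient hU
  rw [(hξ u hu).variationalDerivative_eq]
  exact hξ u hu

/-- Locality of the gradient keeps brackets, and hence iterated brackets, among the local
functionals. -/
theorem IsLocalFunctional.isLocalField (hU : IsOpen U) (hF : IsLocalFunctional U F) :
    IsLocalField U (variationalDerivative F) := by
  obtain ⟨ξ, hl, hξ⟩ := hF.exists_gradient hU
  refine fun i => (hl i).congr fun u hu x => ?_
  rw [(hξ u hu).variationalDerivative_eq]

theorem IsLocalFunctional.isLoop (hU : IsOpen U) (hF : IsLocalFunctional U F)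
    (hu : IsLoop U u) : IsLoop Set.univ (variationalDerivative F u) :=
  (hF.isLocalField hU).isLoop hu

theorem IsLocalFunctional.hasDerivAt (hU : IsOpen U) (hF : IsLocalFunctional U F)
    (hu : IsLoop U u) (hv : IsLoop Set.univ v) :
    HasDerivAt (fun t : ℝ => F (u + t • v)) (loopPairing (variationalDerivative F u) v) 0 :=
  (hF.isVariationalDerivative hU hu).2 v hv

theorem IsVariationalDerivative.congr (hU : IsOpen U) (hu : IsLoop U u) {ξ : ℝ → Fin n → ℝ}
    (hξ : IsVariationalDerivative F u ξ) (e : ∀ u, IsLoop U u → F' u = F u) :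
    IsVariationalDerivative F' u ξ := by
  refine ⟨hξ.1, fun v hv => (hξ.2 v hv).congr_of_eventuallyEq ?_⟩
  filter_upwards [hu.eventually_add_smul hU hv] with t ht using e _ ht

theorem IsLocalFunctional.variationalDerivative_congr (hU : IsOpen U) (hF : IsLocalFunctional U F)
    (hu : IsLoop U u) (e : ∀ u, IsLoop U u → F' u = F u) :
    variationalDerivative F' u = variationalDerivative F u :=
  ((hF.isVariationalDerivative hU hu).congr hU hu e).variationalDerivative_eq

theorem IsLocalFunctional.add_smul (hF : IsLocalFunctional U F) (hG : IsLocalFunctional U G)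
    (c : ℝ) : IsLocalFunctional U (F + c • G) := by
  obtain ⟨f, hf, hF⟩ := isLocalFunctional_iff.1 hF
  obtain ⟨g, hg, hG⟩ := isLocalFunctional_iff.1 hG
  refine isLocalFunctional_iff.2 ⟨_, hf.add ((IsLocalDensity.const c).mul hg), fun u hu => ?_⟩
  rw [intervalIntegral.integral_add ((hf.smoothPeriodic hu).intervalIntegrable _ _)
    (((SmoothPeriodic.const c).mul (hg.smoothPeriodic hu)).intervalIntegrable _ _),
    intervalIntegral.integral_const_mul, ← hF u hu, ← hG u hu]
  rfl

theorem IsLoop.loopPairing_add_smul {ξ η : ℝ → Fin n → ℝ} (hξ : IsLoop Set.univ ξ)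
    (hη : IsLoop Set.univ η) (hv : IsLoop Set.univ v) (c : ℝ) :
    loopPairing (ξ + c • η) v = loopPairing ξ v + c * loopPairing η v := by
  rw [loopPairing, loopPairing, loopPairing, ← intervalIntegral.integral_const_mul,
    ← intervalIntegral.integral_add (hξ.intervalIntegrable_sum_mul hv _ _)
      ((hη.intervalIntegrable_sum_mul hv _ _).const_mul c)]
  refine intervalIntegral.integral_congr fun x _ => ?_
  simp only [Pi.add_apply, Pi.smul_apply, smul_eq_mul, Finset.mul_sum, ← Finset.sum_add_distrib]
  exact Finset.sum_congr rfl fun i _ => by ring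

theorem loopPairing_comm (ξ v : ℝ → Fin n → ℝ) : loopPairing ξ v = loopPairing v ξ :=
  intervalIntegral.integral_congr fun _ _ => Finset.sum_congr rfl fun _ _ => mul_comm _ _

theorem IsLocalFunctional.variationalDerivative_add_smul (hU : IsOpen U)
    (hF : IsLocalFunctional U F) (hG : IsLocalFunctional U G) (hu : IsLoop U u) (c : ℝ) :
    variationalDerivative (F + c • G) u
      = variationalDerivative F u + c • variationalDerivative G u := by
  refine IsVariationalDerivative.variationalDerivative_eq
    ⟨(hF.isLoop hU hu).add ((hG.isLoop hU hu).smul c), fun v hv => ?_⟩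
  refine ((hF.hasDerivAt hU hu hv).add ((hG.hasDerivAt hU hu hv).const_mul c)).congr_deriv ?_
  exact ((hF.isLoop hU hu).loopPairing_add_smul (hG.isLoop hU hu) hv c).symm

/-! ### The second variation -/

/-- The second variation of a functional. -/
noncomputable def hessian (F : LoopFunctional n) (u v w : ℝ → Fin n → ℝ) : ℝ :=
  loopPairing (fieldDeriv (variationalDerivative F) u v) w

/-- The Leibniz rule for the pairing, both entries depending on the loop. -/
theorem IsLocalField.hasDerivAt_loopPairing (hU : IsOpen U)
    {ξ η : (ℝ → Fin n → ℝ) → ℝ → Fin n → ℝ} (hξ : IsLocalField U ξ) (hη : IsLocalField U η)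
    (hu : IsLoop U u) (hv : IsLoop Set.univ v) :
    HasDerivAt (fun t : ℝ => loopPairing (ξ (u + t • v)) (η (u + t • v)))
      (loopPairing (fieldDeriv ξ u v) (η u) + loopPairing (ξ u) (fieldDeriv η u v)) 0 := by
  have hd : IsLocalDensity U fun u x => ∑ i, ξ u x i * η u x i :=
    .sum _ fun i _ => (hξ i).mul (hη i)
  refine (hd.hasDerivAt_integral hU hu hv).congr_deriv ?_
  rw [loopPairing, loopPairing, ← intervalIntegral.integral_add
    ((hξ.isLoop_fieldDeriv hU hu hv).intervalIntegrable_sum_mul (hη.isLoop hu) _ _)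
    ((hξ.isLoop hu).intervalIntegrable_sum_mul (hη.isLoop_fieldDeriv hU hu hv) _ _)]
  refine intervalIntegral.integral_congr fun x _ => ?_
  have h1 := HasDerivAt.fun_sum fun i (_ : i ∈ Finset.univ) =>
    ((hξ i).hasDerivAt hU hu hv x).mul ((hη i).hasDerivAt hU hu hv x)
  have h2 := (hd.hasDerivAt hU hu hv x).unique h1
  simpa [Finset.sum_add_distrib, fieldDeriv] using h2

theorem isLocalField_const {v : ℝ → Fin n → ℝ} (hv : IsLoop Set.univ v) :
    IsLocalField U fun _ => v :=
  fun i => .of_smoothPeriodic (hv.apply i)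

theorem fieldDeriv_const (v : ℝ → Fin n → ℝ) : fieldDeriv (fun _ => v) u w = 0 := by
  funext x i
  simp [fieldDeriv, dirDeriv]

theorem loopPairing_zero (ξ : ℝ → Fin n → ℝ) : loopPairing ξ 0 = 0 := by
  simp [loopPairing]

theorem zero_loopPairing (ξ : ℝ → Fin n → ℝ) : loopPairing 0 ξ = 0 := by
  simp [loopPairing]

theorem IsLocalFunctional.hasDerivAt_hessian (hU : IsOpen U) (hF : IsLocalFunctional U F)
    (hu : IsLoop U u) (hv : IsLoop Set.univ v) (hw : IsLoop Set.univ w) :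
    HasDerivAt (fun t : ℝ => loopPairing (variationalDerivative F (u + t • v)) w)
      (hessian F u v w) 0 := by
  have := (hF.isLocalField hU).hasDerivAt_loopPairing hU (isLocalField_const hw) hu hv
  rwa [fieldDeriv_const, loopPairing_zero, add_zero] at this

/-- Both sides are the integral of the second derivative of the density evaluated on the jets of `v`
and `w`, and that second derivative is a symmetric bilinear form. -/
theorem IsLocalFunctional.hessian_comm (hU : IsOpen U) (hF : IsLocalFunctional U F)
    (hu : IsLoop U u) (hv : IsLoop Set.univ v) (hw : IsLoop Set.univ w) :
    hessian F u v w = hessian F u w v := by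
  obtain ⟨m, f, hf, hp, h⟩ := id hF
  have hO := isOpen_jetDomain hU m
  have hf' : ContDiffOn ℝ ∞ (fderiv ℝ f) (jetDomain U m) := hf.fderiv_of_isOpen hO (by simp)
  have key : ∀ v w, IsLoop Set.univ v → IsLoop Set.univ w → hessian F u v w
      = ∫ x in (0 : ℝ)..1, fderiv ℝ (fderiv ℝ f) (x, jet m u x) (0, jet m v x) (0, jet m w x) := by
    intro v w hv hw
    have hcw := hw.contDiff_jet m
    -- Uniqueness of the derivative of `F` along `w` undoes the integration by parts hidden in the
    -- variational derivative.
    have e1 : ∀ u, IsLoop U u → loopPairing (variationalDerivative F u) w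
        = ∫ x in (0 : ℝ)..1, fderiv ℝ f (x, jet m u x) (0, jet m w x) := by
      intro u hu
      have hd : IsLocalDensity U fun u x => f (x, jet m u x) :=
        ⟨m, f, hf, hp, fun _ _ _ => rfl⟩
      have h1 := hd.hasDerivAt_integral hU hu hw
      have h2 : ∀ᶠ t in 𝓝 (0 : ℝ), F (u + t • w)
          = ∫ x in (0 : ℝ)..1, f (x, jet m (u + t • w) x) := by
        filter_upwards [hu.eventually_add_smul hU hw] with t ht using h _ ht
      rw [(hF.hasDerivAt hU hu hw).unique (h1.congr_of_eventuallyEq h2)]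
      refine intervalIntegral.integral_congr fun x _ => ?_
      exact (hasDerivAt_density hU hf (fun _ _ _ => rfl) hu hw x).deriv
    have hg : ContDiffOn ℝ ∞ (fun z : ℝ × (Fin (m + 1) → Fin n → ℝ) =>
        fderiv ℝ f z (0, jet m w z.1)) (jetDomain U m) :=
      hf'.clm_apply (ContDiff.contDiffOn (contDiff_const.prodMk (hcw.comp contDiff_fst)))
    -- For fixed `w` this is again a local density in `u`, depending explicitly on `x` through the
    -- periodic jet of `w`; it can therefore be varied along `v`.
    have hd : IsLocalDensity U fun u x => fderiv ℝ f (x, jet m u x) (0, jet m w x) := by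
      refine ⟨m, fun z => fderiv ℝ f z (0, jet m w z.1), hg, ?_, fun _ _ _ => rfl⟩
      intro x z hz
      simp only
      rw [fderiv_jetDomain_periodic hU hp x hz, hw.jet_periodic]
    have h3 : ∀ᶠ t in 𝓝 (0 : ℝ), loopPairing (variationalDerivative F (u + t • v)) w
        = ∫ x in (0 : ℝ)..1, fderiv ℝ f (x, jet m (u + t • v) x) (0, jet m w x) := by
      filter_upwards [hu.eventually_add_smul hU hv] with t ht using e1 _ ht
    rw [(hF.hasDerivAt_hessian hU hu hv hw).unique
      ((hd.hasDerivAt_integral hU hu hv).congr_of_eventuallyEq h3)]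
    refine intervalIntegral.integral_congr fun x _ => ?_
    have h4 := hasDerivAt_density hU hf' (h := fun u x => fderiv ℝ f (x, jet m u x))
      (fun _ _ _ => rfl) hu hv x
    have h5 := h4.clm_apply (hasDerivAt_const (0 : ℝ)
      ((0, jet m w x) : ℝ × (Fin (m + 1) → Fin n → ℝ)))
    simpa [dirDeriv] using h5.deriv
  rw [key v w hv hw, key w v hw hv]
  refine intervalIntegral.integral_congr fun x _ => ?_
  exact ((hf.contDiffAt (hO.mem_nhds (hu.jet_mem m x))).isSymmSndFDerivAt
    (by simpa using two_le_infty)).eq _ _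

end Functionals

/-! ### The bracket of a constant operator `g^{ij} d/dx` -/

section ConstantOperator

variable {n : ℕ} {U : Set (Fin n → ℝ)} {F F' H K : LoopFunctional n} {u v w : ℝ → Fin n → ℝ}
  {ξ η : ℝ → Fin n → ℝ} {G : Matrix (Fin n) (Fin n) ℝ} {P Q : LoopOperator n}

/-- The vector field `g^{ij} dξ_j/dx`. -/
noncomputable def hamField (G : Matrix (Fin n) (Fin n) ℝ) (ξ : ℝ → Fin n → ℝ) : ℝ → Fin n → ℝ :=
  fun x i => ∑ j, G i j * deriv ξ x j

/-- `P` is the operator `g^{ij} d/dx` at the loops in `U`. -/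
def IsConstantOperator (U : Set (Fin n → ℝ)) (G : Matrix (Fin n) (Fin n) ℝ)
    (P : LoopOperator n) : Prop :=
  ∀ u, IsLoop U u → P u = hamField G

/-- Operators which send local fields to local fields. -/
def IsLocalOperator (U : Set (Fin n → ℝ)) (P : LoopOperator n) : Prop :=
  ∀ ξ, IsLocalField U ξ → IsLocalField U fun u => P u (ξ u)

theorem IsLoop.hamField (hξ : IsLoop Set.univ ξ) : IsLoop Set.univ (hamField G ξ) :=
  isLoop_univ_iff.2 fun _ => .sum fun j _ => (SmoothPeriodic.const _).mul (hξ.deriv.apply j)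

/-- The sum of the two pairings integrates the total derivative of `g^{ij} ξ_i η_j`; symmetry of `G`
is what makes the two product-rule terms match. -/
theorem loopPairing_hamField (hG : G.IsSymm) (hξ : IsLoop Set.univ ξ) (hη : IsLoop Set.univ η) :
    loopPairing ξ (hamField G η) = -loopPairing η (hamField G ξ) := by
  rw [eq_neg_iff_add_eq_zero, loopPairing, loopPairing, ← intervalIntegral.integral_add
    (hξ.intervalIntegrable_sum_mul hη.hamField _ _) (hη.intervalIntegrable_sum_mul hξ.hamField _ _)]
  refine (SmoothPeriodic.sum (s := Finset.univ) (f := fun i x => ∑ j, G i j * (ξ x i * η x j))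
    fun i _ => .sum fun j _ => (SmoothPeriodic.const _).mul
      ((hξ.apply i).mul (hη.apply j))).integral_eq_zero_of_hasDerivAt fun x => ?_
  have h := HasDerivAt.fun_sum fun i (_ : i ∈ Finset.univ) => HasDerivAt.fun_sum
    fun j (_ : j ∈ Finset.univ) => (((hξ.apply i).hasDerivAt x).mul
      ((hη.apply j).hasDerivAt x)).const_mul (G i j)
  refine h.congr_deriv ?_
  simp only [hamField, hξ.deriv_apply, hη.deriv_apply, Finset.mul_sum, mul_add,
    Finset.sum_add_distrib]
  rw [add_comm]
  congr 1
  · exact Finset.sum_congr rfl fun _ _ => Finset.sum_congr rfl fun _ _ => by ring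
  · rw [Finset.sum_comm]
    refine Finset.sum_congr rfl fun i _ => Finset.sum_congr rfl fun j _ => ?_
    rw [← hG.apply i j]
    ring

theorem isLocalField_hamField (hU : IsOpen U) {ξ : (ℝ → Fin n → ℝ) → ℝ → Fin n → ℝ}
    (hξ : IsLocalField U ξ) : IsLocalField U fun u => hamField G (ξ u) :=
  fun _ => .sum _ fun j _ => (IsLocalDensity.const _).mul
    (((hξ j).deriv hU).congr fun _ hu x => (hξ.isLoop hu).deriv_apply x j)

theorem IsConstantOperator.isLocalOperator (hU : IsOpen U) (hP : IsConstantOperator U G P) :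
    IsLocalOperator U P := fun ξ hξ i =>
  (isLocalField_hamField (G := G) hU hξ i).congr fun u hu x => by simp only [hP u hu]

theorem loopBracket_eq (P : LoopOperator n) (F H : LoopFunctional n) (u : ℝ → Fin n → ℝ) :
    loopBracket P F H u = loopPairing (variationalDerivative F u) (P u (variationalDerivative H u)) :=
  rfl

theorem IsLocalOperator.isLocalFunctional_loopBracket (hU : IsOpen U) (hP : IsLocalOperator U P)
    (hF : IsLocalFunctional U F) (hH : IsLocalFunctional U H) :
    IsLocalFunctional U (loopBracket P F H) :=
  IsLocalDensity.isLocalFunctional (.sum _ fun i _ =>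
    (hF.isLocalField hU i).mul (hP _ (hH.isLocalField hU) i))

theorem loopBracket_congr_left (hU : IsOpen U) (hF : IsLocalFunctional U F) (hu : IsLoop U u)
    (e : ∀ u, IsLoop U u → F' u = F u) : loopBracket P F' H u = loopBracket P F H u := by
  rw [loopBracket_eq, loopBracket_eq, hF.variationalDerivative_congr hU hu e]

theorem loopBracket_add_smul_left (hU : IsOpen U) (hP : IsLocalOperator U P)
    (hF : IsLocalFunctional U F) (hF' : IsLocalFunctional U F') (hH : IsLocalFunctional U H)
    (hu : IsLoop U u) (c : ℝ) : loopBracket P (F + c • F') H u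
      = loopBracket P F H u + c * loopBracket P F' H u := by
  simp only [loopBracket_eq]
  rw [hF.variationalDerivative_add_smul hU hF' hu c]
  exact (hF.isLoop hU hu).loopPairing_add_smul (hF'.isLoop hU hu)
    ((hP _ (hH.isLocalField hU)).isLoop hu) c

theorem loopBracket_add_smul_operator (hU : IsOpen U) (hP : IsLocalOperator U P)
    (hQ : IsLocalOperator U Q) (hF : IsLocalFunctional U F) (hH : IsLocalFunctional U H)
    (hu : IsLoop U u) (c : ℝ) :
    loopBracket (P + c • Q) F H u = loopBracket P F H u + c * loopBracket Q F H u := by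
  simp only [loopBracket_eq]
  rw [loopPairing_comm, loopPairing_comm _ (P u _), loopPairing_comm _ (Q u _)]
  exact ((hP _ (hH.isLocalField hU)).isLoop hu).loopPairing_add_smul
    ((hQ _ (hH.isLocalField hU)).isLoop hu) (hF.isLoop hU hu) c

/-- The bracket with `H` is the derivative along the Hamiltonian vector field of `H`. -/
theorem IsConstantOperator.hasDerivAt_loopBracket (hU : IsOpen U) (hP : IsConstantOperator U G P)
    (hK : IsLocalFunctional U K) (hH : IsLocalFunctional U H) (hu : IsLoop U u) :
    HasDerivAt (fun t : ℝ => K (u + t • hamField G (variationalDerivative H u)))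
      (loopBracket P K H u) 0 := by
  rw [loopBracket_eq, hP u hu]
  exact hK.hasDerivAt hU hu (hH.isLoop hU hu).hamField

theorem IsConstantOperator.loopBracket_skew (hU : IsOpen U) (hG : G.IsSymm)
    (hP : IsConstantOperator U G P) (hF : IsLocalFunctional U F) (hH : IsLocalFunctional U H)
    (hu : IsLoop U u) : loopBracket P F H u = -loopBracket P H F u := by
  rw [loopBracket_eq, loopBracket_eq, hP u hu]
  exact loopPairing_hamField hG (hF.isLoop hU hu) (hH.isLoop hU hu)

/-- The skewness of `G d/dx`, differentiated in the loop with `ξ` held fixed. -/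
theorem loopPairing_fieldDeriv_hamField (hU : IsOpen U) (hG : G.IsSymm)
    {η : (ℝ → Fin n → ℝ) → ℝ → Fin n → ℝ} (hη : IsLocalField U η) (hξ : IsLoop Set.univ ξ)
    (hu : IsLoop U u) (hv : IsLoop Set.univ v) :
    loopPairing ξ (fieldDeriv (fun u => hamField G (η u)) u v)
      = -loopPairing (fieldDeriv η u v) (hamField G ξ) := by
  have h1 := (isLocalField_const hξ).hasDerivAt_loopPairing hU (isLocalField_hamField (G := G) hU hη)
    hu hv
  have h2 := (hη.hasDerivAt_loopPairing hU (isLocalField_const hξ.hamField) hu hv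
    (η := fun _ => hamField G ξ)).neg
  rw [fieldDeriv_const, zero_loopPairing, zero_add] at h1
  rw [fieldDeriv_const, loopPairing_zero, add_zero] at h2
  refine h1.unique (h2.congr_of_eventuallyEq ?_)
  filter_upwards [hu.eventually_add_smul hU hv] with t ht
  exact loopPairing_hamField hG hξ (hη.isLoop ht)

/-- The operator itself has no variation, so only the two gradients vary; moving `G d/dx` across the
pairing produces the minus sign. -/
theorem IsConstantOperator.hasDerivAt_loopBracket_of_isLoop (hU : IsOpen U) (hG : G.IsSymm)
    (hP : IsConstantOperator U G P) (hF : IsLocalFunctional U F) (hH : IsLocalFunctional U H)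
    (hu : IsLoop U u) (hv : IsLoop Set.univ v) :
    HasDerivAt (fun t : ℝ => loopBracket P F H (u + t • v))
      (hessian F u v (hamField G (variationalDerivative H u))
        - hessian H u v (hamField G (variationalDerivative F u))) 0 := by
  have h := (hF.isLocalField hU).hasDerivAt_loopPairing hU
    (isLocalField_hamField (G := G) hU (hH.isLocalField hU)) hu hv
  rw [loopPairing_fieldDeriv_hamField hU hG (hH.isLocalField hU) (hF.isLoop hU hu) hu hv,
    ← sub_eq_add_neg] at h
  refine h.congr_of_eventuallyEq ?_
  filter_upwards [hu.eventually_add_smul hU hv] with t ht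
  rw [loopBracket_eq, hP _ ht]

theorem IsConstantOperator.loopBracket_loopBracket (hU : IsOpen U) (hG : G.IsSymm)
    (hP : IsConstantOperator U G P) (hF : IsLocalFunctional U F) (hH : IsLocalFunctional U H)
    (hK : IsLocalFunctional U K) (hu : IsLoop U u) : loopBracket P (loopBracket P F H) K u
      = hessian F u (hamField G (variationalDerivative K u)) (hamField G (variationalDerivative H u))
        - hessian H u (hamField G (variationalDerivative K u))
          (hamField G (variationalDerivative F u)) :=
  (hP.hasDerivAt_loopBracket hU ((hP.isLocalOperator hU).isLocalFunctional_loopBracket hU hF hH)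
    hK hu).unique (hP.hasDerivAt_loopBracket_of_isLoop hU hG hF hH hu (hK.isLoop hU hu).hamField)

/-- The cyclic sum consists of six second variations that cancel in pairs by `hessian_comm`. -/
theorem IsConstantOperator.jacobiator_eq_zero (hU : IsOpen U) (hG : G.IsSymm)
    (hP : IsConstantOperator U G P) (hF : IsLocalFunctional U F) (hH : IsLocalFunctional U H)
    (hK : IsLocalFunctional U K) (hu : IsLoop U u) : jacobiator P F H K u = 0 := by
  have lF := (hF.isLoop hU hu).hamField (G := G)
  have lH := (hH.isLoop hU hu).hamField (G := G)
  have lK := (hK.isLoop hU hu).hamField (G := G)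
  rw [jacobiator, hP.loopBracket_loopBracket hU hG hF hH hK hu,
    hP.loopBracket_loopBracket hU hG hH hK hF hu, hP.loopBracket_loopBracket hU hG hK hF hH hu,
    hF.hessian_comm hU hu lK lH, hH.hessian_comm hU hu lK lF, hK.hessian_comm hU hu lF lH]
  ring

/-! ### The Lie derivative -/

section LieDerivative

variable {e : (ℝ → Fin n → ℝ) → ℝ → Fin n → ℝ}

theorem IsLocalFunctional.hasDerivAt_evolutionaryDerivative (hU : IsOpen U)
    (he : IsLocalField U e) (hF : IsLocalFunctional U F) (hu : IsLoop U u) :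
    HasDerivAt (fun t : ℝ => F (u + t • e u)) (evolutionaryDerivative e F u) 0 :=
  (hF.hasDerivAt hU hu (he.isLoop hu)).differentiableAt.hasDerivAt

theorem IsLocalFunctional.evolutionaryDerivative_eq (hU : IsOpen U) (he : IsLocalField U e)
    (hF : IsLocalFunctional U F) (hu : IsLoop U u) :
    evolutionaryDerivative e F u = loopPairing (variationalDerivative F u) (e u) :=
  (hF.hasDerivAt hU hu (he.isLoop hu)).deriv

theorem IsLocalFunctional.isLocalFunctional_evolutionaryDerivative (hU : IsOpen U)
    (he : IsLocalField U e) (hF : IsLocalFunctional U F) :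
    IsLocalFunctional U (evolutionaryDerivative e F) :=
  (IsLocalDensity.isLocalFunctional (.sum _ fun i _ => (hF.isLocalField hU i).mul (he i))).congr
    fun _ hu => hF.evolutionaryDerivative_eq hU he hu

theorem IsConstantOperator.loopBracket_evolutionaryDerivative (hU : IsOpen U)
    (hP : IsConstantOperator U G P) (he : IsLocalField U e)
    (hF : IsLocalFunctional U F) (hH : IsLocalFunctional U H) (hu : IsLoop U u) :
    loopBracket P (evolutionaryDerivative e F) H u
      = hessian F u (hamField G (variationalDerivative H u)) (e u)
        + loopPairing (variationalDerivative F u)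
          (fieldDeriv e u (hamField G (variationalDerivative H u))) := by
  have lH := (hH.isLoop hU hu).hamField (G := G)
  refine (hP.hasDerivAt_loopBracket hU (hF.isLocalFunctional_evolutionaryDerivative hU he) hH
    hu).unique (((hF.isLocalField hU).hasDerivAt_loopPairing hU he hu lH).congr_of_eventuallyEq ?_)
  filter_upwards [hu.eventually_add_smul hU lH] with t ht
  exact hF.evolutionaryDerivative_eq hU he ht

/-- The second variations of `F` and of `H` cancel by symmetry, leaving only the linearization of
`e`. In operator form `𝓛_e P = -(e_* P + P e_*†)`. -/
theorem IsConstantOperator.lieDerivativeBracket_eq (hU : IsOpen U) (hG : G.IsSymm)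
    (hP : IsConstantOperator U G P) (he : IsLocalField U e)
    (hF : IsLocalFunctional U F) (hH : IsLocalFunctional U H) (hu : IsLoop U u) :
    lieDerivativeBracket e P F H u
      = loopPairing (variationalDerivative H u)
          (fieldDeriv e u (hamField G (variationalDerivative F u)))
        - loopPairing (variationalDerivative F u)
          (fieldDeriv e u (hamField G (variationalDerivative H u))) := by
  have lF := (hF.isLoop hU hu).hamField (G := G)
  have lH := (hH.isLoop hU hu).hamField (G := G)
  have le := he.isLoop hu
  rw [lieDerivativeBracket, hP.loopBracket_skew hU hG hF
    (hH.isLocalFunctional_evolutionaryDerivative hU he) hu,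
    hP.loopBracket_evolutionaryDerivative hU he hF hH hu,
    hP.loopBracket_evolutionaryDerivative hU he hH hF hu, evolutionaryDerivative,
    (hP.hasDerivAt_loopBracket_of_isLoop hU hG hF hH hu le).deriv,
    hF.hessian_comm hU hu le lH, hH.hessian_comm hU hu le lF]
  ring

end LieDerivative

/-! ### Infinitesimal deformations -/

/-- Bilinearity makes the Jacobi expression a quadratic polynomial in `c`. Its linear coefficient is
the compatibility condition between `P` and `Q`. -/
theorem jacobiator_add_smul (hU : IsOpen U) (hP : IsLocalOperator U P) (hQ : IsLocalOperator U Q)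
    (hF : IsLocalFunctional U F) (hH : IsLocalFunctional U H) (hK : IsLocalFunctional U K)
    (hu : IsLoop U u) (c : ℝ) : jacobiator (P + c • Q) F H K u
      = jacobiator P F H K u
        + c * ((loopBracket P (loopBracket Q F H) K u + loopBracket P (loopBracket Q H K) F u
            + loopBracket P (loopBracket Q K F) H u)
          + (loopBracket Q (loopBracket P F H) K u + loopBracket Q (loopBracket P H K) F u
            + loopBracket Q (loopBracket P K F) H u))
        + c ^ 2 * jacobiator Q F H K u := by
  have key : ∀ F H K, IsLocalFunctional U F → IsLocalFunctional U H → IsLocalFunctional U K →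
      loopBracket (P + c • Q) (loopBracket (P + c • Q) F H) K u
        = loopBracket P (loopBracket P F H) K u + c * loopBracket P (loopBracket Q F H) K u
          + c * (loopBracket Q (loopBracket P F H) K u
            + c * loopBracket Q (loopBracket Q F H) K u) := by
    intro F H K hF hH hK
    have l1 := hP.isLocalFunctional_loopBracket hU hF hH
    have l2 := hQ.isLocalFunctional_loopBracket hU hF hH
    rw [loopBracket_congr_left hU (l1.add_smul l2 c) hu fun u hu =>
        loopBracket_add_smul_operator hU hP hQ hF hH hu c,
      loopBracket_add_smul_operator hU hP hQ (l1.add_smul l2 c) hK hu,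
      loopBracket_add_smul_left hU hP l1 l2 hK hu, loopBracket_add_smul_left hU hQ l1 l2 hK hu]
  rw [jacobiator, key F H K hF hH hK, key H K F hH hK hF, key K F H hK hF hH, jacobiator,
    jacobiator]
  ring

/-- A skew-symmetric Lie derivative `-𝓛_e P` of a constant operator is an infinitesimal
deformation of it. -/
theorem IsMinusLieDerivative.isInfinitesimalDeformation (hU : IsOpen U) (hG : G.IsSymm)
    {e : (ℝ → Fin n → ℝ) → ℝ → Fin n → ℝ} (he : IsLocalField U e)
    (hP : IsConstantOperator U G P) (hQ : IsLocalOperator U Q)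
    (h : IsMinusLieDerivative U e P Q) : IsInfinitesimalDeformation U P Q := by
  have hPl := hP.isLocalOperator hU
  refine ⟨fun F H hF hH u hu => ?_, fun F H K hF hH hK u hu => ?_⟩
  · rw [h F H hF hH u hu, h H F hH hF u hu, hP.lieDerivativeBracket_eq hU hG he hF hH hu,
      hP.lieDerivativeBracket_eq hU hG he hH hF hu]
    ring
  have e1 : ∀ F H K, IsLocalFunctional U F → IsLocalFunctional U H → IsLocalFunctional U K →
      loopBracket P (loopBracket Q F H) K u = -loopBracket P (evolutionaryDerivative e
        (loopBracket P F H)) K u + loopBracket P (loopBracket P (evolutionaryDerivative e F) H) K u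
        + loopBracket P (loopBracket P F (evolutionaryDerivative e H)) K u := by
    intro F H K hF hH hK
    have l1 := (hPl.isLocalFunctional_loopBracket hU hF
      hH).isLocalFunctional_evolutionaryDerivative hU he
    have l2 := hPl.isLocalFunctional_loopBracket hU
      (hF.isLocalFunctional_evolutionaryDerivative hU he) hH
    have l3 := hPl.isLocalFunctional_loopBracket hU hF
      (hH.isLocalFunctional_evolutionaryDerivative hU he)
    have l4 := (l2.add_smul l1 (-1)).add_smul l3 1
    rw [loopBracket_congr_left hU l4 hu fun u hu => ?_,
      loopBracket_add_smul_left hU hPl (l2.add_smul l1 (-1)) l3 hK hu,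
      loopBracket_add_smul_left hU hPl l2 l1 hK hu]
    · ring
    · rw [h F H hF hH u hu, lieDerivativeBracket]
      simp only [Pi.add_apply, Pi.smul_apply, smul_eq_mul]
      ring
  -- The Jacobi expression of `P` vanishes at every loop near `u` on the line along `e u`, so its
  -- derivative along `e` vanishes.
  have e2 : evolutionaryDerivative e (loopBracket P (loopBracket P F H) K) u
      + evolutionaryDerivative e (loopBracket P (loopBracket P H K) F) u
      + evolutionaryDerivative e (loopBracket P (loopBracket P K F) H) u = 0 := by
    have l : ∀ F H K, IsLocalFunctional U F → IsLocalFunctional U H → IsLocalFunctional U K →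
        IsLocalFunctional U (loopBracket P (loopBracket P F H) K) := fun F H K hF hH hK =>
      hPl.isLocalFunctional_loopBracket hU (hPl.isLocalFunctional_loopBracket hU hF hH) hK
    have h1 := (((l F H K hF hH hK).hasDerivAt_evolutionaryDerivative hU he hu).add
      ((l H K F hH hK hF).hasDerivAt_evolutionaryDerivative hU he hu)).add
      ((l K F H hK hF hH).hasDerivAt_evolutionaryDerivative hU he hu)
    refine h1.unique ((hasDerivAt_const (0 : ℝ) (0 : ℝ)).congr_of_eventuallyEq ?_)
    filter_upwards [hu.eventually_add_smul hU (he.isLoop hu)] with t ht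
    exact hP.jacobiator_eq_zero hU hG hF hH hK ht
  have lF := hF.isLocalFunctional_evolutionaryDerivative hU he
  have lH := hH.isLocalFunctional_evolutionaryDerivative hU he
  have lK := hK.isLocalFunctional_evolutionaryDerivative hU he
  have j0 := hP.jacobiator_eq_zero hU hG hF hH hK hu
  have j1 := hP.jacobiator_eq_zero hU hG lF hH hK hu
  have j2 := hP.jacobiator_eq_zero hU hG hF lH hK hu
  have j3 := hP.jacobiator_eq_zero hU hG hF hH lK hu
  have l1 := hPl.isLocalFunctional_loopBracket hU hF hH
  have l2 := hPl.isLocalFunctional_loopBracket hU hH hK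
  have l3 := hPl.isLocalFunctional_loopBracket hU hK hF
  -- After substituting `Q = -𝓛_e P`, the order `ε` term is minus the derivative along `e` of the
  -- Jacobi expression of `(F, H, K)`, plus the three Jacobi expressions of `P` in which `e` has
  -- been applied to one argument.
  have lin : (loopBracket P (loopBracket Q F H) K u + loopBracket P (loopBracket Q H K) F u
      + loopBracket P (loopBracket Q K F) H u) + (loopBracket Q (loopBracket P F H) K u
      + loopBracket Q (loopBracket P H K) F u + loopBracket Q (loopBracket P K F) H u) = 0 := by
    rw [e1 F H K hF hH hK, e1 H K F hH hK hF, e1 K F H hK hF hH, h _ _ l1 hK u hu,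
      h _ _ l2 hF u hu, h _ _ l3 hH u hu]
    simp only [lieDerivativeBracket]
    simp only [jacobiator] at j0 j1 j2 j3
    linear_combination -e2 + j1 + j2 + j3
  refine (isBigO_refl (fun ε : ℝ => ε ^ 2) (𝓝 0)).const_mul_left (jacobiator Q F H K u)
    |>.congr_left fun ε => ?_
  rw [jacobiator_add_smul hU hPl hQ hF hH hK hu ε, j0, lin]
  ring

end ConstantOperator

noncomputable section

/-! ### Operators of degree 1 and 2 -/

section Operators

variable {n : ℕ} {U : Set (Fin n → ℝ)} {u v : ℝ → Fin n → ℝ} {ξ η : ℝ → Fin n → ℝ}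
  {G : Matrix (Fin n) (Fin n) ℝ} {A : Fin n → Fin n → (Fin n → ℝ) → ℝ}

theorem HydrodynamicOperator.IsHamiltonianInFlatCoordinates.mono {V : Set (Fin n → ℝ)}
    {P : HydrodynamicOperator n} (hP : P.IsHamiltonianInFlatCoordinates U) (hV : V ⊆ U) :
    P.IsHamiltonianInFlatCoordinates V :=
  ⟨fun u hu => hP.1 u (hV hu), fun u hu => hP.2.1 u (hV hu),
    fun u hu v hv => hP.2.2 u (hV hu) v (hV hv)⟩

/-- Openness of `U` is used here: constancy of the metric near each point makes the partial
derivatives in the Christoffel symbols vanish. -/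
theorem HydrodynamicOperator.IsHamiltonianInFlatCoordinates.exists_isConstantOperator
    (hU : IsOpen U) {P : HydrodynamicOperator n} (hP : P.IsHamiltonianInFlatCoordinates U) :
    ∃ G : Matrix (Fin n) (Fin n) ℝ, G.IsSymm ∧ IsUnit G.det ∧ (∀ u ∈ U, P.g u = G) ∧
      IsConstantOperator U G P.toOperator := by
  rcases U.eq_empty_or_nonempty with rfl | ⟨p, hp⟩
  -- There are no loops in the empty set, so any symmetric invertible matrix serves.
  · exact ⟨1, Matrix.isSymm_one, by simp, by simp, fun u hu => absurd (hu.2.2 0) (by simp)⟩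
  have hg : ∀ u ∈ U, P.g u = P.g p := fun u hu => hP.2.2 u hu p hp
  refine ⟨P.g p, (hP.1 p hp).1, (hP.1 p hp).2, hg, fun u hu => ?_⟩
  have hd : ∀ u ∈ U, ∀ i j k, partialDeriv k (fun v => (P.g v)⁻¹ i j) u = 0 := by
    intro u hu i j k
    have : (fun v => (P.g v)⁻¹ i j) =ᶠ[𝓝 u] fun _ => (P.g p)⁻¹ i j := by
      filter_upwards [hU.mem_nhds hu] with v hv
      rw [hg v hv]
    rw [partialDeriv, this.fderiv_eq]
    simp
  have hΓ : ∀ u ∈ U, ∀ i j k, P.Γ i j k u = 0 := by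
    intro u hu i j k
    rw [hP.2.1 u hu]
    simp [christoffel, hd u hu]
  funext ξ x i
  refine Finset.sum_congr rfl fun j _ => ?_
  simp [hΓ _ (hu.2.2 x), hg _ (hu.2.2 x)]

theorem SecondOrderOperator.IsAdmissible.isLocalOperator (hU : IsOpen U)
    {P : SecondOrderOperator n} (hP : P.IsAdmissible U) : IsLocalOperator U P.toOperator := by
  obtain ⟨ha, hb, hcc, hc, -⟩ := hP
  intro ξ hξ i
  refine .sum _ fun j _ => .add (.add ?_ ?_) ?_
  · exact (IsLocalDensity.comp_contDiffOn (ha i j)).mul (((hξ j).iteratedDeriv hU 2).congr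
      fun u hu x => (hξ.isLoop hu).iteratedDeriv_apply 2 x j)
  · exact (IsLocalDensity.sum _ fun k _ => (IsLocalDensity.comp_contDiffOn (hb i j k)).mul
      (.coord_deriv hU k)).mul (((hξ j).deriv hU).congr
        fun u hu x => (hξ.isLoop hu).deriv_apply x j)
  · exact ((IsLocalDensity.sum _ fun k _ => .sum _ fun l _ =>
      ((IsLocalDensity.comp_contDiffOn (hcc i j k l)).mul (.coord_deriv hU k)).mul
        (.coord_deriv hU l)).add (.sum _ fun k _ =>
          (IsLocalDensity.comp_contDiffOn (hc i j k)).mul (.coord_iteratedDeriv hU 2 k))).mul (hξ j)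

theorem isLocalField_tensorEvolutionaryField (hU : IsOpen U) (hA : IsSmoothTensorField A U) :
    IsLocalField U (tensorEvolutionaryField A) := fun i =>
  (IsLocalDensity.sum _ fun j _ => (IsLocalDensity.comp_contDiffOn (hA i j)).mul
    (.coord_deriv hU j)).neg

theorem deriv_add_smul_apply (hu : IsLoop Set.univ u) (hv : IsLoop Set.univ v) (t x : ℝ)
    (j : Fin n) : deriv (u + t • v) x j = deriv u x j + t * deriv v x j := by
  have h := ((hu.hasDerivAt x).add ((hv.hasDerivAt x).const_smul t)).deriv
  exact congrFun h j

theorem hasDerivAt_comp_add_smul (hU : IsOpen U) {f : (Fin n → ℝ) → ℝ} (hf : ContDiffOn ℝ ∞ f U)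
    (hu : IsLoop U u) (v : ℝ → Fin n → ℝ) (x : ℝ) :
    HasDerivAt (fun t : ℝ => f ((u + t • v) x)) (∑ k, partialDeriv k f (u x) * v x k) 0 := by
  have h1 : HasDerivAt (fun t : ℝ => (u + t • v) x) (v x) 0 := by
    simpa using ((hasDerivAt_id (0 : ℝ)).smul_const (v x)).const_add (u x)
  simpa using hf.hasDerivAt_comp_curve hU h1 (by simpa using hu.2.2 x)

theorem hasDerivAt_comp_loop (hU : IsOpen U) (hu : IsLoop U u) {f : (Fin n → ℝ) → ℝ}
    (hf : ContDiffOn ℝ ∞ f U) (x : ℝ) :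
    HasDerivAt (fun x => f (u x)) (∑ k, partialDeriv k f (u x) * deriv u x k) x :=
  hf.hasDerivAt_comp_curve hU (hu.hasDerivAt x) (hu.2.2 x)

theorem IsLoop.smoothPeriodic_comp (hu : IsLoop U u) {f : (Fin n → ℝ) → ℝ}
    (hf : ContDiffOn ℝ ∞ f U) : SmoothPeriodic fun x => f (u x) :=
  (IsLocalDensity.comp_contDiffOn hf).smoothPeriodic hu

theorem hasDerivAt_loop_apply (hu : IsLoop U u) (i : Fin n) (x : ℝ) :
    HasDerivAt (fun x => u x i) (deriv u x i) x :=
  hasDerivAt_pi.1 (hu.hasDerivAt x) i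

theorem hasDerivAt_deriv_loop_apply (hu : IsLoop U u) (i : Fin n) (x : ℝ) :
    HasDerivAt (fun x => deriv u x i) (iteratedDeriv 2 u x i) x := by
  rw [iteratedDeriv_succ, iteratedDeriv_one]
  exact hasDerivAt_loop_apply hu.deriv i x

theorem fieldDeriv_tensorEvolutionaryField (hU : IsOpen U) (hA : IsSmoothTensorField A U)
    (hu : IsLoop U u) (hv : IsLoop Set.univ v) (x : ℝ) (i : Fin n) :
    fieldDeriv (tensorEvolutionaryField A) u v x i
      = -∑ r, ((∑ k, partialDeriv r (A i k) (u x) * deriv u x k) * v x r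
        + A i r (u x) * deriv v x r) := by
  refine HasDerivAt.deriv ?_
  have h : HasDerivAt (fun t : ℝ => -∑ j, A i j ((u + t • v) x)
      * (deriv u x j + t * deriv v x j)) _ 0 :=
    (HasDerivAt.fun_sum fun j (_ : j ∈ Finset.univ) =>
    (hasDerivAt_comp_add_smul hU (hA i j) hu v x).mul
      (((hasDerivAt_id (0 : ℝ)).mul_const (deriv v x j)).const_add (deriv u x j))).neg
  have e : (fun t : ℝ => tensorEvolutionaryField A (u + t • v) x i)
      = fun t : ℝ => -∑ j, A i j ((u + t • v) x) * (deriv u x j + t * deriv v x j) := by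
    funext t
    simp only [tensorEvolutionaryField, deriv_add_smul_apply hu.univ hv]
  rw [e]
  refine h.congr_deriv ?_
  simp only [id_eq, zero_mul, add_zero, zero_smul, one_mul, Finset.sum_add_distrib]
  congr 2
  simp only [Finset.sum_mul]
  rw [Finset.sum_comm]
  exact Finset.sum_congr rfl fun r _ => Finset.sum_congr rfl fun k _ => by ring

theorem IsGivenByTensor.isAdmissible (hU : IsOpen U) {g : (Fin n → ℝ) → Matrix (Fin n) (Fin n) ℝ}
    (hg : ∀ u ∈ U, g u = G) (hA : IsSmoothTensorField A U) {P : SecondOrderOperator n}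
    (hP : IsGivenByTensor U g A P) : P.IsAdmissible U := by
  have hA1 : ∀ i j k, ContDiffOn ℝ ∞ (partialDeriv k (A i j)) U := fun i j k =>
    (hA i j).partialDeriv hU k
  have hA2 : ∀ i j k l, ContDiffOn ℝ ∞ (partialDeriv l (partialDeriv k (A i j))) U :=
    fun i j k l => (hA1 i j k).partialDeriv hU l
  have hs : ∀ (i : Fin n) {f : Fin n → (Fin n → ℝ) → ℝ}, (∀ s, ContDiffOn ℝ ∞ (f s) U) →
      ContDiffOn ℝ ∞ (fun u => ∑ s, G i s * f s u) U := fun i f hf =>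
    ContDiffOn.sum fun s _ => contDiffOn_const.mul (hf s)
  refine ⟨fun i j => ?_, fun i j k => ?_, fun i j k l => ?_, fun i j k => ?_,
    fun u hu i j k l => ?_⟩
  · refine ((hs i fun s => hA j s).sub (hs j fun s => hA i s)).congr fun u hu => ?_
    rw [(hP u hu).1, hg u hu]
  · refine (((contDiffOn_const (c := (2 : ℝ))).mul (hs i fun s => hA1 j s k)).sub
      (hs j fun r => hA1 i k r)).sub (hs i fun s => hA1 j k s) |>.congr fun u hu => ?_
    rw [(hP u hu).2.1, hg u hu]
  · refine ((hs i fun s => hA2 j s k l).sub (hs i fun s => (contDiffOn_const (c := (1 / 2 : ℝ))).mul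
      ((hA2 j k l s).add (hA2 j l k s)))).congr (fun u hu => ?_)
    rw [(hP u hu).2.2.1, hg u hu]
  · refine ((hs i fun s => hA1 j s k).sub (hs i fun s => hA1 j k s)).congr fun u hu => ?_
    rw [(hP u hu).2.2.2, hg u hu]
  · rw [(hP u hu).2.2.1, (hP u hu).2.2.1]
    congr 1
    · exact Finset.sum_congr rfl fun s _ => by
        rw [partialDeriv_partialDeriv_comm hU (hA j s) hu]
    · exact Finset.sum_congr rfl fun s _ => by ring

theorem sum_sum_sum_mul (g : Fin n → ℝ) (Z : Fin n → Fin n → Fin n → ℝ) (p : Fin n → ℝ) :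
    ∑ k, ∑ l, (∑ s, g s * Z s k l) * p k * p l = ∑ s, g s * ∑ k, ∑ l, Z s k l * p k * p l := by
  simp only [Finset.mul_sum, Finset.sum_mul]
  rw [Finset.sum_comm (s := (Finset.univ : Finset (Fin n))) (f := fun s k => ∑ l, g s * _)]
  refine Finset.sum_congr rfl fun k _ => ?_
  rw [Finset.sum_comm]
  exact Finset.sum_congr rfl fun s _ => Finset.sum_congr rfl fun l _ => by ring

/-- `A^j_{k,s} u^k_x` along the loop `u`. -/
def tensorDeriv (A : Fin n → Fin n → (Fin n → ℝ) → ℝ) (u : ℝ → Fin n → ℝ) (j s : Fin n)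
    (x : ℝ) : ℝ :=
  ∑ k, partialDeriv s (A j k) (u x) * deriv u x k

/-- `(A^j_{s,k} - A^j_{k,s}) u^k_x` along the loop `u`. -/
def tensorCurl (A : Fin n → Fin n → (Fin n → ℝ) → ℝ) (u : ℝ → Fin n → ℝ) (j s : Fin n)
    (x : ℝ) : ℝ :=
  ∑ k, (partialDeriv k (A j s) (u x) - partialDeriv s (A j k) (u x)) * deriv u x k

/-- `(A^j_{s,kl} - A^j_{(k,l)s}) u^k_x u^l_x + (A^j_{s,k} - A^j_{k,s}) u^k_{xx}` along the loop
`u`. -/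
def tensorCurlDeriv (A : Fin n → Fin n → (Fin n → ℝ) → ℝ) (u : ℝ → Fin n → ℝ) (j s : Fin n)
    (x : ℝ) : ℝ :=
  (∑ k, ∑ l, (partialDeriv l (partialDeriv k (A j s)) (u x)
    - (1 / 2) * (partialDeriv s (partialDeriv l (A j k)) (u x)
      + partialDeriv s (partialDeriv k (A j l)) (u x))) * deriv u x k * deriv u x l)
  + ∑ k, (partialDeriv k (A j s) (u x) - partialDeriv s (A j k) (u x)) * iteratedDeriv 2 u x k

/-- Splits `d/dx A = C + D` into the curl `C` and the part `D` of the linearization of `e` that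
contains no derivative of the variation. The coefficients `(*)` become transparent in terms of `A`,
`C` and `D`. -/
theorem hasDerivAt_tensor (hU : IsOpen U) (hA : IsSmoothTensorField A U) (hu : IsLoop U u)
    (j s : Fin n) (x : ℝ) :
    HasDerivAt (fun x => A j s (u x)) (tensorCurl A u j s x + tensorDeriv A u j s x) x := by
  refine (hasDerivAt_comp_loop hU hu (hA j s) x).congr_deriv ?_
  rw [tensorCurl, tensorDeriv, ← Finset.sum_add_distrib]
  exact Finset.sum_congr rfl fun k _ => by ring

/-- This explains the zeroth-order coefficients in `(*)`: they assemble to `G dC/dx`. Symmetrizing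
in `k, l` changes nothing after contraction with `u^k_x u^l_x`. -/
theorem hasDerivAt_tensorCurl (hU : IsOpen U) (hA : IsSmoothTensorField A U) (hu : IsLoop U u)
    (j s : Fin n) (x : ℝ) : HasDerivAt (tensorCurl A u j s) (tensorCurlDeriv A u j s x) x := by
  have hA1 : ∀ i j k, ContDiffOn ℝ ∞ (partialDeriv k (A i j)) U := fun i j k =>
    (hA i j).partialDeriv hU k
  have h := HasDerivAt.fun_sum fun k (_ : k ∈ Finset.univ) =>
    ((hasDerivAt_comp_loop hU hu (hA1 j s k) x).sub (hasDerivAt_comp_loop hU hu (hA1 j k s) x)).mul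
      (hasDerivAt_deriv_loop_apply hu k x)
  refine h.congr_deriv ?_
  rw [tensorCurlDeriv, Finset.sum_add_distrib]
  congr 1
  have sw : ∑ k, ∑ l, partialDeriv s (partialDeriv k (A j l)) (u x) * deriv u x k * deriv u x l
      = ∑ k, ∑ l, partialDeriv s (partialDeriv l (A j k)) (u x) * deriv u x k * deriv u x l := by
    rw [Finset.sum_comm]
    exact Finset.sum_congr rfl fun k _ => Finset.sum_congr rfl fun l _ => by ring
  have e1 : ∑ k, ∑ l, (partialDeriv l (partialDeriv k (A j s)) (u x)
      - (1 / 2) * (partialDeriv s (partialDeriv l (A j k)) (u x)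
      + partialDeriv s (partialDeriv k (A j l)) (u x))) * deriv u x k * deriv u x l
      = ∑ k, ∑ l, partialDeriv l (partialDeriv k (A j s)) (u x) * deriv u x k * deriv u x l
      - ((1 / 2) * ∑ k, ∑ l, partialDeriv s (partialDeriv l (A j k)) (u x) * deriv u x k
          * deriv u x l
        + (1 / 2) * ∑ k, ∑ l, partialDeriv s (partialDeriv k (A j l)) (u x) * deriv u x k
          * deriv u x l) := by
    simp only [Finset.mul_sum, ← Finset.sum_add_distrib, ← Finset.sum_sub_distrib]
    exact Finset.sum_congr rfl fun k _ => Finset.sum_congr rfl fun l _ => by ring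
  rw [e1, sw, ← add_mul, add_halves, one_mul, ← Finset.sum_sub_distrib]
  refine Finset.sum_congr rfl fun k _ => ?_
  rw [sub_mul, Finset.sum_mul, Finset.sum_mul]
  congr 1
  · exact Finset.sum_congr rfl fun l _ => by ring
  · refine Finset.sum_congr rfl fun l _ => ?_
    rw [partialDeriv_partialDeriv_comm hU (hA j k) (hu.2.2 x) l s]
    ring

/-- The first sum is `G d/dx (A η_x + C η)`, since `dA/dx = C + D`; it is `L e_*†`. The second sum,
with its sign, is `e_* L`. -/
theorem IsGivenByTensor.toOperator_eq {g : (Fin n → ℝ) → Matrix (Fin n) (Fin n) ℝ}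
    (hg : ∀ u ∈ U, g u = G) {P : SecondOrderOperator n} (hP : IsGivenByTensor U g A P)
    (hu : IsLoop U u) (η : ℝ → Fin n → ℝ) (x : ℝ) (i : Fin n) : P.toOperator u η x i
      = ∑ j, ∑ s, G i s * (A j s (u x) * iteratedDeriv 2 η x j
          + (2 * tensorCurl A u j s x + tensorDeriv A u j s x) * deriv η x j
          + tensorCurlDeriv A u j s x * η x j)
        - ∑ j, ∑ s, G j s * (A i s (u x) * iteratedDeriv 2 η x j
          + tensorDeriv A u i s x * deriv η x j) := by
  obtain ⟨e1, e2, e3, e4⟩ := hP _ (hu.2.2 x)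
  rw [SecondOrderOperator.toOperator, ← Finset.sum_sub_distrib]
  refine Finset.sum_congr rfl fun j _ => ?_
  simp only [e1, e2, e3, e4, hg _ (hu.2.2 x)]
  have f2 : ∑ k, (2 * ∑ s, G i s * partialDeriv k (A j s) (u x)
      - ∑ r, G j r * partialDeriv r (A i k) (u x)
      - ∑ s, G i s * partialDeriv s (A j k) (u x)) * deriv u x k
      = ∑ s, G i s * (2 * tensorCurl A u j s x + tensorDeriv A u j s x) - ∑ s, G j s * tensorDeriv A u i s x := by
    simp only [tensorCurl, tensorDeriv, Finset.mul_sum, sub_mul, Finset.sum_mul, mul_add,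
      Finset.sum_add_distrib, Finset.sum_sub_distrib, mul_sub]
    rw [Finset.sum_comm (f := fun k s => 2 * (G i s * partialDeriv k (A j s) (u x))
        * deriv u x k),
      Finset.sum_comm (f := fun k s => G j s * partialDeriv s (A i k) (u x) * deriv u x k),
      Finset.sum_comm (f := fun k s => G i s * partialDeriv s (A j k) (u x) * deriv u x k)]
    simp only [← Finset.sum_add_distrib, ← Finset.sum_sub_distrib]
    exact Finset.sum_congr rfl fun s _ => Finset.sum_congr rfl fun k _ => by ring
  set Z : Fin n → Fin n → Fin n → ℝ := fun s k l =>
    partialDeriv l (partialDeriv k (A j s)) (u x)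
      - (1 / 2) * (partialDeriv s (partialDeriv l (A j k)) (u x)
        + partialDeriv s (partialDeriv k (A j l)) (u x)) with hZ
  have f3 : ∀ k l, ∑ s, G i s * partialDeriv l (partialDeriv k (A j s)) (u x)
      - ∑ s, G i s * ((1 / 2) * (partialDeriv s (partialDeriv l (A j k)) (u x)
        + partialDeriv s (partialDeriv k (A j l)) (u x))) = ∑ s, G i s * Z s k l := fun k l => by
    simp only [hZ, mul_sub, Finset.sum_sub_distrib]
  have f4 : ∑ k, (∑ s, G i s * partialDeriv k (A j s) (u x)
      - ∑ s, G i s * partialDeriv s (A j k) (u x)) * iteratedDeriv 2 u x k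
      = ∑ s, G i s * ∑ k, (partialDeriv k (A j s) (u x) - partialDeriv s (A j k) (u x))
        * iteratedDeriv 2 u x k := by
    simp only [← Finset.sum_sub_distrib, Finset.mul_sum, Finset.sum_mul]
    rw [Finset.sum_comm]
    exact Finset.sum_congr rfl fun k _ => Finset.sum_congr rfl fun s _ => by ring
  have f5 : ∀ s, tensorCurlDeriv A u j s x = (∑ k, ∑ l, Z s k l * deriv u x k * deriv u x l)
      + ∑ k, (partialDeriv k (A j s) (u x) - partialDeriv s (A j k) (u x))
        * iteratedDeriv 2 u x k := fun s => rfl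
  simp only [f3]
  rw [f2, f4, sum_sum_sum_mul (G i) Z]
  simp only [f5, mul_add, Finset.sum_add_distrib, ← mul_assoc, ← Finset.sum_mul]
  ring

theorem fieldDeriv_tensorEvolutionaryField_hamField (hU : IsOpen U) (hG : G.IsSymm)
    (hA : IsSmoothTensorField A U) (hu : IsLoop U u) (hη : IsLoop Set.univ η) (x : ℝ) (i : Fin n) :
    fieldDeriv (tensorEvolutionaryField A) u (hamField G η) x i
      = -∑ j, ∑ s, G j s * (A i s (u x) * iteratedDeriv 2 η x j
        + tensorDeriv A u i s x * deriv η x j) := by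
  have hd : ∀ r, deriv (hamField G η) x r = ∑ j, G r j * iteratedDeriv 2 η x j := fun r => by
    rw [hη.hamField.deriv_apply]
    exact (HasDerivAt.fun_sum fun j (_ : j ∈ Finset.univ) =>
      (hasDerivAt_deriv_loop_apply hη j x).const_mul (G r j)).deriv
  rw [fieldDeriv_tensorEvolutionaryField hU hA hu hη.hamField, Finset.sum_comm]
  congr 1
  refine Finset.sum_congr rfl fun s _ => ?_
  rw [hd, hamField, ← tensorDeriv, Finset.mul_sum, Finset.mul_sum, ← Finset.sum_add_distrib]
  refine Finset.sum_congr rfl fun j _ => ?_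
  rw [hG.apply j s]
  ring

/-- The bracket with coefficients given by `A` is the Lie derivative along `-A^i_j u^j_x`. -/
theorem IsGivenByTensor.loopPairing_toOperator (hU : IsOpen U) (hG : G.IsSymm)
    {g : (Fin n → ℝ) → Matrix (Fin n) (Fin n) ℝ} (hg : ∀ u ∈ U, g u = G)
    (hA : IsSmoothTensorField A U) {P : SecondOrderOperator n} (hP : IsGivenByTensor U g A P)
    (hu : IsLoop U u) (hξ : IsLoop Set.univ ξ) (hη : IsLoop Set.univ η) :
    loopPairing ξ (P.toOperator u η)
      = loopPairing ξ (fieldDeriv (tensorEvolutionaryField A) u (hamField G η))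
        - loopPairing η (fieldDeriv (tensorEvolutionaryField A) u (hamField G ξ)) := by
  have hA1 : ∀ i j k, ContDiffOn ℝ ∞ (partialDeriv k (A i j)) U := fun i j k =>
    (hA i j).partialDeriv hU k
  have hA0 : ∀ j s, SmoothPeriodic (fun x => A j s (u x)) := fun j s => hu.smoothPeriodic_comp (hA j s)
  have hB0 : ∀ j s, SmoothPeriodic (tensorCurl A u j s) := fun j s => .sum fun k _ =>
    ((hu.smoothPeriodic_comp (hA1 j s k)).sub (hu.smoothPeriodic_comp (hA1 j k s))).mul
      (hu.deriv.apply k)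
  -- The primitive `G (ξ (A η_x + C η) - ξ_x A η)`: the first term comes from moving `d/dx` off `A
  -- η_x + C η`, the second from moving it back onto `ξ_x`. In its derivative the terms `ξ_x A η_x`
  -- and `ξ_x C η` cancel.
  have hR : SmoothPeriodic fun x => ∑ i, ∑ j, ∑ s, G i s *
      (ξ x i * (A j s (u x) * deriv η x j + tensorCurl A u j s x * η x j) - deriv ξ x i * (A j s (u x) * η x j)) :=
    .sum fun i _ => .sum fun j _ => .sum fun s _ => (SmoothPeriodic.const _).mul
      (((hξ.apply i).mul (((hA0 j s).mul (hη.deriv.apply j)).add ((hB0 j s).mul (hη.apply j)))).sub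
        ((hξ.deriv.apply i).mul ((hA0 j s).mul (hη.apply j))))
  have he := isLocalField_tensorEvolutionaryField hU hA
  have hQ : IsLoop Set.univ (P.toOperator u η) :=
    ((hP.isAdmissible hU hg hA).isLocalOperator hU _ (isLocalField_const hη)).isLoop hu
  have i1 := hξ.intervalIntegrable_sum_mul hQ 0 1
  have i2 := hξ.intervalIntegrable_sum_mul (he.isLoop_fieldDeriv hU hu (hη.hamField (G := G))) 0 1
  have i3 := hη.intervalIntegrable_sum_mul (he.isLoop_fieldDeriv hU hu (hξ.hamField (G := G))) 0 1
  rw [← sub_eq_zero]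
  simp only [loopPairing]
  rw [← intervalIntegral.integral_sub i2 i3, ← intervalIntegral.integral_sub i1 (i2.sub i3)]
  refine hR.integral_eq_zero_of_hasDerivAt fun x => ?_
  have hd := HasDerivAt.fun_sum fun i (_ : i ∈ Finset.univ) => HasDerivAt.fun_sum
    fun j (_ : j ∈ Finset.univ) => HasDerivAt.fun_sum fun s (_ : s ∈ Finset.univ) =>
    (((hasDerivAt_loop_apply hξ i x).mul (((hasDerivAt_tensor hU hA hu j s x).mul (hasDerivAt_deriv_loop_apply hη j x)).add
      ((hasDerivAt_tensorCurl hU hA hu j s x).mul (hasDerivAt_loop_apply hη j x)))).sub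
      ((hasDerivAt_deriv_loop_apply hξ i x).mul
        ((hasDerivAt_tensor hU hA hu j s x).mul (hasDerivAt_loop_apply hη j x)))).const_mul (G i s)
  have e1 : ∑ i, η x i * ∑ j, ∑ s, G j s * (A i s (u x) * iteratedDeriv 2 ξ x j
      + tensorDeriv A u i s x * deriv ξ x j) = ∑ i, ∑ j, ∑ s, η x j * (G i s * (A j s (u x)
      * iteratedDeriv 2 ξ x i + tensorDeriv A u j s x * deriv ξ x i)) := by
    simp only [Finset.mul_sum]
    exact Finset.sum_comm
  have e2 : ∑ i, ξ x i * P.toOperator u η x i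
      - (∑ i, ξ x i * fieldDeriv (tensorEvolutionaryField A) u (hamField G η) x i
        - ∑ i, η x i * fieldDeriv (tensorEvolutionaryField A) u (hamField G ξ) x i)
      = ∑ i, ξ x i * (∑ j, ∑ s, G i s * (A j s (u x) * iteratedDeriv 2 η x j
          + (2 * tensorCurl A u j s x + tensorDeriv A u j s x) * deriv η x j
          + tensorCurlDeriv A u j s x * η x j))
        - ∑ i, ∑ j, ∑ s, η x j * (G i s * (A j s (u x) * iteratedDeriv 2 ξ x i
          + tensorDeriv A u j s x * deriv ξ x i)) := by
    simp only [hP.toOperator_eq hg hu η, fieldDeriv_tensorEvolutionaryField_hamField hU hG hA hu hξ,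
      fieldDeriv_tensorEvolutionaryField_hamField hU hG hA hu hη, mul_neg, Finset.sum_neg_distrib,
      e1, mul_sub, Finset.sum_sub_distrib]
    ring
  refine hd.congr_deriv (Eq.trans ?_ e2.symm)
  simp only [Finset.mul_sum, ← Finset.sum_sub_distrib]
  refine Finset.sum_congr rfl fun i _ => Finset.sum_congr rfl fun j _ =>
    Finset.sum_congr rfl fun s _ => ?_
  simp only [Pi.mul_apply, Pi.add_apply]
  ring

theorem IsGivenByTensor.isMinusLieDerivative (hU : IsOpen U) {P₁ : HydrodynamicOperator n}
    (hP₁ : P₁.IsHamiltonianInFlatCoordinates U) (hA : IsSmoothTensorField A U)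
    {P₂ : SecondOrderOperator n} (hP₂ : IsGivenByTensor U P₁.g A P₂) :
    IsMinusLieDerivative U (tensorEvolutionaryField A) P₁.toOperator P₂.toOperator := by
  obtain ⟨G, hG, -, hg, hP⟩ := hP₁.exists_isConstantOperator hU
  intro F H hF hH u hu
  rw [hP.lieDerivativeBracket_eq hU hG (isLocalField_tensorEvolutionaryField hU hA) hF hH hu,
    loopBracket_eq, hP₂.loopPairing_toOperator hU hG hg hA hu (hF.isLoop hU hu) (hH.isLoop hU hu)]
  ring

theorem IsGivenByTensor.isInfinitesimalDeformation (hU : IsOpen U) {P₁ : HydrodynamicOperator n}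
    (hP₁ : P₁.IsHamiltonianInFlatCoordinates U) (hA : IsSmoothTensorField A U)
    {P₂ : SecondOrderOperator n} (hP₂ : IsGivenByTensor U P₁.g A P₂) :
    P₂.IsAdmissible U ∧ IsInfinitesimalDeformation U P₁.toOperator P₂.toOperator := by
  obtain ⟨G, hG, -, hg, hP⟩ := hP₁.exists_isConstantOperator hU
  have had := hP₂.isAdmissible hU hg hA
  exact ⟨had, (hP₂.isMinusLieDerivative hU hP₁ hA).isInfinitesimalDeformation hU hG
    (isLocalField_tensorEvolutionaryField hU hA) hP (had.isLocalOperator hU)⟩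

end Operators

end

noncomputable section

/-! ### Testing deformations on linear functionals -/

section LinearFunctionals

variable {n : ℕ} {U : Set (Fin n → ℝ)} {u v : ℝ → Fin n → ℝ} {ξ η ζ : ℝ → Fin n → ℝ}
  {G : Matrix (Fin n) (Fin n) ℝ} {P Q : LoopOperator n}

theorem isLocalFunctional_loopPairing (hξ : IsLoop Set.univ ξ) :
    IsLocalFunctional U (loopPairing ξ) :=
  IsLocalDensity.isLocalFunctional (.sum _ fun i _ =>
    (IsLocalDensity.of_smoothPeriodic (hξ.apply i)).mul (.coord i))

theorem variationalDerivative_loopPairing (hξ : IsLoop Set.univ ξ) (hu : IsLoop U u) :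
    variationalDerivative (loopPairing ξ) u = ξ := by
  refine IsVariationalDerivative.variationalDerivative_eq ⟨hξ, fun v hv => ?_⟩
  have e : (fun t : ℝ => loopPairing ξ (u + t • v))
      = fun t : ℝ => loopPairing ξ u + t * loopPairing ξ v := by
    funext t
    rw [loopPairing_comm, hu.univ.loopPairing_add_smul hv hξ, loopPairing_comm u,
      loopPairing_comm v]
  rw [e]
  change HasDerivAt _ (loopPairing ξ v) 0
  simpa using ((hasDerivAt_id (0 : ℝ)).mul_const (loopPairing ξ v)).const_add (loopPairing ξ u)

theorem loopBracket_loopPairing (hξ : IsLoop Set.univ ξ) (hη : IsLoop Set.univ η)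
    (hu : IsLoop U u) :
    loopBracket Q (loopPairing ξ) (loopPairing η) u = loopPairing ξ (Q u η) := by
  rw [loopBracket_eq, variationalDerivative_loopPairing hξ hu,
    variationalDerivative_loopPairing hη hu]

theorem IsInfinitesimalDeformation.loopPairing_skew (h : IsInfinitesimalDeformation U P Q)
    (hξ : IsLoop Set.univ ξ) (hη : IsLoop Set.univ η) (hu : IsLoop U u) :
    loopPairing ξ (Q u η) = -loopPairing η (Q u ξ) := by
  rw [← loopBracket_loopPairing hξ hη hu, ← loopBracket_loopPairing hη hξ hu]
  exact h.1 _ _ (isLocalFunctional_loopPairing hξ) (isLocalFunctional_loopPairing hη) u hu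

/-- Dividing by `ε ≠ 0` leaves `a = O(ε)`, which forces the constant `a` to vanish. -/
theorem eq_zero_of_isBigO_sq {a b : ℝ}
    (h : (fun ε : ℝ => ε * a + ε ^ 2 * b) =O[𝓝 0] fun ε : ℝ => ε ^ 2) : a = 0 := by
  have h1 : (fun ε : ℝ => ε * a) =O[𝓝 0] fun ε : ℝ => ε ^ 2 :=
    (h.sub ((isBigO_refl (fun ε : ℝ => ε ^ 2) (𝓝 0)).const_mul_left b)).congr_left
      fun ε => by ring
  obtain ⟨C, hC⟩ := h1.bound
  have h2 : ∀ᶠ ε in 𝓝[≠] (0 : ℝ), ‖a‖ ≤ C * ‖ε‖ := by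
    filter_upwards [nhdsWithin_le_nhds hC, self_mem_nhdsWithin] with ε hε hne
    have hpos : 0 < ‖ε‖ := norm_pos_iff.2 hne
    rw [norm_mul, norm_pow] at hε
    refine le_of_mul_le_mul_left ?_ hpos
    linarith
  have h3 : Filter.Tendsto (fun ε : ℝ => C * ‖ε‖) (𝓝[≠] 0) (𝓝 0) := by
    have : Continuous fun ε : ℝ => C * ‖ε‖ := by fun_prop
    simpa using (this.tendsto 0).mono_left nhdsWithin_le_nhds
  exact norm_le_zero_iff.1 (ge_of_tendsto h3 h2)

/-- The inner bracket takes the same value at all loops in `U`, so its variational derivative is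
zero. -/
theorem IsConstantOperator.loopBracket_loopBracket_loopPairing (hU : IsOpen U)
    (hP : IsConstantOperator U G P) (H : LoopFunctional n)
    (hξ : IsLoop Set.univ ξ) (hη : IsLoop Set.univ η) (hu : IsLoop U u) :
    loopBracket Q (loopBracket P (loopPairing ξ) (loopPairing η)) H u = 0 := by
  have hc : IsVariationalDerivative (fun _ => loopPairing ξ (hamField G η)) u 0 :=
    ⟨isLoop_univ_iff.2 fun _ => SmoothPeriodic.const 0, fun v _ => by
      simpa using hasDerivAt_const (0 : ℝ) (loopPairing ξ (hamField G η))⟩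
  have := hc.congr hU hu (F' := loopBracket P (loopPairing ξ) (loopPairing η)) fun u hu => by
    rw [loopBracket_loopPairing hξ hη hu, hP u hu]
  rw [loopBracket_eq, this.variationalDerivative_eq, zero_loopPairing]

/-- On linear functionals the order `ε` terms with `P` in the inner bracket disappear. In the others
the inner bracket is a pairing with `Q`, and the outer one differentiates it along a Hamiltonian
field that does not depend on the loop. -/
theorem IsInfinitesimalDeformation.jacobi (hU : IsOpen U) (hG : G.IsSymm)
    (hP : IsConstantOperator U G P) (hQ : IsLocalOperator U Q)
    (h : IsInfinitesimalDeformation U P Q) (hξ : IsLoop Set.univ ξ) (hη : IsLoop Set.univ η)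
    (hζ : IsLoop Set.univ ζ) (hu : IsLoop U u) {d₁ d₂ d₃ : ℝ}
    (h₁ : HasDerivAt (fun t : ℝ => loopPairing ξ (Q (u + t • hamField G ζ) η)) d₁ 0)
    (h₂ : HasDerivAt (fun t : ℝ => loopPairing η (Q (u + t • hamField G ξ) ζ)) d₂ 0)
    (h₃ : HasDerivAt (fun t : ℝ => loopPairing ζ (Q (u + t • hamField G η) ξ)) d₃ 0) :
    d₁ + d₂ + d₃ = 0 := by
  have lξ := isLocalFunctional_loopPairing (U := U) hξ
  have lη := isLocalFunctional_loopPairing (U := U) hη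
  have lζ := isLocalFunctional_loopPairing (U := U) hζ
  have key : ∀ {ξ η ζ : ℝ → Fin n → ℝ} {d : ℝ}, IsLoop Set.univ ξ → IsLoop Set.univ η →
      IsLoop Set.univ ζ →
      HasDerivAt (fun t : ℝ => loopPairing ξ (Q (u + t • hamField G ζ) η)) d 0 →
      loopBracket P (loopBracket Q (loopPairing ξ) (loopPairing η)) (loopPairing ζ) u = d := by
    intro ξ η ζ d hξ hη hζ hd
    have h1 := hP.hasDerivAt_loopBracket hU (hQ.isLocalFunctional_loopBracket hU
      (isLocalFunctional_loopPairing hξ) (isLocalFunctional_loopPairing hη))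
      (isLocalFunctional_loopPairing hζ) hu
    rw [variationalDerivative_loopPairing hζ hu] at h1
    refine h1.unique (hd.congr_of_eventuallyEq ?_)
    filter_upwards [hu.eventually_add_smul hU (hζ.hamField (G := G))] with t ht
    exact loopBracket_loopPairing hξ hη ht
  have hO := h.2 _ _ _ lξ lη lζ u hu
  simp only [jacobiator_add_smul hU (hP.isLocalOperator hU) hQ lξ lη lζ hu,
    hP.jacobiator_eq_zero hU hG lξ lη lζ hu, key hξ hη hζ h₁, key hη hζ hξ h₂, key hζ hξ hη h₃,
    hP.loopBracket_loopBracket_loopPairing hU _ hξ hη hu,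
    hP.loopBracket_loopBracket_loopPairing hU _ hη hζ hu,
    hP.loopBracket_loopBracket_loopPairing hU _ hζ hξ hu, add_zero, zero_add] at hO
  exact eq_zero_of_isBigO_sq hO

/-! ### Test loops -/

/-- The loop `φ e_i`. -/
def coordLoop (i : Fin n) (φ : ℝ → ℝ) : ℝ → Fin n → ℝ := fun x => Pi.single i (φ x)

theorem coordLoop_apply (i : Fin n) (φ : ℝ → ℝ) (x : ℝ) (k : Fin n) :
    coordLoop i φ x k = if k = i then φ x else 0 := by
  simp [coordLoop, Pi.single_apply]

theorem SmoothPeriodic.coordLoop {φ : ℝ → ℝ} (hφ : SmoothPeriodic φ) (i : Fin n) :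
    IsLoop Set.univ (coordLoop i φ) := by
  rw [isLoop_univ_iff]
  intro k
  simp only [coordLoop_apply]
  by_cases h : k = i
  · simpa [h] using hφ
  · simpa [h] using SmoothPeriodic.const 0

theorem deriv_coordLoop {φ : ℝ → ℝ} (hφ : SmoothPeriodic φ) (i : Fin n) :
    deriv (coordLoop i φ) = coordLoop i (deriv φ) := by
  funext x k
  rw [(hφ.coordLoop i).deriv_apply]
  simp only [coordLoop_apply]
  by_cases h : k = i <;> simp [h]

theorem loopPairing_coordLoop (i : Fin n) (φ : ℝ → ℝ) (v : ℝ → Fin n → ℝ) :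
    loopPairing (coordLoop i φ) v = ∫ x in (0 : ℝ)..1, φ x * v x i :=
  intervalIntegral.integral_congr fun x _ => by
    simp [coordLoop_apply]

theorem hamField_coordLoop {φ : ℝ → ℝ} (hφ : SmoothPeriodic φ) (i : Fin n) (x : ℝ) (k : Fin n) :
    hamField G (coordLoop i φ) x k = G k i * deriv φ x := by
  simp [hamField, deriv_coordLoop hφ, coordLoop_apply]

/-- Constant covectors give Casimirs of `G d/dx`; using them as test covectors removes terms from
the Jacobi identity. -/
theorem hamField_coordLoop_const (i : Fin n) (c : ℝ) : hamField G (coordLoop i fun _ => c) = 0 := by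
  funext x k
  simp [hamField_coordLoop (SmoothPeriodic.const c)]

/-- The density of `∫ φ P^{ij} ψ dx`. -/
def SecondOrderOperator.density (P : SecondOrderOperator n) (i j : Fin n) (φ ψ : ℝ → ℝ)
    (u : ℝ → Fin n → ℝ) (x : ℝ) : ℝ :=
  φ x * (P.a i j (u x) * deriv (deriv ψ) x
    + (∑ k, P.b i j k (u x) * deriv u x k) * deriv ψ x
    + ((∑ k, ∑ l, P.cc i j k l (u x) * deriv u x k * deriv u x l)
      + ∑ k, P.c i j k (u x) * iteratedDeriv 2 u x k) * ψ x)

theorem SecondOrderOperator.loopPairing_coordLoop (P : SecondOrderOperator n) (i j : Fin n)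
    {φ ψ : ℝ → ℝ} (hψ : SmoothPeriodic ψ) (u : ℝ → Fin n → ℝ) :
    loopPairing (coordLoop i φ) (P.toOperator u (coordLoop j ψ))
      = ∫ x in (0 : ℝ)..1, P.density i j φ ψ u x := by
  rw [_root_.loopPairing_coordLoop]
  refine intervalIntegral.integral_congr fun x _ => ?_
  simp only [density, toOperator]
  congr 1
  rw [Finset.sum_eq_single j]
  · rw [iteratedDeriv_succ, iteratedDeriv_one, deriv_coordLoop hψ, deriv_coordLoop hψ.deriv]
    simp [coordLoop_apply]
  · intro k _ hk
    rw [iteratedDeriv_succ, iteratedDeriv_one, deriv_coordLoop hψ, deriv_coordLoop hψ.deriv]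
    simp [coordLoop_apply, hk]
  · simp

theorem SecondOrderOperator.IsAdmissible.isLocalDensity_density (hU : IsOpen U)
    {P : SecondOrderOperator n} (hP : P.IsAdmissible U) (i j : Fin n) {φ ψ : ℝ → ℝ}
    (hφ : SmoothPeriodic φ) (hψ : SmoothPeriodic ψ) : IsLocalDensity U (P.density i j φ ψ) := by
  obtain ⟨ha, hb, hcc, hc, -⟩ := hP
  exact (IsLocalDensity.of_smoothPeriodic hφ).mul ((((IsLocalDensity.comp_contDiffOn (ha i j)).mul
    (.of_smoothPeriodic hψ.deriv.deriv)).add ((IsLocalDensity.sum _ fun k _ =>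
      (IsLocalDensity.comp_contDiffOn (hb i j k)).mul (.coord_deriv hU k)).mul
        (.of_smoothPeriodic hψ.deriv))).add (((IsLocalDensity.sum _ fun k _ => .sum _ fun l _ =>
      ((IsLocalDensity.comp_contDiffOn (hcc i j k l)).mul (.coord_deriv hU k)).mul
        (.coord_deriv hU l)).add (.sum _ fun k _ => (IsLocalDensity.comp_contDiffOn (hc i j k)).mul
          (.coord_iteratedDeriv hU 2 k))).mul (.of_smoothPeriodic hψ)))

/-- Trigonometric test functions. -/
theorem exists_test_functions : ∃ τ φ σ : ℝ → ℝ, SmoothPeriodic τ ∧ SmoothPeriodic φ ∧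
    SmoothPeriodic σ ∧ deriv τ = φ ∧ ∫ x in (0 : ℝ)..1, deriv φ x * deriv φ x ≠ 0 ∧
    ∫ x in (0 : ℝ)..1, deriv φ x * deriv φ x * deriv σ x ≠ 0 := by
  have hπ : Real.pi ≠ 0 := Real.pi_ne_zero
  have hs : ∀ k : ℕ, SmoothPeriodic fun x => Real.sin (k * (2 * Real.pi) * x) := fun k => by
    refine ⟨by fun_prop, fun x => ?_⟩
    simp only [mul_add, mul_one, Real.sin_add_nat_mul_two_pi]
  have hc : ∀ k : ℕ, SmoothPeriodic fun x => Real.cos (k * (2 * Real.pi) * x) := fun k => by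
    refine ⟨by fun_prop, fun x => ?_⟩
    simp only [mul_add, mul_one, Real.cos_add_nat_mul_two_pi]
  have ds : ∀ (k : ℕ) x, HasDerivAt (fun x => Real.sin (k * (2 * Real.pi) * x))
      (Real.cos (k * (2 * Real.pi) * x) * (k * (2 * Real.pi))) x := fun k x => by
    simpa using ((hasDerivAt_id x).const_mul (k * (2 * Real.pi))).sin
  have dc : ∀ (k : ℕ) x, HasDerivAt (fun x => Real.cos (k * (2 * Real.pi) * x))
      (-Real.sin (k * (2 * Real.pi) * x) * (k * (2 * Real.pi))) x := fun k x => by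
    simpa using ((hasDerivAt_id x).const_mul (k * (2 * Real.pi))).cos
  set C : ℕ → ℝ → ℝ := fun k x => Real.cos (k * (2 * Real.pi) * x) with hC
  have dφ : deriv (fun x => (1 / (2 * Real.pi)) * Real.sin ((1 : ℕ) * (2 * Real.pi) * x)) = C 1 := by
    funext x
    rw [((ds 1 x).const_mul _).deriv]
    simp only [hC]
    push_cast
    field_simp
  have dσ : deriv (fun x => (1 / (4 * Real.pi)) * Real.sin ((2 : ℕ) * (2 * Real.pi) * x)) = C 2 := by
    funext x
    rw [((ds 2 x).const_mul _).deriv]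
    simp only [hC]
    push_cast
    field_simp
    ring
  have dbl : ∀ x, C 1 x * C 1 x = (1 + C 2 x) / 2 := fun x => by
    simp only [hC]
    have h := Real.cos_two_mul ((1 : ℕ) * (2 * Real.pi) * x)
    rw [show 2 * ((1 : ℕ) * (2 * Real.pi) * x) = (2 : ℕ) * (2 * Real.pi) * x by push_cast; ring] at h
    rw [h]
    ring
  have dbl' : ∀ x, C 2 x * C 2 x = (1 + C 4 x) / 2 := fun x => by
    simp only [hC]
    have h := Real.cos_two_mul ((2 : ℕ) * (2 * Real.pi) * x)
    rw [show 2 * ((2 : ℕ) * (2 * Real.pi) * x) = (4 : ℕ) * (2 * Real.pi) * x by push_cast; ring] at h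
    rw [h]
    ring
  have hz : ∀ k : ℕ, k ≠ 0 → ∫ x in (0 : ℝ)..1, C k x = 0 := fun k hk => by
    have hk' : (k : ℝ) ≠ 0 := Nat.cast_ne_zero.2 hk
    refine ((SmoothPeriodic.const (1 / (k * (2 * Real.pi)))).mul
      (hs k)).integral_eq_zero_of_hasDerivAt fun x => ?_
    refine ((ds k x).const_mul (1 / (k * (2 * Real.pi)))).congr_deriv ?_
    simp only [hC]
    field_simp
  have hi : ∀ k, IntervalIntegrable (C k) MeasureTheory.volume 0 1 := fun k =>
    (hc k).intervalIntegrable 0 1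
  -- Normalized so that `τ' = φ`, `φ' = cos 2πx` and `σ' = cos 4πx`. Then `φ'²` has mean `1/2`, and
  -- the frequency doubling in `σ` gives `φ'² σ'` the mean `1/4`.
  refine ⟨fun x => (-1 / (4 * Real.pi ^ 2)) * Real.cos ((1 : ℕ) * (2 * Real.pi) * x),
    fun x => (1 / (2 * Real.pi)) * Real.sin ((1 : ℕ) * (2 * Real.pi) * x),
    fun x => (1 / (4 * Real.pi)) * Real.sin ((2 : ℕ) * (2 * Real.pi) * x),
    (SmoothPeriodic.const _).mul (hc 1), (SmoothPeriodic.const _).mul (hs 1),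
    (SmoothPeriodic.const _).mul (hs 2), ?_, ?_, ?_⟩
  · funext x
    rw [((dc 1 x).const_mul _).deriv]
    push_cast
    field_simp
    ring
  · rw [dφ]
    simp only [dbl, add_div]
    rw [intervalIntegral.integral_add (by simp) ((hi 2).div_const 2)]
    simp only [intervalIntegral.integral_div, hz 2 two_ne_zero]
    simp
  · rw [dφ, dσ]
    have e : ∀ x, C 1 x * C 1 x * C 2 x = C 2 x / 2 + (1 / 4 + C 4 x / 4) := fun x => by
      rw [dbl]
      linear_combination dbl' x / 2
    simp only [e]
    rw [intervalIntegral.integral_add ((hi 2).div_const 2)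
        (IntervalIntegrable.add (by simp) ((hi 4).div_const 4)),
      intervalIntegral.integral_add (by simp) ((hi 4).div_const 4)]
    simp only [intervalIntegral.integral_div, hz 2 two_ne_zero, hz 4 four_ne_zero]
    simp

/-- Continuity at `s = 0`. It is used after dividing an identity on the perturbed loops `u + s • v`
by a power of `s`, to evaluate coefficients at a constant loop. -/
theorem IsLocalDensity.integral_eq_zero_of_eventually (hU : IsOpen U)
    {h : (ℝ → Fin n → ℝ) → ℝ → ℝ} (hh : IsLocalDensity U h) (hu : IsLoop U u)
    (hv : IsLoop Set.univ v)
    (e : ∀ᶠ s in 𝓝[≠] (0 : ℝ), ∫ x in (0 : ℝ)..1, h (u + s • v) x = 0) :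
    ∫ x in (0 : ℝ)..1, h u x = 0 := by
  have h1 := (hh.hasDerivAt_integral hU hu hv).continuousAt.tendsto.mono_left
    (nhdsWithin_le_nhds (s := {0}ᶜ))
  have h2 := tendsto_nhds_unique h1 (tendsto_const_nhds.congr' (e.mono fun s hs => hs.symm))
  simpa using h2

end LinearFunctionals

end

noncomputable section

/-! ### The conditions on the coefficients of an infinitesimal deformation -/

section Conditions

variable {n : ℕ} {U : Set (Fin n → ℝ)} {u v : ℝ → Fin n → ℝ} {p : Fin n → ℝ}
  {G : Matrix (Fin n) (Fin n) ℝ} {L : LoopOperator n} {P : SecondOrderOperator n}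

theorem deriv_const_add_smul (p : Fin n → ℝ) (hv : IsLoop Set.univ v) (s x : ℝ) (k : Fin n) :
    deriv ((fun _ => p : ℝ → Fin n → ℝ) + s • v) x k = s * deriv v x k := by
  rw [deriv_add_smul_apply (IsLoop.const (Set.mem_univ p)) hv]
  simp

theorem iteratedDeriv_two_const_add_smul (p : Fin n → ℝ) (hv : IsLoop Set.univ v) (s x : ℝ)
    (k : Fin n) : iteratedDeriv 2 ((fun _ => p : ℝ → Fin n → ℝ) + s • v) x k
      = s * iteratedDeriv 2 v x k := by
  have h1 := IsLoop.const (Set.mem_univ p)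
  have h2 := (hv.iteratedDeriv_apply 2 x k).symm
  rw [(h1.add (hv.smul s)).iteratedDeriv_apply]
  simp only [iteratedDeriv_succ, iteratedDeriv_zero] at h2 ⊢
  have h3 : deriv (fun y => ((fun _ => p : ℝ → Fin n → ℝ) + s • v) y k)
      = fun y => s * deriv v y k := by
    funext y
    rw [← (h1.add (hv.smul s)).deriv_apply, deriv_const_add_smul p hv]
  rw [h3]
  exact ((hasDerivAt_deriv_loop_apply hv k x).const_mul s).deriv.trans (by
    rw [iteratedDeriv_succ, iteratedDeriv_one])

theorem SecondOrderOperator.density_const (P : SecondOrderOperator n) (i j : Fin n) (φ ψ : ℝ → ℝ)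
    (p : Fin n → ℝ) (x : ℝ) :
    P.density i j φ ψ (fun _ => p) x = φ x * (P.a i j p * deriv (deriv ψ) x) := by
  simp [density, iteratedDeriv_succ]

theorem IsInfinitesimalDeformation.integral_density_skew
    (h : IsInfinitesimalDeformation U L P.toOperator) (i j : Fin n) {φ ψ : ℝ → ℝ}
    (hφ : SmoothPeriodic φ) (hψ : SmoothPeriodic ψ) (hu : IsLoop U u) :
    ∫ x in (0 : ℝ)..1, P.density i j φ ψ u x = -∫ x in (0 : ℝ)..1, P.density j i ψ φ u x := by
  rw [← P.loopPairing_coordLoop i j hψ, ← P.loopPairing_coordLoop j i hφ]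
  exact h.loopPairing_skew (hφ.coordLoop i) (hψ.coordLoop j) hu

/-- At a constant loop only the `a` term survives, and taking both test functions equal to `φ`
leaves a multiple of `∫ φ'²`. -/
theorem IsInfinitesimalDeformation.a_skew (h : IsInfinitesimalDeformation U L P.toOperator)
    (hp : p ∈ U) (i j : Fin n) : P.a i j p = -P.a j i p := by
  obtain ⟨-, φ, -, -, hφ, -, -, hne, -⟩ := exists_test_functions
  have h1 := h.integral_density_skew i j hφ hφ (IsLoop.const hp)
  simp only [P.density_const, mul_left_comm (φ _), intervalIntegral.integral_const_mul] at h1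
  rw [hφ.integral_mul_deriv hφ.deriv] at h1
  simp only [neg_mul, intervalIntegral.integral_neg] at h1
  have h2 : (P.a i j p + P.a j i p) * ∫ x in (0 : ℝ)..1, deriv φ x * deriv φ x = 0 := by
    linear_combination -h1
  linarith [(mul_eq_zero.1 h2).resolve_right hne]

theorem hasDerivAt_sum_comp_mul_deriv (hU : IsOpen U) {c : Fin n → (Fin n → ℝ) → ℝ}
    (hc : ∀ k, ContDiffOn ℝ ∞ (c k) U) (hu : IsLoop U u) (x : ℝ) :
    HasDerivAt (fun x => ∑ k, c k (u x) * deriv u x k)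
      ((∑ k, ∑ l, partialDeriv l (c k) (u x) * deriv u x k * deriv u x l)
        + ∑ k, c k (u x) * iteratedDeriv 2 u x k) x := by
  refine (HasDerivAt.fun_sum fun k (_ : k ∈ Finset.univ) =>
    (hasDerivAt_comp_loop hU hu (hc k) x).mul (hasDerivAt_deriv_loop_apply hu k x)).congr_deriv ?_
  rw [Finset.sum_add_distrib]
  congr 1
  refine Finset.sum_congr rfl fun k _ => ?_
  rw [Finset.sum_mul]
  exact Finset.sum_congr rfl fun l _ => by ring

theorem smoothPeriodic_sum_comp_mul_deriv {c : Fin n → (Fin n → ℝ) → ℝ}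
    (hc : ∀ k, ContDiffOn ℝ ∞ (c k) U) (hu : IsLoop U u) :
    SmoothPeriodic fun x => ∑ k, c k (u x) * deriv u x k :=
  .sum fun k _ => (hu.smoothPeriodic_comp (hc k)).mul (hu.deriv.apply k)

/-- Two of the three covectors are constant, so two of the three Jacobi terms are derivatives along
the zero field. -/
theorem IsInfinitesimalDeformation.hasDerivAt_density_const_const (hU : IsOpen U) (hG : G.IsSymm)
    (hL : IsConstantOperator U G L) (hP : P.IsAdmissible U)
    (h : IsInfinitesimalDeformation U L P.toOperator) (i j : Fin n) {ζ : ℝ → Fin n → ℝ}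
    (hζ : IsLoop Set.univ ζ) (hu : IsLoop U u) :
    HasDerivAt (fun t : ℝ => ∫ x in (0 : ℝ)..1,
      P.density i j (fun _ => 1) (fun _ => 1) (u + t • hamField G ζ) x) 0 0 := by
  have c1 : SmoothPeriodic fun _ => (1 : ℝ) := .const 1
  have hd := (hP.isLocalDensity_density hU i j c1 c1).hasDerivAt_integral hU hu
    (hζ.hamField (G := G))
  have hd' := hd
  simp only [← P.loopPairing_coordLoop i j c1] at hd'
  have := h.jacobi hU hG hL (hP.isLocalOperator hU) (c1.coordLoop i) (c1.coordLoop j) hζ hu hd'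
    (d₂ := 0) (d₃ := 0) (by simp only [hamField_coordLoop_const, smul_zero, add_zero]
                            exact hasDerivAt_const _ _)
    (by simp only [hamField_coordLoop_const, smul_zero, add_zero]
        exact hasDerivAt_const _ _)
  rw [add_zero, add_zero] at this
  rwa [this] at hd

/-- Non-degeneracy of the metric enters: `ζ = G⁻¹ y τ` realizes a perturbation in an arbitrary
direction `y` as a Hamiltonian field. -/
theorem exists_hamField_eq (hGu : IsUnit G.det) (y : Fin n → ℝ) {τ : ℝ → ℝ}
    (hτ : SmoothPeriodic τ) : ∃ ζ : ℝ → Fin n → ℝ, IsLoop Set.univ ζ ∧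
      hamField G ζ = fun x k => y k * deriv τ x := by
  have hζ : IsLoop Set.univ fun x k => (G⁻¹.mulVec y) k * τ x :=
    isLoop_univ_iff.2 fun k => (SmoothPeriodic.const _).mul hτ
  refine ⟨_, hζ, ?_⟩
  funext x k
  have hd : ∀ j, deriv (fun x k => (G⁻¹.mulVec y) k * τ x) x j = (G⁻¹.mulVec y) j * deriv τ x :=
    fun j => by
      rw [hζ.deriv_apply]
      exact ((hτ.hasDerivAt x).const_mul _).deriv
  have e : G.mulVec (G⁻¹.mulVec y) = y := by
    rw [Matrix.mulVec_mulVec, Matrix.mul_nonsing_inv _ hGu, Matrix.one_mulVec]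
  have e' := congrFun e k
  simp only [Matrix.mulVec, dotProduct] at e' hd ⊢
  simp only [hamField, hd, ← mul_assoc, ← Finset.sum_mul, e']

/-- The integral of the zeroth-order part of `P^{ij}` does not change along Hamiltonian directions,
and it vanishes at constant loops. Integrating `c^{ij}_k u^k_{xx}` by parts leaves an integrand
quadratic in `u_x`; along `p + s y φ` it is `s²` times the desired difference times `φ'²`. -/
theorem IsInfinitesimalDeformation.sum_cc_eq (hU : IsOpen U) (hG : G.IsSymm)
    (hGu : IsUnit G.det) (hL : IsConstantOperator U G L) (hP : P.IsAdmissible U)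
    (h : IsInfinitesimalDeformation U L P.toOperator) (hp : p ∈ U) (i j : Fin n)
    (y : Fin n → ℝ) :
    ∑ k, ∑ l, P.cc i j k l p * y k * y l = ∑ k, ∑ l, partialDeriv l (P.c i j k) p * y k * y l := by
  obtain ⟨τ, φ, -, hτ, hφ, -, rfl, hne, -⟩ := exists_test_functions
  obtain ⟨-, -, hcc, hc, -⟩ := id hP
  obtain ⟨ζ, hζ, hζy⟩ := exists_hamField_eq hGu y hτ
  set v : ℝ → Fin n → ℝ := fun x k => y k * deriv τ x with hv
  have hvl : IsLoop Set.univ v := hζy ▸ hζ.hamField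
  have hu := IsLoop.const hp
  set E : ℝ → ℝ := fun t => ∫ x in (0 : ℝ)..1,
    P.density i j (fun _ => 1) (fun _ => 1) ((fun _ => p) + t • v) x with hE
  obtain ⟨δ, hδ, hball⟩ := Metric.eventually_nhds_iff_ball.1 (hu.eventually_add_smul hU hvl)
  -- The Jacobi identity is applied at the loop `p + s • v` itself, which gives the vanishing
  -- derivative at every `s` and not only at `0`.
  have hE' : ∀ s ∈ Metric.ball (0 : ℝ) δ, HasDerivAt E 0 s := by
    intro s hs
    have h1 := h.hasDerivAt_density_const_const hU hG hL hP i j hζ (hball s hs)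
    rw [hζy] at h1
    have h2 : HasDerivAt (fun r => r - s) 1 s := (hasDerivAt_id s).sub_const s
    have h3 := HasDerivAt.comp s (h₂ := fun t : ℝ => ∫ x in (0 : ℝ)..1,
      P.density i j (fun _ => 1) (fun _ => 1) ((fun _ => p) + s • v + t • v) x)
      (by simpa using h1) h2
    rw [zero_mul] at h3
    refine h3.congr_of_eventuallyEq (.of_forall fun r => ?_)
    simp only [hE, Function.comp_apply, add_assoc, ← add_smul, add_sub_cancel]
  have hE0 : E 0 = 0 := by
    simp only [hE, zero_smul, add_zero, P.density_const]
    simp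
  have hEs : ∀ s ∈ Metric.ball (0 : ℝ) δ, E s = 0 := fun s hs => by
    rw [← hE0]
    exact Metric.isOpen_ball.is_const_of_deriv_eq_zero (convex_ball 0 δ).isPreconnected
      (fun r hr => (hE' r hr).differentiableAt.differentiableWithinAt)
      (fun r hr => (hE' r hr).deriv) hs (Metric.mem_ball_self hδ)
  have hEu : ∀ u, IsLoop U u → ∫ x in (0 : ℝ)..1, P.density i j (fun _ => 1) (fun _ => 1) u x
      = ∫ x in (0 : ℝ)..1, ((∑ k, ∑ l, P.cc i j k l (u x) * deriv u x k * deriv u x l)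
        - ∑ k, ∑ l, partialDeriv l (P.c i j k) (u x) * deriv u x k * deriv u x l) := by
    intro u hu
    have i2 : SmoothPeriodic fun x => (∑ k, ∑ l, P.cc i j k l (u x) * deriv u x k * deriv u x l)
        - ∑ k, ∑ l, partialDeriv l (P.c i j k) (u x) * deriv u x k * deriv u x l :=
      (SmoothPeriodic.sum fun k _ => .sum fun l _ => ((hu.smoothPeriodic_comp (hcc i j k l)).mul
        (hu.deriv.apply k)).mul (hu.deriv.apply l)).sub (.sum fun k _ => .sum fun l _ =>
        ((hu.smoothPeriodic_comp ((hc i j k).partialDeriv hU l)).mul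
        (hu.deriv.apply k)).mul (hu.deriv.apply l))
    have i1 := (hP.isLocalDensity_density hU i j (.const 1) (.const 1)).smoothPeriodic hu
    rw [← sub_eq_zero, ← intervalIntegral.integral_sub (i1.intervalIntegrable _ _)
      (i2.intervalIntegrable _ _)]
    refine (smoothPeriodic_sum_comp_mul_deriv (hc i j) hu).integral_eq_zero_of_hasDerivAt
      fun x => (hasDerivAt_sum_comp_mul_deriv hU (hc i j) hu x).congr_deriv ?_
    simp [SecondOrderOperator.density]
    ring
  have hT : IsLocalDensity U fun u x => ((∑ k, ∑ l, P.cc i j k l (u x) * y k * y l)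
      - ∑ k, ∑ l, partialDeriv l (P.c i j k) (u x) * y k * y l)
      * (deriv (deriv τ) x * deriv (deriv τ) x) := by
    refine .mul (.add ?_ (.neg ?_)) (.of_smoothPeriodic (hφ.deriv.mul hφ.deriv))
    · exact .sum _ fun k _ => .sum _ fun l _ => ((IsLocalDensity.comp_contDiffOn (hcc i j k l)).mul
        (.const _)).mul (.const _)
    · exact .sum _ fun k _ => .sum _ fun l _ => ((IsLocalDensity.comp_contDiffOn
        ((hc i j k).partialDeriv hU l)).mul (.const _)).mul (.const _)
  have key := hT.integral_eq_zero_of_eventually hU hu hvl (by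
    filter_upwards [nhdsWithin_le_nhds (Metric.ball_mem_nhds 0 hδ), self_mem_nhdsWithin]
      with s hs hs0
    have h1 := hEs s hs
    simp only [hE] at h1
    rw [hEu _ (hball s hs)] at h1
    have hdv : ∀ x k, deriv v x k = y k * deriv (deriv τ) x := fun x k => by
      rw [hvl.deriv_apply]
      exact ((hφ.hasDerivAt x).const_mul _).deriv
    have h2 : s ^ 2 * (∫ x in (0 : ℝ)..1,
        ((∑ k, ∑ l, P.cc i j k l (((fun _ => p : ℝ → Fin n → ℝ) + s • v) x) * y k * y l)
        - ∑ k, ∑ l, partialDeriv l (P.c i j k) (((fun _ => p : ℝ → Fin n → ℝ) + s • v) x) * y k * y l)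
        * (deriv (deriv τ) x * deriv (deriv τ) x)) = 0 := by
      rw [← intervalIntegral.integral_const_mul]
      refine Eq.trans ?_ h1
      refine intervalIntegral.integral_congr fun x _ => ?_
      simp only [deriv_const_add_smul p hvl, hdv, ← Finset.sum_sub_distrib, Finset.sum_mul,
        Finset.mul_sum]
      exact Finset.sum_congr rfl fun k _ => Finset.sum_congr rfl fun l _ => by ring
    exact (mul_eq_zero.1 h2).resolve_left (pow_ne_zero 2 hs0))
  rw [intervalIntegral.integral_const_mul] at key
  exact sub_eq_zero.1 ((mul_eq_zero.1 key).resolve_right hne)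

end Conditions

end

/-! ### Relations between `a`, `b` and `c`, and the closedness conditions -/

noncomputable section

section MoreConditions

variable {n : ℕ} {U : Set (Fin n → ℝ)} {u v : ℝ → Fin n → ℝ} {p : Fin n → ℝ}
  {G : Matrix (Fin n) (Fin n) ℝ} {L : LoopOperator n} {P : SecondOrderOperator n}

/-- `c^{ij}_k u^k_x` along a loop. -/
def SecondOrderOperator.cForm (P : SecondOrderOperator n) (i j : Fin n) (u : ℝ → Fin n → ℝ)
    (x : ℝ) : ℝ :=
  ∑ k, P.c i j k (u x) * deriv u x k

theorem SecondOrderOperator.IsAdmissible.isLocalDensity_cForm (hU : IsOpen U)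
    (hP : P.IsAdmissible U) (i j : Fin n) : IsLocalDensity U (P.cForm i j) :=
  .sum _ fun k _ => (IsLocalDensity.comp_contDiffOn (hP.2.2.2.1 i j k)).mul (.coord_deriv hU k)

/-- Constant operators, admissible second order operators and the infinitesimal deformation
property, as in the hypotheses of the classification. -/
structure DeformationData (U : Set (Fin n → ℝ)) (G : Matrix (Fin n) (Fin n) ℝ)
    (L : LoopOperator n) (P : SecondOrderOperator n) : Prop where
  isOpen : IsOpen U
  isSymm : G.IsSymm
  isUnit_det : IsUnit G.det
  isConstant : IsConstantOperator U G L
  isAdmissible : P.IsAdmissible U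
  isInfinitesimalDeformation : IsInfinitesimalDeformation U L P.toOperator

namespace DeformationData

/-- By `sum_cc_eq` the zeroth-order part of `P^{ij}` is the total derivative of `c^{ij}_k u^k_x`,
which removes `c^{ij}_{kl}` from all further computations. -/
theorem hasDerivAt_cForm (h : DeformationData U G L P) (hu : IsLoop U u) (i j : Fin n) (x : ℝ) :
    HasDerivAt (P.cForm i j u) ((∑ k, ∑ l, P.cc i j k l (u x) * deriv u x k * deriv u x l)
      + ∑ k, P.c i j k (u x) * iteratedDeriv 2 u x k) x := by
  rw [h.isInfinitesimalDeformation.sum_cc_eq h.isOpen h.isSymm h.isUnit_det h.isConstant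
    h.isAdmissible (hu.2.2 x)]
  exact hasDerivAt_sum_comp_mul_deriv h.isOpen (h.isAdmissible.2.2.2.1 i j) hu x

theorem smoothPeriodic_cForm (h : DeformationData U G L P) (hu : IsLoop U u) (i j : Fin n) :
    SmoothPeriodic (P.cForm i j u) :=
  (h.isAdmissible.isLocalDensity_cForm h.isOpen i j).smoothPeriodic hu

theorem density_eq (h : DeformationData U G L P) (hu : IsLoop U u) (i j : Fin n) (φ ψ : ℝ → ℝ)
    (x : ℝ) : P.density i j φ ψ u x = φ x * (P.a i j (u x) * deriv (deriv ψ) x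
      + (∑ k, P.b i j k (u x) * deriv u x k) * deriv ψ x + deriv (P.cForm i j u) x * ψ x) := by
  rw [(h.hasDerivAt_cForm hu i j x).deriv, SecondOrderOperator.density]

theorem integral_density_one (h : DeformationData U G L P) (hu : IsLoop U u) (i j : Fin n)
    {φ : ℝ → ℝ} (hφ : SmoothPeriodic φ) :
    ∫ x in (0 : ℝ)..1, P.density i j φ (fun _ => 1) u x
      = ∫ x in (0 : ℝ)..1, -deriv φ x * P.cForm i j u x := by
  rw [← hφ.integral_mul_deriv (h.smoothPeriodic_cForm hu i j)]
  refine intervalIntegral.integral_congr fun x _ => ?_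
  simp [h.density_eq hu]

/-- Skewness tested on the pair `1, φ`. After integration by parts both sides are integrals against
`φ'` of expressions linear in `u_x`; the loop `p + s φ e_k` isolates the `k`-th coefficient. -/
theorem b_eq (h : DeformationData U G L P) (hp : p ∈ U) (i j k : Fin n) :
    P.b i j k p = partialDeriv k (P.a i j) p + P.c i j k p + P.c j i k p := by
  obtain ⟨-, φ, -, -, hφ, -, -, hne, -⟩ := exists_test_functions
  obtain ⟨ha, hb, -, hc, -⟩ := id h.isAdmissible
  have hU := h.isOpen
  set d : Fin n → (Fin n → ℝ) → ℝ := fun k u =>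
    P.b i j k u - partialDeriv k (P.a i j) u - P.c i j k u - P.c j i k u with hd
  have hds : ∀ k, ContDiffOn ℝ ∞ (d k) U := fun k =>
    (((hb i j k).sub ((ha i j).partialDeriv hU k)).sub (hc i j k)).sub (hc j i k)
  have key : ∀ u, IsLoop U u → ∫ x in (0 : ℝ)..1, (∑ k, d k (u x) * deriv u x k) * deriv φ x = 0 := by
    intro u hu
    have e1 := h.isInfinitesimalDeformation.integral_density_skew i j (.const 1) hφ hu
    rw [h.integral_density_one hu j i hφ, ← sub_eq_zero, sub_neg_eq_add,
      ← intervalIntegral.integral_add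
      (((h.isAdmissible.isLocalDensity_density hU i j (.const 1) hφ).smoothPeriodic
        hu).intervalIntegrable _ _) ((hφ.deriv.neg.mul
          (h.smoothPeriodic_cForm hu j i)).intervalIntegrable _ _)] at e1
    have e2 : ∫ x in (0 : ℝ)..1, (P.density i j (fun _ => 1) φ u x
        + -deriv φ x * P.cForm j i u x - (∑ k, d k (u x) * deriv u x k) * deriv φ x) = 0 := by
      refine (((hu.smoothPeriodic_comp (ha i j)).mul hφ.deriv).add
        ((h.smoothPeriodic_cForm hu i j).mul hφ)).integral_eq_zero_of_hasDerivAt fun x => ?_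
      refine (((hasDerivAt_comp_loop hU hu (ha i j) x).mul (hφ.deriv.hasDerivAt x)).add
        (((h.smoothPeriodic_cForm hu i j).hasDerivAt x).mul (hφ.hasDerivAt x))).congr_deriv ?_
      have e3 : ∑ k, d k (u x) * deriv u x k = ∑ k, P.b i j k (u x) * deriv u x k
          - ∑ k, partialDeriv k (P.a i j) (u x) * deriv u x k - P.cForm i j u x
          - P.cForm j i u x := by
        simp only [hd, SecondOrderOperator.cForm, sub_mul, Finset.sum_sub_distrib]
      rw [h.density_eq hu, e3]
      ring
    rw [intervalIntegral.integral_sub (((h.isAdmissible.isLocalDensity_density hU i j (.const 1)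
      hφ).smoothPeriodic hu |>.add (hφ.deriv.neg.mul
        (h.smoothPeriodic_cForm hu j i))).intervalIntegrable _ _)
        (((smoothPeriodic_sum_comp_mul_deriv hds hu).mul hφ.deriv).intervalIntegrable _ _),
      e1, zero_sub, neg_eq_zero] at e2
    exact e2
  have hu := IsLoop.const hp
  have hv := hφ.coordLoop k
  have hT : IsLocalDensity U fun u x => d k (u x) * (deriv φ x * deriv φ x) :=
    (IsLocalDensity.comp_contDiffOn (hds k)).mul (.of_smoothPeriodic (hφ.deriv.mul hφ.deriv))
  have lim := hT.integral_eq_zero_of_eventually hU hu hv (by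
    filter_upwards [nhdsWithin_le_nhds (hu.eventually_add_smul hU hv), self_mem_nhdsWithin]
      with s hs hs0
    have h2 : s * (∫ x in (0 : ℝ)..1, d k (((fun _ => p : ℝ → Fin n → ℝ) + s • coordLoop k φ) x)
        * (deriv φ x * deriv φ x)) = 0 := by
      rw [← intervalIntegral.integral_const_mul]
      refine Eq.trans ?_ (key _ hs)
      refine intervalIntegral.integral_congr fun x _ => ?_
      simp only [deriv_const_add_smul p hv, deriv_coordLoop hφ, coordLoop_apply, mul_ite, mul_zero,
        Finset.sum_ite_eq', Finset.mem_univ, if_true]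
      ring
    exact (mul_eq_zero.1 h2).resolve_left hs0)
  rw [intervalIntegral.integral_const_mul] at lim
  have := (mul_eq_zero.1 lim).resolve_right hne
  simp only [hd] at this
  linarith

/-- The derivative of `c^{aj}_k u^k_x` along `g^{mb} χ_x`. -/
theorem hasDerivAt_integral_cForm (h : DeformationData U G L P) (hu : IsLoop U u)
    (a j b : Fin n) {φ χ : ℝ → ℝ} (hφ : SmoothPeriodic φ) (hχ : SmoothPeriodic χ) :
    HasDerivAt (fun t : ℝ => ∫ x in (0 : ℝ)..1, P.density a j φ (fun _ => 1)
        (u + t • hamField G (coordLoop b χ)) x)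
      (∫ x in (0 : ℝ)..1, -deriv φ x * ((∑ k, (∑ m, partialDeriv m (P.c a j k) (u x) * G m b)
        * deriv u x k) * deriv χ x + (∑ k, P.c a j k (u x) * G k b) * deriv (deriv χ) x)) 0 := by
  have hU := h.isOpen
  have hw := (hχ.coordLoop b).hamField (G := G)
  have hloc : IsLocalDensity U fun u x => -deriv φ x * P.cForm a j u x :=
    (IsLocalDensity.of_smoothPeriodic hφ.deriv.neg).mul (h.isAdmissible.isLocalDensity_cForm hU a j)
  have hd := hloc.hasDerivAt_integral hU hu hw
  refine (hd.congr_of_eventuallyEq ?_).congr_deriv (intervalIntegral.integral_congr fun x _ => ?_)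
  · filter_upwards [hu.eventually_add_smul hU hw] with t ht
    exact h.integral_density_one ht a j hφ
  · have hdw : ∀ k, deriv (hamField G (coordLoop b χ)) x k = G k b * deriv (deriv χ) x := fun k => by
      rw [hw.deriv_apply]
      simp only [hamField_coordLoop hχ]
      exact ((hχ.deriv.hasDerivAt x).const_mul _).deriv
    have h1 := (HasDerivAt.fun_sum fun k (_ : k ∈ Finset.univ) =>
      (hasDerivAt_comp_add_smul hU (h.isAdmissible.2.2.2.1 a j k) hu
        (hamField G (coordLoop b χ)) x).mul
      (((hasDerivAt_id (0 : ℝ)).mul_const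
        (deriv (hamField G (coordLoop b χ)) x k)).const_add (deriv u x k))).const_mul (-deriv φ x)
    have h2 : HasDerivAt (fun t : ℝ => -deriv φ x * P.cForm a j
        (u + t • hamField G (coordLoop b χ)) x) _ 0 :=
      h1.congr_of_eventuallyEq (.of_forall fun t => by
        simp only [SecondOrderOperator.cForm, deriv_add_smul_apply hu.univ hw]
        rfl)
    refine h2.deriv.trans ?_
    simp only [id_eq, zero_mul, add_zero, zero_smul, one_mul, hdw, hamField_coordLoop hχ,
      Finset.sum_add_distrib, Finset.sum_mul]
    congr 2
    · refine Finset.sum_congr rfl fun k _ => Finset.sum_congr rfl fun m _ => ?_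
      ring
    · exact Finset.sum_congr rfl fun k _ => by ring

/-- In the Jacobi identity with constant middle covector one term vanishes, and skewness of `P`
brings a second one to the same shape as the first. -/
theorem integral_cForm_comm (h : DeformationData U G L P) (hu : IsLoop U u)
    (a j b : Fin n) {φ χ : ℝ → ℝ} (hφ : SmoothPeriodic φ) (hχ : SmoothPeriodic χ) :
    ∫ x in (0 : ℝ)..1, -deriv φ x * ((∑ k, (∑ m, partialDeriv m (P.c a j k) (u x) * G m b)
        * deriv u x k) * deriv χ x + (∑ k, P.c a j k (u x) * G k b) * deriv (deriv χ) x)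
      = ∫ x in (0 : ℝ)..1, -deriv χ x * ((∑ k, (∑ m, partialDeriv m (P.c b j k) (u x) * G m a)
        * deriv u x k) * deriv φ x + (∑ k, P.c b j k (u x) * G k a) * deriv (deriv φ) x) := by
  have hU := h.isOpen
  have c1 : SmoothPeriodic fun _ => (1 : ℝ) := .const 1
  have h1 := h.hasDerivAt_integral_cForm hu a j b hφ hχ
  have h2 := (h.hasDerivAt_integral_cForm hu b j a hχ hφ).neg
  have h2' := h2.congr_of_eventuallyEq (f₁ := fun t : ℝ => ∫ x in (0 : ℝ)..1,
      P.density j b (fun _ => 1) χ (u + t • hamField G (coordLoop a φ)) x) (by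
    filter_upwards [hu.eventually_add_smul hU ((hφ.coordLoop a).hamField (G := G))] with t ht
    exact h.isInfinitesimalDeformation.integral_density_skew j b c1 hχ ht)
  simp only [← P.loopPairing_coordLoop a j c1] at h1
  simp only [← P.loopPairing_coordLoop j b hχ] at h2'
  have := h.isInfinitesimalDeformation.jacobi hU h.isSymm h.isConstant
    (h.isAdmissible.isLocalOperator hU) (hφ.coordLoop a) (c1.coordLoop j) (hχ.coordLoop b) hu
    h1 h2' (d₃ := 0) (by simp only [hamField_coordLoop_const, smul_zero, add_zero]
                         exact hasDerivAt_const _ _)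
  linarith

/-- `integral_cForm_comm` at a constant loop with `χ = τ` and `φ = τ'`; both sides become multiples
of `∫ φ'²`. In lowered indices this is the antisymmetry of a 2-form for each fixed `j`. -/
theorem c_skew (h : DeformationData U G L P) (hp : p ∈ U) (a j b : Fin n) :
    ∑ k, P.c a j k p * G k b = -∑ k, P.c b j k p * G k a := by
  obtain ⟨τ, φ, -, hτ, hφ, -, rfl, hne, -⟩ := exists_test_functions
  have h1 := h.integral_cForm_comm (IsLoop.const hp) a j b hφ hτ
  simp only [deriv_const, Pi.zero_apply, mul_zero, Finset.sum_const_zero, zero_mul, zero_add] at h1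
  simp only [mul_left_comm _ (∑ k, _), intervalIntegral.integral_const_mul, neg_mul,
    intervalIntegral.integral_neg] at h1
  rw [hφ.integral_mul_deriv hφ.deriv] at h1
  simp only [neg_mul, intervalIntegral.integral_neg] at h1
  have h2 : (∑ k, P.c a j k p * G k b + ∑ k, P.c b j k p * G k a)
      * ∫ x in (0 : ℝ)..1, deriv (deriv τ) x * deriv (deriv τ) x = 0 := by
    linear_combination -h1
  linarith [(mul_eq_zero.1 h2).resolve_right hne]

/-- `integral_cForm_comm` with equal test functions, now keeping the part linear in `u_x`. It
appears against `φ'²`, and the loop `p + s σ e_k` extracts it because `φ'² σ'` has non-zero mean. In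
lowered indices this closes the 2-forms given by `c_skew`. -/
theorem c_closed (h : DeformationData U G L P) (hp : p ∈ U) (a j b k : Fin n) :
    ∑ m, partialDeriv m (P.c a j k) p * G m b - ∑ m, partialDeriv m (P.c b j k) p * G m a
      = ∑ m, partialDeriv k (P.c a j m) p * G m b := by
  obtain ⟨-, φ, σ, -, hφ, hσ, -, -, hne⟩ := exists_test_functions
  have hU := h.isOpen
  have hc := h.isAdmissible.2.2.2.1
  have hcp : ∀ a k m, ContDiffOn ℝ ∞ (partialDeriv m (P.c a j k)) U := fun a k m =>
    (hc a j k).partialDeriv hU m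
  set d : Fin n → (Fin n → ℝ) → ℝ := fun k u => ∑ m, partialDeriv m (P.c a j k) u * G m b
    - ∑ m, partialDeriv m (P.c b j k) u * G m a - ∑ m, partialDeriv k (P.c a j m) u * G m b with hd
  have hds : ∀ k, ContDiffOn ℝ ∞ (d k) U := fun k =>
    ((ContDiffOn.sum fun m _ => (hcp a k m).mul contDiffOn_const).sub
      (ContDiffOn.sum fun m _ => (hcp b k m).mul contDiffOn_const)).sub
      (ContDiffOn.sum fun m _ => (hcp a m k).mul contDiffOn_const)
  set C : Fin n → Fin n → (Fin n → ℝ) → ℝ := fun a b u => ∑ k, P.c a j k u * G k b with hC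
  have hCs : ∀ a b, ContDiffOn ℝ ∞ (C a b) U := fun a b =>
    ContDiffOn.sum fun m _ => (hc a j m).mul contDiffOn_const
  have key : ∀ u, IsLoop U u →
      ∫ x in (0 : ℝ)..1, (∑ k, d k (u x) * deriv u x k) * (deriv φ x * deriv φ x) = 0 := by
    intro u hu
    have hS : ∀ a b, SmoothPeriodic fun x => -deriv φ x * ((∑ k, (∑ m, partialDeriv m (P.c a j k)
        (u x) * G m b) * deriv u x k) * deriv φ x + C a b (u x) * deriv (deriv φ) x) := fun a b =>
      hφ.deriv.neg.mul (((SmoothPeriodic.sum fun k _ => (SmoothPeriodic.sum fun m _ =>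
        (hu.smoothPeriodic_comp (hcp a k m)).mul (.const _)).mul (hu.deriv.apply k)).mul
          hφ.deriv).add ((hu.smoothPeriodic_comp (hCs a b)).mul hφ.deriv.deriv))
    have e1 := h.integral_cForm_comm hu a j b hφ hφ
    rw [← sub_eq_zero, ← intervalIntegral.integral_sub ((hS a b).intervalIntegrable _ _)
      ((hS b a).intervalIntegrable _ _)] at e1
    have hI := (smoothPeriodic_sum_comp_mul_deriv hds hu).mul (hφ.deriv.mul hφ.deriv)
    -- By `c_skew` the second-derivative terms combine to `-2 C_ab φ' φ''`; the primitive `-C_ab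
    -- φ'²` converts them into a derivative of `C_ab` against `φ'²`.
    have e2 := ((((hu.smoothPeriodic_comp (hCs a b)).mul
      (hφ.deriv.mul hφ.deriv))).neg).integral_eq_zero_of_hasDerivAt (f' := fun x =>
        (-deriv φ x * ((∑ k, (∑ m, partialDeriv m (P.c a j k)
        (u x) * G m b) * deriv u x k) * deriv φ x + C a b (u x) * deriv (deriv φ) x)
        - -deriv φ x * ((∑ k, (∑ m, partialDeriv m (P.c b j k)
        (u x) * G m a) * deriv u x k) * deriv φ x + C b a (u x) * deriv (deriv φ) x))
        + (∑ k, d k (u x) * deriv u x k) * (deriv φ x * deriv φ x)) fun x => by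
      refine ((hasDerivAt_comp_loop hU hu (hCs a b) x).mul ((hφ.deriv.hasDerivAt x).mul
        (hφ.deriv.hasDerivAt x))).neg.congr_deriv ?_
      have hCd : ∀ k, partialDeriv k (C a b) (u x) = ∑ m, partialDeriv k (P.c a j m) (u x) * G m b :=
        fun k => by
          rw [partialDeriv, HasFDerivAt.fderiv (HasFDerivAt.fun_sum fun m (_ : m ∈ Finset.univ) =>
            ((hc a j m).hasFDerivAt_of_mem hU (hu.2.2 x)).mul_const (G m b))]
          simp [partialDeriv, mul_comm]
      have hsk : C b a (u x) = -C a b (u x) := h.c_skew (hu.2.2 x) b j a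
      rw [hsk]
      simp only [hCd, hd, sub_mul, Finset.sum_sub_distrib, Pi.mul_apply]
      ring
    rw [intervalIntegral.integral_add (((hS a b).sub (hS b a)).intervalIntegrable _ _)
      (hI.intervalIntegrable _ _), e1, zero_add] at e2
    exact e2
  have hu := IsLoop.const hp
  have hv := hσ.coordLoop k
  have hT : IsLocalDensity U fun u x => d k (u x) * (deriv φ x * deriv φ x * deriv σ x) :=
    (IsLocalDensity.comp_contDiffOn (hds k)).mul
      (.of_smoothPeriodic ((hφ.deriv.mul hφ.deriv).mul hσ.deriv))
  have lim := hT.integral_eq_zero_of_eventually hU hu hv (by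
    filter_upwards [nhdsWithin_le_nhds (hu.eventually_add_smul hU hv), self_mem_nhdsWithin]
      with s hs hs0
    have h2 : s * (∫ x in (0 : ℝ)..1, d k (((fun _ => p : ℝ → Fin n → ℝ) + s • coordLoop k σ) x)
        * (deriv φ x * deriv φ x * deriv σ x)) = 0 := by
      rw [← intervalIntegral.integral_const_mul]
      refine Eq.trans ?_ (key _ hs)
      refine intervalIntegral.integral_congr fun x _ => ?_
      simp only [deriv_const_add_smul p hv, deriv_coordLoop hσ, coordLoop_apply, mul_ite, mul_zero,
        Finset.sum_ite_eq', Finset.mem_univ, if_true]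
      ring
    exact (mul_eq_zero.1 h2).resolve_left hs0)
  rw [intervalIntegral.integral_const_mul] at lim
  have := (mul_eq_zero.1 lim).resolve_right hne
  simp only [hd] at this
  linarith

/-- At a constant loop the quadratic term in `u_x` has no first variation, and `b` and `c`
contribute only through the derivatives of the perturbation. -/
theorem hasDerivAt_integral_density_const (h : DeformationData U G L P) (hp : p ∈ U)
    (i j l : Fin n) {φ ψ χ : ℝ → ℝ} (hφ : SmoothPeriodic φ) (hψ : SmoothPeriodic ψ)
    (hχ : SmoothPeriodic χ) :
    HasDerivAt (fun t : ℝ => ∫ x in (0 : ℝ)..1, P.density i j φ ψ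
        ((fun _ => p : ℝ → Fin n → ℝ) + t • hamField G (coordLoop l χ)) x)
      (∫ x in (0 : ℝ)..1, φ x * ((∑ m, partialDeriv m (P.a i j) p * G m l)
          * (deriv χ x * deriv (deriv ψ) x)
        + (∑ m, P.b i j m p * G m l) * (deriv (deriv χ) x * deriv ψ x)
        + (∑ m, P.c i j m p * G m l) * (deriv (deriv (deriv χ)) x * ψ x))) 0 := by
  have hU := h.isOpen
  obtain ⟨ha, hb, hcc, hc, -⟩ := id h.isAdmissible
  have hu := IsLoop.const hp
  set w := hamField G (coordLoop l χ)
  have hw : IsLoop Set.univ w := (hχ.coordLoop l).hamField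
  have hw0 : ∀ x k, w x k = G k l * deriv χ x := fun x k => hamField_coordLoop hχ l x k
  have hw1 : ∀ x k, deriv w x k = G k l * deriv (deriv χ) x := fun x k => by
    rw [hw.deriv_apply]
    simp only [hw0]
    exact ((hχ.deriv.hasDerivAt x).const_mul _).deriv
  have hw2 : ∀ x k, iteratedDeriv 2 w x k = G k l * deriv (deriv (deriv χ)) x := fun x k => by
    rw [iteratedDeriv_succ, iteratedDeriv_one, hw.deriv.deriv_apply]
    simp only [hw1]
    exact ((hχ.deriv.deriv.hasDerivAt x).const_mul _).deriv
  refine ((h.isAdmissible.isLocalDensity_density hU i j hφ hψ).hasDerivAt_integral hU hu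
    hw).congr_deriv (intervalIntegral.integral_congr fun x _ => ?_)
  have hcomp : ∀ {f : (Fin n → ℝ) → ℝ}, ContDiffOn ℝ ∞ f U →
      HasDerivAt (fun t : ℝ => f (((fun _ => p : ℝ → Fin n → ℝ) + t • w) x))
        (∑ k, partialDeriv k f p * w x k) 0 := fun hf => hasDerivAt_comp_add_smul hU hf hu w x
  have ht : ∀ c : ℝ, HasDerivAt (fun t : ℝ => t * c) c 0 := fun c => by
    simpa using (hasDerivAt_id (0 : ℝ)).mul_const c
  have h1 := (((((hcomp (ha i j)).mul_const (deriv (deriv ψ) x)).add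
    ((HasDerivAt.fun_sum fun k (_ : k ∈ Finset.univ) =>
      (hcomp (hb i j k)).mul (ht (deriv w x k))).mul_const (deriv ψ x))).add
    (((HasDerivAt.fun_sum fun k (_ : k ∈ Finset.univ) => HasDerivAt.fun_sum
      fun l (_ : l ∈ Finset.univ) => ((hcomp (hcc i j k l)).mul (ht (deriv w x k))).mul
        (ht (deriv w x l))).add (HasDerivAt.fun_sum fun k (_ : k ∈ Finset.univ) =>
      (hcomp (hc i j k)).mul (ht (iteratedDeriv 2 w x k)))).mul_const (ψ x)))).const_mul (φ x)
  have h2 : HasDerivAt (fun t : ℝ => P.density i j φ ψ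
      ((fun _ => p : ℝ → Fin n → ℝ) + t • w) x) _ 0 :=
    h1.congr_of_eventuallyEq (.of_forall fun t => by
      simp only [SecondOrderOperator.density, deriv_const_add_smul p hw,
        iteratedDeriv_two_const_add_smul p hw]
      rfl)
  refine h2.deriv.trans ?_
  simp only [Pi.mul_apply, zero_mul, mul_zero, add_zero, zero_add, zero_smul, hw0, hw1, hw2,
    Pi.add_apply, Finset.sum_const_zero, ← mul_assoc, ← Finset.sum_mul]
  simp only [Pi.zero_apply, add_zero]

/-- The Jacobi identity at a constant loop with test functions `φ, φ, χ`. Once `b` is eliminated by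
`b_eq`, every term reduces modulo total derivatives to a multiple of `∫ φ'² χ'`. -/
theorem a_cyclic (h : DeformationData U G L P) (hp : p ∈ U) (i j l : Fin n) :
    ∑ m, partialDeriv m (P.a i j) p * G m l + ∑ m, partialDeriv m (P.a j l) p * G m i
      + ∑ m, partialDeriv m (P.a l i) p * G m j
      = ∑ m, P.c i j m p * G m l + ∑ m, P.c l i m p * G m j + ∑ m, P.c j l m p * G m i := by
  obtain ⟨-, φ, χ, -, hφ, hχ, -, -, hne⟩ := exists_test_functions
  have hU := h.isOpen
  have hu := IsLoop.const hp
  have h1 := h.hasDerivAt_integral_density_const hp i j l hφ hφ hχ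
  have h2 := h.hasDerivAt_integral_density_const hp j l i hφ hχ hφ
  have h3 := h.hasDerivAt_integral_density_const hp l i j hχ hφ hφ
  simp only [← P.loopPairing_coordLoop i j hφ] at h1
  simp only [← P.loopPairing_coordLoop j l hχ] at h2
  simp only [← P.loopPairing_coordLoop l i hφ] at h3
  have hj := h.isInfinitesimalDeformation.jacobi hU h.isSymm h.isConstant
    (h.isAdmissible.isLocalOperator hU) (hφ.coordLoop i) (hφ.coordLoop j) (hχ.coordLoop l) hu
    h1 h2 h3
  have hb : ∀ i j l, ∑ m, P.b i j m p * G m l = ∑ m, partialDeriv m (P.a i j) p * G m l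
      + ∑ m, P.c i j m p * G m l + ∑ m, P.c j i m p * G m l := fun i j l => by
    simp only [h.b_eq hp, add_mul, Finset.sum_add_distrib]
  -- By `c_skew` the six contractions of `c` with `G` reduce to the three named `q`, `r` and `s`
  -- below.
  rw [hb i j l, hb j l i, hb l i j, h.c_skew hp l j i, h.c_skew hp i l j, h.c_skew hp l i j] at hj
  rw [h.c_skew hp l i j]
  generalize ∑ m, partialDeriv m (P.a i j) p * G m l = α at hj ⊢
  generalize ∑ m, partialDeriv m (P.a j l) p * G m i = β at hj ⊢
  generalize ∑ m, partialDeriv m (P.a l i) p * G m j = γ at hj ⊢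
  generalize ∑ m, P.c i j m p * G m l = q at hj ⊢
  generalize ∑ m, P.c j i m p * G m l = r at hj ⊢
  generalize ∑ m, P.c j l m p * G m i = s at hj ⊢
  have hI : SmoothPeriodic fun x => deriv φ x * deriv φ x * deriv χ x :=
    (hφ.deriv.mul hφ.deriv).mul hχ.deriv
  have i1 : SmoothPeriodic fun x => φ x * (α * (deriv χ x * deriv (deriv φ) x)
      + (α + q + r) * (deriv (deriv χ) x * deriv φ x) + q * (deriv (deriv (deriv χ)) x * φ x)) :=
    hφ.mul ((((SmoothPeriodic.const _).mul (hχ.deriv.mul hφ.deriv.deriv)).add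
      ((SmoothPeriodic.const _).mul (hχ.deriv.deriv.mul hφ.deriv))).add
      ((SmoothPeriodic.const _).mul (hχ.deriv.deriv.deriv.mul hφ)))
  have i2 : SmoothPeriodic fun x => φ x * (β * (deriv φ x * deriv (deriv χ) x)
      + (β + s + -q) * (deriv (deriv φ) x * deriv χ x) + s * (deriv (deriv (deriv φ)) x * χ x)) :=
    hφ.mul ((((SmoothPeriodic.const _).mul (hφ.deriv.mul hχ.deriv.deriv)).add
      ((SmoothPeriodic.const _).mul (hφ.deriv.deriv.mul hχ.deriv))).add
      ((SmoothPeriodic.const _).mul (hφ.deriv.deriv.deriv.mul hχ)))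
  have i3 : SmoothPeriodic fun x => χ x * (γ * (deriv φ x * deriv (deriv φ) x)
      + (γ + -r + -s) * (deriv (deriv φ) x * deriv φ x) + -r * (deriv (deriv (deriv φ)) x * φ x)) :=
    hχ.mul ((((SmoothPeriodic.const _).mul (hφ.deriv.mul hφ.deriv.deriv)).add
      ((SmoothPeriodic.const _).mul (hφ.deriv.deriv.mul hφ.deriv))).add
      ((SmoothPeriodic.const _).mul (hφ.deriv.deriv.deriv.mul hφ)))
  -- A primitive of the Jacobi integrand plus `(α + β + γ - q + r - s) φ'² χ'`; its coefficients are
  -- fixed by comparing the monomials in the derivatives of `φ` and `χ`.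
  have hR : SmoothPeriodic fun x => q * (φ x * φ x * deriv (deriv χ) x)
      + (α + β - q + r) * (φ x * deriv φ x * deriv χ x) + (s - r) * (φ x * deriv (deriv φ) x * χ x)
      + (γ - s) * (deriv φ x * deriv φ x * χ x) :=
    (((((SmoothPeriodic.const _).mul ((hφ.mul hφ).mul hχ.deriv.deriv)).add
      ((SmoothPeriodic.const _).mul ((hφ.mul hφ.deriv).mul hχ.deriv))).add
      ((SmoothPeriodic.const _).mul ((hφ.mul hφ.deriv.deriv).mul hχ))).add
      ((SmoothPeriodic.const _).mul ((hφ.deriv.mul hφ.deriv).mul hχ)))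
  have e := hR.integral_eq_zero_of_hasDerivAt (f' := fun x =>
      (φ x * (α * (deriv χ x * deriv (deriv φ) x)
        + (α + q + r) * (deriv (deriv χ) x * deriv φ x) + q * (deriv (deriv (deriv χ)) x * φ x))
      + φ x * (β * (deriv φ x * deriv (deriv χ) x)
        + (β + s + -q) * (deriv (deriv φ) x * deriv χ x) + s * (deriv (deriv (deriv φ)) x * χ x))
      + χ x * (γ * (deriv φ x * deriv (deriv φ) x) + (γ + -r + -s) * (deriv (deriv φ) x * deriv φ x)
        + -r * (deriv (deriv (deriv φ)) x * φ x)))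
      + (α + β + γ - q + r - s) * (deriv φ x * deriv φ x * deriv χ x)) fun x => by
    have d0 := hφ.hasDerivAt x
    have d1 := hφ.deriv.hasDerivAt x
    have d2 := hφ.deriv.deriv.hasDerivAt x
    have e0 := hχ.hasDerivAt x
    have e1 := hχ.deriv.hasDerivAt x
    have e2 := hχ.deriv.deriv.hasDerivAt x
    refine (((((d0.mul d0).mul e2).const_mul q).add (((d0.mul d1).mul e1).const_mul
      (α + β - q + r))).add (((d0.mul d2).mul e0).const_mul (s - r))).add
      (((d1.mul d1).mul e0).const_mul (γ - s)) |>.congr_deriv ?_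
    simp only [Pi.mul_apply]
    ring
  rw [intervalIntegral.integral_add (((i1.add i2).add i3).intervalIntegrable _ _)
      (((SmoothPeriodic.const _).mul hI).intervalIntegrable _ _),
    intervalIntegral.integral_add ((i1.add i2).intervalIntegrable _ _)
      (i3.intervalIntegrable _ _),
    intervalIntegral.integral_add (i1.intervalIntegrable _ _) (i2.intervalIntegrable _ _), hj,
    zero_add, intervalIntegral.integral_const_mul] at e
  have := (mul_eq_zero.1 e).resolve_right hne
  linarith

end DeformationData

end MoreConditions

end

/-! ### Reconstruction of the tensor by the Poincaré lemma -/

noncomputable section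

section Reconstruction

variable {n : ℕ} {U V : Set (Fin n → ℝ)} {u p : Fin n → ℝ} {G : Matrix (Fin n) (Fin n) ℝ}
  {L : LoopOperator n} {P : SecondOrderOperator n}

theorem partialDeriv_congr {f g : (Fin n → ℝ) → ℝ} (hV : IsOpen V) (h : Set.EqOn f g V)
    (hu : u ∈ V) (k : Fin n) : partialDeriv k f u = partialDeriv k g u := by
  rw [partialDeriv, partialDeriv,
    Filter.EventuallyEq.fderiv_eq (Filter.eventually_of_mem (hV.mem_nhds hu) h)]

theorem partialDeriv_add {f g : (Fin n → ℝ) → ℝ} (hV : IsOpen V) (hf : ContDiffOn ℝ ∞ f V)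
    (hg : ContDiffOn ℝ ∞ g V) (hu : u ∈ V) (k : Fin n) :
    partialDeriv k (fun v => f v + g v) u = partialDeriv k f u + partialDeriv k g u := by
  rw [partialDeriv, ((hf.hasFDerivAt_of_mem hV hu).fun_add (hg.hasFDerivAt_of_mem hV hu)).fderiv]
  rfl

theorem partialDeriv_sub {f g : (Fin n → ℝ) → ℝ} (hV : IsOpen V) (hf : ContDiffOn ℝ ∞ f V)
    (hg : ContDiffOn ℝ ∞ g V) (hu : u ∈ V) (k : Fin n) :
    partialDeriv k (fun v => f v - g v) u = partialDeriv k f u - partialDeriv k g u := by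
  rw [partialDeriv, ((hf.hasFDerivAt_of_mem hV hu).fun_sub (hg.hasFDerivAt_of_mem hV hu)).fderiv]
  rfl

theorem contDiffOn_sum_const_mul {ι : Type*} [Fintype ι] {c : ι → ℝ} {f : ι → (Fin n → ℝ) → ℝ}
    (hf : ∀ s, ContDiffOn ℝ ∞ (f s) V) : ContDiffOn ℝ ∞ (fun v => ∑ s, c s * f s v) V :=
  ContDiffOn.sum fun s _ => contDiffOn_const.mul (hf s)

theorem partialDeriv_sum_const_mul {ι : Type*} [Fintype ι] {c : ι → ℝ} {f : ι → (Fin n → ℝ) → ℝ}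
    (hV : IsOpen V) (hf : ∀ s, ContDiffOn ℝ ∞ (f s) V) (hu : u ∈ V) (k : Fin n) :
    partialDeriv k (fun v => ∑ s, c s * f s v) u = ∑ s, c s * partialDeriv k (f s) u := by
  rw [partialDeriv, HasFDerivAt.fderiv (HasFDerivAt.fun_sum fun s (_ : s ∈ Finset.univ) =>
    ((hf s).hasFDerivAt_of_mem hV hu).const_mul (c s))]
  simp [partialDeriv]

/-- Conjugation by `G⁻¹`: it turns an antisymmetrization in raised indices into one in lowered
indices. -/
theorem Matrix.inv_mul_sub_transpose {X Y : Matrix (Fin n) (Fin n) ℝ} (hG : G.IsSymm)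
    (hGu : IsUnit G.det) (h : X * G - (X * G).transpose = Y * G) :
    G⁻¹ * X - (G⁻¹ * X).transpose = G⁻¹ * Y := by
  have hH : G⁻¹.transpose = G⁻¹ := by rw [Matrix.transpose_nonsing_inv, hG.eq]
  have := congrArg (fun M => G⁻¹ * M * G⁻¹) h
  simpa [Matrix.transpose_mul, hG.eq, hH, Matrix.mul_sub, Matrix.sub_mul, Matrix.mul_assoc,
    Matrix.mul_nonsing_inv _ hGu, Matrix.nonsing_inv_mul _ hGu,
    Matrix.nonsing_inv_mul_cancel_left _ _ hGu] using this

theorem sum_mul_inv (hGu : IsUnit G.det) (f : Fin n → ℝ) (k : Fin n) :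
    ∑ l, (∑ m, f m * G m l) * G⁻¹ l k = f k := by
  have := congrFun (congrArg (fun M => Matrix.vecMul f M) (Matrix.mul_nonsing_inv G hGu)) k
  simp only [← Matrix.vecMul_vecMul, Matrix.vecMul_one] at this
  simpa [Matrix.vecMul, dotProduct] using this

theorem sum_mul_sum_inv_mul (hGu : IsUnit G.det) (f : Fin n → ℝ) (i : Fin n) :
    ∑ s, G i s * ∑ a, G⁻¹ s a * f a = f i := by
  have := congrFun (congrArg (fun M => Matrix.mulVec M f) (Matrix.mul_nonsing_inv G hGu)) i
  simp only [← Matrix.mulVec_mulVec, Matrix.one_mulVec] at this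
  simpa [Matrix.mulVec, dotProduct] using this

/-- The Poincaré lemma for bivector fields, with indices raised by a constant metric. -/
theorem exists_potential_of_cyclic (hV : IsOpen V) (hstar : StarConvex ℝ p V)
    (hG : G.IsSymm) (hGu : IsUnit G.det) {α : Fin n → Fin n → (Fin n → ℝ) → ℝ}
    (hα : ∀ i j, ContDiffOn ℝ ∞ (α i j) V) (hanti : ∀ u ∈ V, ∀ i j, α i j u = -α j i u)
    (hcyc : ∀ u ∈ V, ∀ i j l, ∑ m, partialDeriv m (α i j) u * G m l
      + ∑ m, partialDeriv m (α j l) u * G m i + ∑ m, partialDeriv m (α l i) u * G m j = 0) :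
    ∃ f : Fin n → (Fin n → ℝ) → ℝ, (∀ j, ContDiffOn ℝ ∞ (f j) V) ∧ ∀ u ∈ V, ∀ i j,
      α i j u = ∑ s, G i s * partialDeriv s (f j) u - ∑ s, G j s * partialDeriv s (f i) u := by
  have hs : ∀ s t, ContDiffOn ℝ ∞ (fun u => ∑ j, G⁻¹ t j * α s j u) V := fun s t =>
    contDiffOn_sum_const_mul fun j => hα s j
  have hd : ∀ u ∈ V, ∀ k s t, partialDeriv k (fun u => ∑ i, G⁻¹ s i * ∑ j, G⁻¹ t j * α i j u) u
      = ∑ i, ∑ j, ∑ l, G⁻¹ s i * G⁻¹ t j * G⁻¹ k l * ∑ m, partialDeriv m (α i j) u * G m l := by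
    intro u hu k s t
    have hH : ∀ l, G⁻¹ k l = G⁻¹ l k := fun l => by
      have : G⁻¹.transpose = G⁻¹ := by rw [Matrix.transpose_nonsing_inv, hG.eq]
      exact congrFun (congrFun this l) k
    rw [partialDeriv_sum_const_mul hV (fun i => hs i t) hu]
    refine Finset.sum_congr rfl fun i _ => ?_
    rw [partialDeriv_sum_const_mul hV (fun j => hα i j) hu, Finset.mul_sum]
    refine Finset.sum_congr rfl fun j _ => ?_
    rw [← sum_mul_inv hGu (fun k => partialDeriv k (α i j) u) k, Finset.mul_sum, Finset.mul_sum]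
    refine Finset.sum_congr rfl fun l _ => ?_
    rw [hH l]
    ring
  obtain ⟨θ, hθ, hβ⟩ := exists_potential_of_closed hV hstar
    -- The 2-form obtained by lowering both indices; as `G` is constant, lowering commutes with
    -- differentiation.
    (β := fun s t u => ∑ i, G⁻¹ s i * ∑ j, G⁻¹ t j * α i j u)
    (fun s t => contDiffOn_sum_const_mul fun i => hs i t)
    (fun u hu s t => by
      simp only [Finset.mul_sum]
      rw [Finset.sum_comm, ← Finset.sum_neg_distrib]
      refine Finset.sum_congr rfl fun j _ => ?_
      rw [← Finset.sum_neg_distrib]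
      refine Finset.sum_congr rfl fun i _ => ?_
      rw [hanti u hu i j]
      ring)
    (fun u hu s t k => by
      have e1 := hd u hu k s t
      have e2 := hd u hu s t k
      have e3 := hd u hu t k s
      -- The order of summation is permuted so that the three sums run over the same `i, j, l`,
      -- where `hcyc` applies termwise.
      rw [Finset.sum_congr rfl fun i _ => Finset.sum_comm, Finset.sum_comm] at e2
      rw [Finset.sum_comm, Finset.sum_congr rfl fun i _ => Finset.sum_comm] at e3
      rw [e1, e2, e3]
      simp only [← Finset.sum_add_distrib]
      refine Finset.sum_eq_zero fun i _ => Finset.sum_eq_zero fun j _ =>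
        Finset.sum_eq_zero fun l _ => ?_
      linear_combination G⁻¹ s i * G⁻¹ t j * G⁻¹ k l * hcyc u hu i j l)
  -- Raising the index of the potential 1-form `θ`.
  refine ⟨fun j u => ∑ t, G j t * θ t u, fun j => contDiffOn_sum_const_mul hθ, fun u hu i j => ?_⟩
  have e : α i j u = ∑ s, G i s * ∑ t, G j t * ∑ i, G⁻¹ s i * ∑ j, G⁻¹ t j * α i j u := by
    have e1 : ∀ s t, ∑ i, G⁻¹ s i * ∑ j, G⁻¹ t j * α i j u
        = ∑ j, G⁻¹ t j * ∑ i, G⁻¹ s i * α i j u := fun s t => by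
      simp only [Finset.mul_sum]
      rw [Finset.sum_comm]
      exact Finset.sum_congr rfl fun _ _ => Finset.sum_congr rfl fun _ _ => by ring
    simp only [e1, sum_mul_sum_inv_mul hGu]
  rw [e]
  simp only [hβ u hu, partialDeriv_sum_const_mul hV hθ hu, mul_sub, Finset.sum_sub_distrib]
  congr 1
  simp only [Finset.mul_sum]
  rw [Finset.sum_comm]
  exact Finset.sum_congr rfl fun _ _ => Finset.sum_congr rfl fun _ _ => by ring

namespace DeformationData

/-- Polarization of the quadratic identity `sum_cc_eq`, using the assumed symmetry of `cc` in its
last two indices. -/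
theorem cc_eq (h : DeformationData U G L P) (hp : p ∈ U) (i j k l : Fin n) :
    P.cc i j k l p = (1 / 2) * (partialDeriv l (P.c i j k) p + partialDeriv k (P.c i j l) p) := by
  have H := h.isInfinitesimalDeformation.sum_cc_eq h.isOpen h.isSymm h.isUnit_det h.isConstant
    h.isAdmissible hp i j
  have e1 := H (Pi.single k 1)
  have e2 := H (Pi.single l 1)
  have e3 := H (Pi.single k 1 + Pi.single l 1)
  simp only [Pi.add_apply, Pi.single_apply, mul_ite, mul_one, mul_zero, Finset.sum_ite_eq',
    Finset.mem_univ, if_true, mul_add, Finset.sum_add_distrib] at e1 e2 e3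
  have := h.isAdmissible.2.2.2.2 p hp i j k l
  linarith

/-- `b_eq` and `cc_eq` express `b` and `cc` through `a`, `c` and their first derivatives, so a
tensor matching `a` and `c` on an open set matches all coefficients. -/
theorem isGivenByTensor_of_eq (h : DeformationData U G L P) (hV : IsOpen V) (hVU : V ⊆ U)
    {A : Fin n → Fin n → (Fin n → ℝ) → ℝ} (hA : IsSmoothTensorField A V)
    (ha : ∀ u ∈ V, ∀ i j, P.a i j u = ∑ r, G i r * A j r u - ∑ r, G j r * A i r u)
    (hc : ∀ u ∈ V, ∀ i j k, P.c i j k u = ∑ s, G i s * partialDeriv k (A j s) u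
      - ∑ s, G i s * partialDeriv s (A j k) u) :
    IsGivenByTensor V (fun _ => G) A P := by
  have hA' : ∀ i j k, ContDiffOn ℝ ∞ (partialDeriv k (A i j)) V := fun i j k =>
    (hA i j).partialDeriv hV k
  refine fun u hu => ⟨ha u hu, fun i j k => ?_, fun i j k l => ?_, hc u hu⟩
  · rw [h.b_eq (hVU hu), hc u hu, hc u hu, partialDeriv_congr hV (fun v hv => ha v hv i j) hu,
      partialDeriv_sub hV (contDiffOn_sum_const_mul (hA j)) (contDiffOn_sum_const_mul (hA i)) hu,
      partialDeriv_sum_const_mul hV (hA j) hu, partialDeriv_sum_const_mul hV (hA i) hu]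
    ring
  · have hd : ∀ k l, partialDeriv l (P.c i j k) u
        = ∑ s, G i s * partialDeriv l (partialDeriv k (A j s)) u
          - ∑ s, G i s * partialDeriv s (partialDeriv l (A j k)) u := fun k l => by
      rw [partialDeriv_congr hV (fun v hv => hc v hv i j k) hu,
        partialDeriv_sub hV (contDiffOn_sum_const_mul fun s => hA' j s k)
          (contDiffOn_sum_const_mul fun s => hA' j k s) hu,
        partialDeriv_sum_const_mul hV (fun s => hA' j s k) hu,
        partialDeriv_sum_const_mul hV (fun s => hA' j k s) hu]
      simp only [partialDeriv_partialDeriv_comm hV (hA j k) hu l]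
    rw [h.cc_eq (hVU hu), hd, hd]
    simp only [partialDeriv_partialDeriv_comm hV (hA j _) hu k l, mul_left_comm (G i _) (1 / 2),
      ← Finset.mul_sum, mul_add, Finset.sum_add_distrib]
    ring

/-- The symbols `c^{ij}_k` are the raised exterior derivatives of `1`-forms. -/
theorem exists_tensor_c (h : DeformationData U G L P) (hV : IsOpen V) (hVU : V ⊆ U)
    (hstar : StarConvex ℝ p V) :
    ∃ A : Fin n → Fin n → (Fin n → ℝ) → ℝ, IsSmoothTensorField A V ∧
      ∀ u ∈ V, ∀ i j k, P.c i j k u = ∑ s, G i s * partialDeriv k (A j s) u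
        - ∑ s, G i s * partialDeriv s (A j k) u := by
  have hc : ∀ i j k, ContDiffOn ℝ ∞ (P.c i j k) V := fun i j k =>
    (h.isAdmissible.2.2.2.1 i j k).mono hVU
  have key : ∀ j, ∃ θ : Fin n → (Fin n → ℝ) → ℝ, (∀ i, ContDiffOn ℝ ∞ (θ i) V) ∧
      ∀ u ∈ V, ∀ s k, ∑ i, G⁻¹ s i * P.c i j k u
        = partialDeriv s (θ k) u - partialDeriv k (θ s) u := fun j => by
    have hanti : ∀ u ∈ V, ∀ s k, ∑ i, G⁻¹ s i * P.c i j k u = -∑ i, G⁻¹ k i * P.c i j s u := by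
      intro u hu s k
      -- Antisymmetry of `X G` is fed in as `X G - (X G)ᵀ = 2 X G`; the result `G⁻¹ X - (G⁻¹ X)ᵀ = 2
      -- G⁻¹ X` is antisymmetry of `G⁻¹ X`.
      have := congrFun (congrFun (Matrix.inv_mul_sub_transpose (X := .of fun i k => P.c i j k u)
        (Y := (.of fun i k => P.c i j k u) + .of fun i k => P.c i j k u) h.isSymm h.isUnit_det (by
          ext a b
          have := h.c_skew (hVU hu) a j b
          simp only [Matrix.sub_apply, Matrix.transpose_apply, Matrix.mul_apply, Matrix.of_apply,
            Matrix.add_apply, add_mul, Finset.sum_add_distrib]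
          linarith)) s) k
      simp only [Matrix.sub_apply, Matrix.transpose_apply, Matrix.mul_apply, Matrix.of_apply,
        Matrix.add_apply, mul_add, Finset.sum_add_distrib] at this
      linarith
    refine exists_potential_of_closed hV hstar
      (fun s k => contDiffOn_sum_const_mul fun i => hc i j k) hanti fun u hu s t k => ?_
    have e : partialDeriv t (fun u => ∑ i, G⁻¹ k i * P.c i j s u) u
        = -partialDeriv t (fun u => ∑ i, G⁻¹ s i * P.c i j k u) u := by
      rw [partialDeriv_congr hV (fun v hv => hanti v hv k s) hu, partialDeriv, partialDeriv,
        fderiv_fun_neg]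
      rfl
    rw [e]
    simp only [partialDeriv_sum_const_mul hV (fun i => hc i j _) hu]
    -- Lowering the indices `a, b` of `c_closed`, with `j` and `k` fixed, gives the closedness
    -- identity up to the antisymmetry already used in `e`.
    have := congrFun (congrFun (Matrix.inv_mul_sub_transpose
      (X := .of fun i m => partialDeriv m (P.c i j k) u)
      (Y := .of fun i m => partialDeriv k (P.c i j m) u) h.isSymm h.isUnit_det (by
        ext a b
        have := h.c_closed (hVU hu) a j b k
        simpa only [Matrix.sub_apply, Matrix.transpose_apply, Matrix.mul_apply,
          Matrix.of_apply] using this)) s) t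
    simp only [Matrix.sub_apply, Matrix.transpose_apply, Matrix.mul_apply, Matrix.of_apply] at this
    linarith
  choose θ hθ hθc using key
  -- The sign accounts for `(*)` having `A^j_{s,k} - A^j_{k,s}`, opposite to the exterior derivative
  -- convention of the Poincaré lemma.
  refine ⟨fun j s u => -θ j s u, fun j s => (hθ j s).neg, fun u hu i j k => ?_⟩
  rw [← sum_mul_sum_inv_mul h.isUnit_det (fun i => P.c i j k u) i, ← Finset.sum_sub_distrib]
  refine Finset.sum_congr rfl fun s _ => ?_
  rw [hθc j u hu, partialDeriv, partialDeriv, partialDeriv, partialDeriv, fderiv_fun_neg,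
    fderiv_fun_neg]
  simp only [_root_.neg_apply]
  ring

/-- The tensor `B` matching `c` is free up to gradients `∂_s f^j`. Subtracting the `a` produced by
`B` from the actual one turns `a_cyclic` into a homogeneous cyclic identity, and the resulting
potential `f` supplies exactly the gradient correction needed. -/
theorem exists_isGivenByTensor (h : DeformationData U G L P) (hV : IsOpen V) (hVU : V ⊆ U)
    (hstar : StarConvex ℝ p V) :
    ∃ A, IsSmoothTensorField A V ∧ IsGivenByTensor V (fun _ => G) A P := by
  obtain ⟨B, hB, hc⟩ := h.exists_tensor_c hV hVU hstar
  have ha : ∀ i j, ContDiffOn ℝ ∞ (P.a i j) V := fun i j => (h.isAdmissible.1 i j).mono hVU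
  have hGs : ∀ i j, G i j = G j i := fun i j => h.isSymm.apply j i
  have hR : ∀ i j, ContDiffOn ℝ ∞ (fun u => ∑ r, G i r * B j r u) V := fun i j =>
    contDiffOn_sum_const_mul (hB j)
  -- Rewrites the right-hand side of `a_cyclic` through derivatives of the raised tensor `G B`, in
  -- the same form as the derivatives of `a` on its left-hand side.
  have hC : ∀ u ∈ V, ∀ i j l, ∑ m, P.c i j m u * G m l
      = ∑ m, partialDeriv m (fun u => ∑ r, G i r * B j r u) u * G m l
        - ∑ m, partialDeriv m (fun u => ∑ r, G l r * B j r u) u * G m i := by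
    intro u hu i j l
    simp only [hc u hu, partialDeriv_sum_const_mul hV (hB j) hu, sub_mul, Finset.sum_sub_distrib,
      Finset.sum_mul]
    congr 1
    rw [Finset.sum_comm]
    refine Finset.sum_congr rfl fun s _ => Finset.sum_congr rfl fun m _ => ?_
    rw [hGs s i, hGs m l]
    ring
  obtain ⟨f, hf, hα⟩ := exists_potential_of_cyclic hV hstar h.isSymm h.isUnit_det
    (α := fun i j u => P.a i j u - (∑ r, G i r * B j r u - ∑ r, G j r * B i r u))
    (fun i j => (ha i j).sub ((hR i j).sub (hR j i)))
    (fun u hu i j => by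
      rw [h.isInfinitesimalDeformation.a_skew (hVU hu) i j]
      ring)
    (fun u hu i j l => by
      have := h.a_cyclic (hVU hu) i j l
      rw [hC u hu, hC u hu, hC u hu] at this
      simp only [partialDeriv_sub hV (ha _ _) ((hR _ _).sub (hR _ _)) hu,
        partialDeriv_sub hV (hR _ _) (hR _ _) hu, sub_mul, Finset.sum_sub_distrib]
      linarith)
  have hf' : ∀ j s, ContDiffOn ℝ ∞ (partialDeriv s (f j)) V := fun j s =>
    (hf j).partialDeriv hV s
  refine ⟨fun j s u => B j s u + partialDeriv s (f j) u, fun j s => (hB j s).add (hf' j s),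
    h.isGivenByTensor_of_eq hV hVU (fun j s => (hB j s).add (hf' j s)) (fun u hu i j => ?_)
      fun u hu i j k => ?_⟩
  · have := hα u hu i j
    simp only [mul_add, Finset.sum_add_distrib]
    linarith
  -- The gradient correction drops out of `c` by symmetry of the second derivatives of `f`.
  · rw [hc u hu]
    simp only [partialDeriv_add hV (hB _ _) (hf' _ _) hu, mul_add, Finset.sum_add_distrib,
      partialDeriv_partialDeriv_comm hV (hf j) hu k]
    ring

end DeformationData

end Reconstruction

end

/-! ### The classification theorem -/

theorem mainTheorem7 {n : ℕ} (U : Set (Fin n → ℝ)) (hU : IsOpen U)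
    (P₁ : HydrodynamicOperator n) (hP₁ : P₁.IsHamiltonianInFlatCoordinates U) :
    (∀ P₂ : SecondOrderOperator n, P₂.IsAdmissible U →
      IsInfinitesimalDeformation U P₁.toOperator P₂.toOperator →
      ∀ V : Set (Fin n → ℝ), V ⊆ U → IsOpen V → (∃ p ∈ V, StarConvex ℝ p V) →
        ∃ A : Fin n → Fin n → (Fin n → ℝ) → ℝ,
          IsSmoothTensorField A V ∧ IsGivenByTensor V P₁.g A P₂ ∧
          IsMinusLieDerivative V (tensorEvolutionaryField A) P₁.toOperator P₂.toOperator) ∧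
    (∀ A : Fin n → Fin n → (Fin n → ℝ) → ℝ, IsSmoothTensorField A U →
      ∀ P₂ : SecondOrderOperator n, IsGivenByTensor U P₁.g A P₂ →
        P₂.IsAdmissible U ∧
        IsInfinitesimalDeformation U P₁.toOperator P₂.toOperator ∧
        IsMinusLieDerivative U (tensorEvolutionaryField A) P₁.toOperator P₂.toOperator) := by
  refine ⟨fun P₂ hP₂ h V hVU hV ⟨p, _, hstar⟩ => ?_, fun A hA P₂ hP₂ => ?_⟩
  · obtain ⟨G, hG, hGu, hg, hc⟩ := hP₁.exists_isConstantOperator hU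
    obtain ⟨A, hA, hAP⟩ := DeformationData.exists_isGivenByTensor
      ⟨hU, hG, hGu, hc, hP₂, h⟩ hV hVU hstar
    have hA' : IsGivenByTensor V P₁.g A P₂ := fun u hu => by
      rw [hg u (hVU hu)]
      exact hAP u hu
    -- Triviality on `V` follows from the form of the coefficients alone, with the hypotheses on
    -- `P₁` restricted to `V`.
    exact ⟨A, hA, hA', hA'.isMinusLieDerivative hV (hP₁.mono hVU) hA⟩
  · obtain ⟨h₁, h₂⟩ := hP₂.isInfinitesimalDeformation hU hP₁ hA
    exact ⟨h₁, h₂, hP₂.isMinusLieDerivative hU hP₁ hA⟩
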